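/- **Setting.** Let $\gamma>\frac13$ and $T>0$. Let $\mathcal A$ be a von Neumann algebra of bounded operators on a complex Hilbert space, with a trace $\varphi$ (a unital, positive, faithful, tracial, weakly continuous linear functional). Let $X:[0,T]\to\mathcal A$ be a path of self-adjoint elements that is $\gamma$-Hölder for the operator norm, and let $\mathcal A_t\subset\mathcal A$ be the von Neumann subalgebra generated by $\{X_s:0\le s\le t\}$. $\hat\otimes$ is the projective tensor product over $\mathbb C$; $\mathcal A_t^{\hat\otimes k}$ is mapped to $\mathcal A^{\hat\otimes k}$ by the inclusion $\mathcal A_t\subset\mathcal A$. A path $W$ in $\mathcal A$ or $\mathcal A^{\hat\otimes k}$ is *adapted* if $W_t\in\mathcal A_t$, resp. $W_t\in\mathcal A_t^{\hat\otimes k}$, for every $t\in[0,T]$. The following formulas extend linearly and continuously, except that $*$ is conjugate-linear: $$(a\otimes b)\sharp x=axb,\quad x\sharp(a\otimes b\otimes c)=(axb)\otimes c,\quad (a\otimes b\otimes c)\sharp x=a\otimes(bxc),\quad (a\otimes b)^*=b^*\otimes a^*.$$ For a Banach space $V$ and an interval $I\subset[0,T]$, put $(\delta f)_{st}=f_t-f_s$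 and $(\delta h)_{sut}=h_{st}-h_{su}-h_{ut}$ for $s\le u\le t$ in $I$. For $\alpha>0$, $\mathcal C_1^\alpha(I;V)$ is the set of continuous $f:I\to V$ with $\mathcal N[f;\mathcal C_1^\alpha(I)]=\sup_{s<t}\|(\delta f)_{st}\|/|t-s|^\alpha<\infty$, and $\mathcal N[f;\mathcal C_1^0(I)]=\sup_{t\in I}\|f_t\|$. $\mathcal C_2^\alpha(I;V)$ is the set of continuous $h$ on $\{s\le t\}$, zero on the diagonal, with $\mathcal N[h;\mathcal C_2^\alpha(I)]=\sup_{s<t}\|h_{st}\|/|t-s|^\alpha<\infty$. $\mathcal C_3^\mu(I;V)$ is the set of finite sums of continuous $h^i$ on $\{s\le u\le t\}$, zero if two of the times are equal, with $\sup_{s<u<t}\|h^i_{sut}\|/(|t-u|^{\alpha_i}|u-s|^{\mu-\alpha_i})<\infty$ for some $0\le\alpha_i\le\mu$. If $\mu>1$ and there is a unique element of $\mathcal C_2^\mu([0,T];V)$ whose image under $\delta$ is $h$, it is denoted $\Lambda h$. A *product Lévy area* above $X$ is a family of bounded operators $\mathbf X_{st}:\mathcal A_s\hat\otimes\mathcal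 A_s\to\mathcal A_t$, $0\le s<t\le T$ (with $\mathbf X_{tt}=0$ by convention), such that $\mathcal N[\mathbf X]:=\sup_{s<t}\|\mathbf X_{st}\|/|t-s|^{2\gamma}<\infty$ and, for all $s<u<t$ and $\mathbf W\in\mathcal A_s\hat\otimes\mathcal A_s$, $$\mathbf X_{st}[\mathbf W]-\mathbf X_{su}[\mathbf W]-\mathbf X_{ut}[\mathbf W]=(\mathbf W\sharp(\delta X)_{su})\,(\delta X)_{ut}.$$ Put $\mathbf X^*_{st}[\mathbf W]=\mathbf X_{st}[\mathbf W^*]^*$, $[\mathbf X_{st}\times\mathrm{Id}](a\otimes b\otimes c)=\mathbf X_{st}[a\otimes b]\,c$ and $[\mathrm{Id}\times\mathbf X^*_{st}](a\otimes b\otimes c)=a\,\mathbf X^*_{st}[b\otimes c]$ on $\mathcal A_s^{\hat\otimes3}$. $\mathcal Q(X)$ is the set of adapted $Y\in\mathcal C_1^\gamma([0,T];\mathcal A)$ with $(\delta Y)_{st}=\mathbf Y^X_s\sharp(\delta X)_{st}+Y^\flat_{st}$, where $\mathbf Y^X\in\mathcal C_1^\gamma([0,T];\mathcal A^{\hat\otimes2})$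 is adapted and $Y^\flat\in\mathcal C_2^{2\gamma}([0,T];\mathcal A)$. For such a decomposition, $$\mathcal N[Y;\mathcal Q(I;X)]=\mathcal N[Y;\mathcal C_1^\gamma(I)]+\mathcal N[\mathbf Y^X;\mathcal C_1^0(I)]+\mathcal N[\mathbf Y^X;\mathcal C_1^\gamma(I)]+\mathcal N[Y^\flat;\mathcal C_2^{2\gamma}(I)].$$ $\mathbf Q(X)$ is the set of adapted $\mathbf U\in\mathcal C_1^\gamma([0,T];\mathcal A^{\hat\otimes2})$ with $(\delta\mathbf U)_{st}=(\delta X)_{st}\sharp\mathbb U^{1}_s+\mathbb U^{2}_s\sharp(\delta X)_{st}+\mathbf U^\flat_{st}$, where $\mathbb U^{1},\mathbb U^{2}\in\mathcal C_1^\gamma([0,T];\mathcal A^{\hat\otimes3})$ are adapted and $\mathbf U^\flat\in\mathcal C_2^{2\gamma}([0,T];\mathcal A^{\hat\otimes2})$. For such a decomposition, $$\mathcal N[\mathbf U;\mathbf Q(I;X)]=\mathcal N[\mathbf U;\mathcal C_1^\gamma(I)]+\sum_{i=1,2}\big\{\mathcal N[\mathbb U^{i};\mathcal C_1^0(I)]+\mathcal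 N[\mathbb U^{i};\mathcal C_1^\gamma(I)]\big\}+\mathcal N[\mathbf U^\flat;\mathcal C_2^{2\gamma}(I)].$$ **Proposition.** Let $\mathbf X$ be a product Lévy area above $X$. For $\mathbf U\in\mathbf Q(X)$ with a decomposition as above, set $\mathcal J_{st}(\mathbf U\sharp dX):=M_{st}-(\Lambda\delta M)_{st}$, where $$M_{st}:=\mathbf U_s\sharp(\delta X)_{st}+[\mathbf X_{st}\times\mathrm{Id}](\mathbb U^{1}_s)+[\mathrm{Id}\times\mathbf X^*_{st}](\mathbb U^{2}_s).$$ 1. $\delta M\in\mathcal C_3^{3\gamma}([0,T];\mathcal A)$, the element $\Lambda\delta M$ of $\mathcal C_2^{3\gamma}([0,T];\mathcal A)$ exists and is unique, and $\mathcal J(\mathbf U\sharp dX)\in\mathcal C_2^\gamma([0,T];\mathcal A)$. 2. If $X$ is differentiable on $[0,T]$ with Lebesgue (Bochner) integrable derivative $X'$, and $\mathbf X_{st}[\mathbf W]=\int_s^t(\mathbf W\sharp(\delta X)_{su})X'_u\,du$ for all $s\le t$ and $\mathbf W\in\mathcal A_s\hat\otimes\mathcal A_s$, then, for all $s\le t$,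 $u\mapsto\mathbf U_u\sharp X'_u$ is integrable on $[s,t]$ and $\mathcal J_{st}(\mathbf U\sharp dX)=\int_s^t\mathbf U_u\sharp X'_u\,du$. 3. For every $A\in\mathcal A$ there is a unique path $Z:[0,T]\to\mathcal A$ with $Z_0=A$ and $(\delta Z)_{st}=\mathcal J_{st}(\mathbf U\sharp dX)$ for all $s\le t$. Moreover $Y:=Z-A$ belongs to $\mathcal Q(X)$, with $\mathbf Y^X=\mathbf U$ in its decomposition; and if $A\in\mathcal A_0$, then $Z\in\mathcal Q(X)$, with $\mathbf Z^X=\mathbf U$. 4. For the path $Z$ of item 3, with $\mathbf Z^X=\mathbf U$ and $Z^\flat_{st}=(\delta Z)_{st}-\mathbf U_s\sharp(\delta X)_{st}$ in the expression $\mathcal N[Z;\mathcal Q(I;X)]$, and every interval $I=[\ell_1,\ell_2]\subset[0,T]$, $$\mathcal N[Z;\mathcal Q(I;X)]\le c_X\big\{1+\mathcal N[\mathbf U;\mathcal C_1^0(I)]+\|\mathbb U^{1}_{\ell_1}\|+\|\mathbb U^{2}_{\ell_1}\|+|I|^\gamma\,\mathcal N[\mathbf U;\mathbf Q(I;X)]\big\},$$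 where $c_X=a+b\,\mathcal N[X;\mathcal C_1^\gamma([0,T])]+c\,\mathcal N[\mathbf X]$ with constants $a,b,c\ge0$ that depend only on $\gamma$ and $T$. -/

import Mathlib

open scoped ENNReal NNReal TensorProduct

universe u

noncomputable section

namespace ProductArea

/-! ### Projective tensor powers -/

section Tensor

variable {B C G : Type*}
  [NormedRing B] [NormedAlgebra ℂ B] [NormedRing C] [NormedAlgebra ℂ C]
  [NormedAddCommGroup G] [NormedSpace ℂ G]

/-- The projective tensor power of `B` with `k` factors: the completion of the algebraic tensor
power over `ℂ` for the projective norm, which is the norm that Mathlib puts on `⨂[ℂ] _, B`. -/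
def PT (B : Type*) [NormedRing B] [NormedAlgebra ℂ B] (k : ℕ) : Type _ :=
  UniformSpace.Completion (⨂[ℂ] _ : Fin k, B)

instance (k : ℕ) : NormedAddCommGroup (PT B k) :=
  inferInstanceAs (NormedAddCommGroup (UniformSpace.Completion (⨂[ℂ] _ : Fin k, B)))

instance (k : ℕ) : NormedSpace ℂ (PT B k) :=
  inferInstanceAs (NormedSpace ℂ (UniformSpace.Completion (⨂[ℂ] _ : Fin k, B)))

instance (k : ℕ) : CompleteSpace (PT B k) :=
  inferInstanceAs (CompleteSpace (UniformSpace.Completion (⨂[ℂ] _ : Fin k, B)))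

/-- The canonical map of the algebraic tensor power to its completion. -/
def toPT (B : Type*) [NormedRing B] [NormedAlgebra ℂ B] (k : ℕ) :
    (⨂[ℂ] _ : Fin k, B) →L[ℂ] PT B k :=
  UniformSpace.Completion.toComplL (𝕜 := ℂ) (E := ⨂[ℂ] _ : Fin k, B)

/-- The elementary tensors, as a bounded multilinear map. -/
def tens (B : Type*) [NormedRing B] [NormedAlgebra ℂ B] (k : ℕ) :
    ContinuousMultilinearMap ℂ (fun _ : Fin k => B) (PT B k) :=
  (toPT B k).compContinuousMultilinearMap (PiTensorProduct.tprodL ℂ)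

/-- The bounded linear map on the projective tensor power that extends a bounded multilinear map
(given on elementary tensors). -/
def extPT [CompleteSpace G] {k : ℕ} (f : ContinuousMultilinearMap ℂ (fun _ : Fin k => B) G) :
    PT B k →L[ℂ] G :=
  ContinuousLinearMap.fromCompletion (α := ⨂[ℂ] _ : Fin k, B) (PiTensorProduct.liftIsometry ℂ (fun _ : Fin k => B) G f)

theorem extPT_toPT [CompleteSpace G] {k : ℕ}
    (f : ContinuousMultilinearMap ℂ (fun _ : Fin k => B) G) (x : ⨂[ℂ] _ : Fin k, B) :
    extPT f (toPT B k x) = PiTensorProduct.lift f.toMultilinearMap x := by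
  have h := ContinuousLinearMap.fromCompletion_apply_coe
    (PiTensorProduct.liftIsometry ℂ (fun _ : Fin k => B) G f) x
  rw [PiTensorProduct.liftIsometry_apply_apply] at h
  exact h

theorem extPT_tens [CompleteSpace G] {k : ℕ}
    (f : ContinuousMultilinearMap ℂ (fun _ : Fin k => B) G) (v : Fin k → B) :
    extPT f (tens B k v) = f v := by
  have h := extPT_toPT f (PiTensorProduct.tprod ℂ v)
  rw [PiTensorProduct.lift.tprod] at h
  simpa [tens] using h

/-- The elementary tensor `a ⊗ b`. -/
def tens₂ (a b : B) : PT B 2 := tens B 2 ![a, b]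

theorem norm_tens_le {k : ℕ} (v : Fin k → B) : ‖tens B k v‖ ≤ ∏ i, ‖v i‖ := by
  have h : ‖toPT B k (PiTensorProduct.tprod ℂ v)‖ = ‖PiTensorProduct.tprod ℂ v‖ :=
    UniformSpace.Completion.norm_coe _
  have h' := PiTensorProduct.projectiveSeminorm_tprod_le (𝕜 := ℂ) v
  simpa [tens, h] using h'

theorem norm_tens₂_le (a b : B) : ‖tens₂ a b‖ ≤ ‖a‖ * ‖b‖ := by
  simpa [tens₂, Fin.prod_univ_two] using norm_tens_le ![a, b]

theorem update_vec_zero {B : Type*} (a b x : B) : Function.update ![a, b] 0 x = ![x, b] := by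
  ext i; fin_cases i <;> rfl

theorem update_vec_one {B : Type*} (a b x : B) : Function.update ![a, b] 1 x = ![a, x] := by
  ext i; fin_cases i <;> rfl

theorem tens₂_add_left (a a' b : B) : tens₂ (a + a') b = tens₂ a b + tens₂ a' b := by
  have h := (tens B 2).map_update_add ![a, b] 0 a a'
  rwa [update_vec_zero, update_vec_zero, update_vec_zero] at h

theorem tens₂_smul_left (c : ℂ) (a b : B) : tens₂ (c • a) b = c • tens₂ a b := by
  have h := (tens B 2).map_update_smul ![a, b] 0 c a
  rwa [update_vec_zero, update_vec_zero] at h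

theorem tens₂_add_right (a b b' : B) : tens₂ a (b + b') = tens₂ a b + tens₂ a b' := by
  have h := (tens B 2).map_update_add ![a, b] 1 b b'
  rwa [update_vec_one, update_vec_one, update_vec_one] at h

theorem tens₂_smul_right (c : ℂ) (a b : B) : tens₂ a (c • b) = c • tens₂ a b := by
  have h := (tens B 2).map_update_smul ![a, b] 1 c b
  rwa [update_vec_one, update_vec_one] at h

/-- A bounded bilinear map, as a bounded multilinear map on two factors. -/
def mk₂ (f : B → B → G) (C : ℝ)
    (hal : ∀ a a' b, f (a + a') b = f a b + f a' b) (hsl : ∀ (z : ℂ) a b, f (z • a) b = z • f a b)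
    (har : ∀ a b b', f a (b + b') = f a b + f a b') (hsr : ∀ (z : ℂ) a b, f a (z • b) = z • f a b)
    (hC : ∀ a b, ‖f a b‖ ≤ C * (‖a‖ * ‖b‖)) :
    ContinuousMultilinearMap ℂ (fun _ : Fin 2 => B) G :=
  MultilinearMap.mkContinuous
    (MultilinearMap.mk' (fun v : Fin 2 → B => f (v 0) (v 1))
      (by intro m i x y; fin_cases i <;> simp [hal, har])
      (by intro m i c x; fin_cases i <;> simp [hsl, hsr]))
    C (by intro m; simpa [Fin.prod_univ_two] using hC (m 0) (m 1))

/-- A bounded trilinear map, as a bounded multilinear map on three factors. -/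
def mk₃ (f : B → B → B → G) (C : ℝ)
    (h1 : ∀ a a' b c, f (a + a') b c = f a b c + f a' b c)
    (s1 : ∀ (z : ℂ) a b c, f (z • a) b c = z • f a b c)
    (h2 : ∀ a b b' c, f a (b + b') c = f a b c + f a b' c)
    (s2 : ∀ (z : ℂ) a b c, f a (z • b) c = z • f a b c)
    (h3 : ∀ a b c c', f a b (c + c') = f a b c + f a b c')
    (s3 : ∀ (z : ℂ) a b c, f a b (z • c) = z • f a b c)
    (hC : ∀ a b c, ‖f a b c‖ ≤ C * (‖a‖ * ‖b‖ * ‖c‖)) :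
    ContinuousMultilinearMap ℂ (fun _ : Fin 3 => B) G :=
  MultilinearMap.mkContinuous
    (MultilinearMap.mk' (fun v : Fin 3 → B => f (v 0) (v 1) (v 2))
      (by intro m i x y; fin_cases i <;> simp [h1, h2, h3])
      (by intro m i c x; fin_cases i <;> simp [s1, s2, s3]))
    C (by intro m; simpa [Fin.prod_univ_three] using hC (m 0) (m 1) (m 2))

/-- `(a ⊗ b) ♯ x = a x b`. -/
def sharp [CompleteSpace B] (U : PT B 2) (x : B) : B :=
  extPT (mk₂ (fun a b : B => a * x * b) ‖x‖
    (by intros; simp [add_mul]) (by intros; simp)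
    (by intros; simp [mul_add]) (by intros; simp)
    (by intro a b
        calc ‖a * x * b‖ ≤ ‖a‖ * ‖x‖ * ‖b‖ := norm_mul₃_le
          _ = ‖x‖ * (‖a‖ * ‖b‖) := by ring)) U

/-- `x ♯ (a ⊗ b ⊗ c) = (a x b) ⊗ c`. -/
def sharpL (x : B) (W : PT B 3) : PT B 2 :=
  extPT (mk₃ (fun a b c : B => tens₂ (a * x * b) c) ‖x‖
    (by intros; simp [add_mul, tens₂_add_left]) (by intros; simp [tens₂_smul_left])
    (by intros; simp [mul_add, tens₂_add_left]) (by intros; simp [tens₂_smul_left])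
    (by intros; simp [tens₂_add_right]) (by intros; simp [tens₂_smul_right])
    (by intro a b c
        calc ‖tens₂ (a * x * b) c‖ ≤ ‖a * x * b‖ * ‖c‖ := norm_tens₂_le _ _
          _ ≤ ‖a‖ * ‖x‖ * ‖b‖ * ‖c‖ := by gcongr; exact norm_mul₃_le
          _ = ‖x‖ * (‖a‖ * ‖b‖ * ‖c‖) := by ring)) W

/-- `(a ⊗ b ⊗ c) ♯ x = a ⊗ (b x c)`. -/
def sharpR (W : PT B 3) (x : B) : PT B 2 :=
  extPT (mk₃ (fun a b c : B => tens₂ a (b * x * c)) ‖x‖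
    (by intros; simp [tens₂_add_left]) (by intros; simp [tens₂_smul_left])
    (by intros; simp [add_mul, tens₂_add_right]) (by intros; simp [tens₂_smul_right])
    (by intros; simp [mul_add, tens₂_add_right]) (by intros; simp [tens₂_smul_right])
    (by intro a b c
        calc ‖tens₂ a (b * x * c)‖ ≤ ‖a‖ * ‖b * x * c‖ := norm_tens₂_le _ _
          _ ≤ ‖a‖ * (‖b‖ * ‖x‖ * ‖c‖) := by gcongr; exact norm_mul₃_le
          _ = ‖x‖ * (‖a‖ * ‖b‖ * ‖c‖) := by ring)) W

/-- The map of projective tensor powers induced by a bounded linear map of the factors: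
`a₁ ⊗ ⋯ ⊗ aₖ ↦ j a₁ ⊗ ⋯ ⊗ j aₖ`. -/
def mapPT (j : B →L[ℂ] C) (k : ℕ) : PT B k →L[ℂ] PT C k :=
  extPT ((tens C k).compContinuousLinearMap fun _ => j)

end Tensor

/-! ### Operators on tensors over a *-subalgebra -/

section Sub

variable {A : Type*} [NormedRing A] [NormedAlgebra ℂ A] [StarRing A] [StarModule ℂ A]

/-- The inclusion of a *-subalgebra, as a bounded linear map. -/
def incl (S : StarSubalgebra ℂ A) : S →L[ℂ] A :=
  LinearMap.mkContinuous S.subtype.toAlgHom.toLinearMap 1 (by intro x; simp)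

/-- The inclusion between two nested *-subalgebras, as a bounded linear map. -/
def inclLE {S S' : StarSubalgebra ℂ A} (h : S ≤ S') : S →L[ℂ] S' :=
  LinearMap.mkContinuous (StarSubalgebra.inclusion h).toAlgHom.toLinearMap 1
    (by intro x; rw [one_mul]; exact le_rfl)

variable [CStarRing A] [CompleteSpace A] {S : StarSubalgebra ℂ A}

/-- The adjoint `L*` of a bounded operator on `S ⊗ S`, namely `L*[U] = L[U*]*` where
`(a ⊗ b)* = b* ⊗ a*`; it is the bounded linear map with `L*[a ⊗ b] = L[b* ⊗ a*]*`. -/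
def adjOp (L : PT S 2 →L[ℂ] A) : PT S 2 →L[ℂ] A :=
  extPT (mk₂ (fun a b : S => star (L (tens₂ (star b) (star a)))) ‖L‖
    (by intros; simp [tens₂_add_right]) (by intros; simp [tens₂_smul_right])
    (by intros; simp [tens₂_add_left]) (by intros; simp [tens₂_smul_left])
    (by intro a b
        calc ‖star (L (tens₂ (star b) (star a)))‖ = ‖L (tens₂ (star b) (star a))‖ := norm_star _
          _ ≤ ‖L‖ * ‖tens₂ (star b) (star a)‖ := L.le_opNorm _
          _ ≤ ‖L‖ * (‖star b‖ * ‖star a‖) := by gcongr; exact norm_tens₂_le _ _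
          _ = ‖L‖ * (‖a‖ * ‖b‖) := by rw [norm_star, norm_star]; ring))

/-- The operator `L × Id` on `S ⊗ S ⊗ S`: `(L × Id)(a ⊗ b ⊗ c) = L[a ⊗ b] c`. -/
def timesId (L : PT S 2 →L[ℂ] A) : PT S 3 →L[ℂ] A :=
  extPT (mk₃ (fun a b c : S => L (tens₂ a b) * (c : A)) ‖L‖
    (by intros; simp [add_mul, tens₂_add_left]) (by intros; simp [tens₂_smul_left])
    (by intros; simp [add_mul, tens₂_add_right]) (by intros; simp [tens₂_smul_right])
    (by intros; simp [mul_add]) (by intros; simp)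
    (by intro a b c
        calc ‖L (tens₂ a b) * (c : A)‖ ≤ ‖L (tens₂ a b)‖ * ‖(c : A)‖ := norm_mul_le _ _
          _ ≤ ‖L‖ * (‖a‖ * ‖b‖) * ‖c‖ := by
            gcongr
            · exact (L.le_opNorm _).trans (by gcongr; exact norm_tens₂_le _ _)
            · exact le_rfl
          _ = ‖L‖ * (‖a‖ * ‖b‖ * ‖c‖) := by ring))

/-- The operator `Id × L` on `S ⊗ S ⊗ S`: `(Id × L)(a ⊗ b ⊗ c) = a L[b ⊗ c]`. -/
def idTimes (L : PT S 2 →L[ℂ] A) : PT S 3 →L[ℂ] A :=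
  extPT (mk₃ (fun a b c : S => (a : A) * L (tens₂ b c)) ‖L‖
    (by intros; simp [add_mul]) (by intros; simp)
    (by intros; simp [mul_add, tens₂_add_left]) (by intros; simp [tens₂_smul_left])
    (by intros; simp [mul_add, tens₂_add_right]) (by intros; simp [tens₂_smul_right])
    (by intro a b c
        calc ‖(a : A) * L (tens₂ b c)‖ ≤ ‖(a : A)‖ * ‖L (tens₂ b c)‖ := norm_mul_le _ _
          _ ≤ ‖a‖ * (‖L‖ * (‖b‖ * ‖c‖)) := by
            gcongr
            · exact le_rfl
            · exact (L.le_opNorm _).trans (by gcongr; exact norm_tens₂_le _ _)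
          _ = ‖L‖ * (‖a‖ * ‖b‖ * ‖c‖) := by ring))

end Sub

/-! ### Increments, Hölder spaces, sewing map -/

section Holder

variable {V : Type*} [NormedAddCommGroup V]

/-- `(δ f)_{st} = f_t - f_s`. -/
def incr (f : ℝ → V) (s t : ℝ) : V := f t - f s

/-- `(δ h)_{sut} = h_{st} - h_{su} - h_{ut}`. -/
def cobd (h : ℝ → ℝ → V) (s r t : ℝ) : V := h s t - h s r - h r t

/-- `sup_{s < t ∈ I} n_{st} / |t - s|^α`, with values in `[0, ∞]`. -/
def holderSup (α : ℝ) (I : Set ℝ) (n : ℝ → ℝ → ℝ) : ℝ≥0∞ :=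
  ⨆ (s ∈ I) (t ∈ I) (_ : s < t), ENNReal.ofReal (n s t / (t - s) ^ α)

/-- The seminorm of `C_1^α(I; V)` for `α > 0`. -/
def N1 (α : ℝ) (I : Set ℝ) (f : ℝ → V) : ℝ≥0∞ := holderSup α I fun s t => ‖incr f s t‖

/-- The supremum norm on `I`, that is the norm of `C_1^0(I; V)`. -/
def N0 (I : Set ℝ) (f : ℝ → V) : ℝ≥0∞ := ⨆ t ∈ I, ENNReal.ofReal ‖f t‖

/-- The norm of `C_2^α(I; V)`. -/
def N2 (α : ℝ) (I : Set ℝ) (h : ℝ → ℝ → V) : ℝ≥0∞ := holderSup α I fun s t => ‖h s t‖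

/-- The norm of `C_3^{(α, β)}(I; V)`. -/
def N3 (α β : ℝ) (I : Set ℝ) (h : ℝ → ℝ → ℝ → V) : ℝ≥0∞ :=
  ⨆ (s ∈ I) (r ∈ I) (t ∈ I) (_ : s < r) (_ : r < t),
    ENNReal.ofReal (‖h s r t‖ / ((t - r) ^ α * (r - s) ^ β))

/-- `f ∈ C_1^α(I; V)`. -/
structure MemC1 (α : ℝ) (I : Set ℝ) (f : ℝ → V) : Prop where
  cont : ContinuousOn f I
  finite : N1 α I f ≠ ∞

/-- `h ∈ C_2^α(I; V)`: continuous on the simplex, zero on the diagonal, finite norm. -/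
structure MemC2 (α : ℝ) (I : Set ℝ) (h : ℝ → ℝ → V) : Prop where
  cont : ContinuousOn (fun p : ℝ × ℝ => h p.1 p.2) {p | p.1 ∈ I ∧ p.2 ∈ I ∧ p.1 ≤ p.2}
  diag : ∀ t ∈ I, h t t = 0
  finite : N2 α I h ≠ ∞

/-- `h ∈ C_3^{(α, β)}(I; V)`: continuous on the simplex, zero on the diagonals, finite norm. -/
structure MemC3' (α β : ℝ) (I : Set ℝ) (h : ℝ → ℝ → ℝ → V) : Prop where
  cont : ContinuousOn (fun p : ℝ × ℝ × ℝ => h p.1 p.2.1 p.2.2)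
    {p | p.1 ∈ I ∧ p.2.1 ∈ I ∧ p.2.2 ∈ I ∧ p.1 ≤ p.2.1 ∧ p.2.1 ≤ p.2.2}
  diag_left : ∀ s ∈ I, ∀ t ∈ I, s ≤ t → h s s t = 0
  diag_right : ∀ s ∈ I, ∀ t ∈ I, s ≤ t → h s t t = 0
  finite : N3 α β I h ≠ ∞

/-- `h ∈ C_3^μ(I; V)`, the sum of the spaces `C_3^{(α, μ - α)}(I; V)` over `0 ≤ α ≤ μ`: on the
simplex `h` is a finite sum of elements of these spaces. -/
def MemC3 (μ : ℝ) (I : Set ℝ) (h : ℝ → ℝ → ℝ → V) : Prop :=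
  ∃ (n : ℕ) (α : Fin n → ℝ) (g : Fin n → ℝ → ℝ → ℝ → V),
    (∀ i, 0 ≤ α i ∧ α i ≤ μ ∧ MemC3' (α i) (μ - α i) I (g i)) ∧
    ∀ s ∈ I, ∀ r ∈ I, ∀ t ∈ I, s ≤ r → r ≤ t → h s r t = ∑ i, g i s r t

/-- `N` is an element of `C_2^μ([0, T]; V)` with `δ N = h`. -/
def IsSewing (μ T : ℝ) (h : ℝ → ℝ → ℝ → V) (N : ℝ → ℝ → V) : Prop :=
  MemC2 μ (Set.Icc 0 T) N ∧
    ∀ s r t, 0 ≤ s → s ≤ r → r ≤ t → t ≤ T → cobd N s r t = h s r t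

/-- The sewing map `Λ`: an element `Λ h` of `C_2^μ([0, T]; V)` with `δ (Λ h) = h` (it is
meaningful when there is such an element and it is unique on the simplex). -/
def sewing (μ T : ℝ) (h : ℝ → ℝ → ℝ → V) : ℝ → ℝ → V :=
  open Classical in if hN : ∃ N, IsSewing μ T h N then hN.choose else 0

end Holder

/-! ### Non-commutative probability spaces and filtrations -/

section Prob

variable {H : Type*} [NormedAddCommGroup H] [InnerProductSpace ℂ H] [CompleteSpace H]

instance (A : VonNeumannAlgebra H) : CompleteSpace A.toStarSubalgebra := by
  have h : IsClosed (A.toStarSubalgebra : Set (H →L[ℂ] H)) := by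
    rw [VonNeumannAlgebra.coe_toStarSubalgebra, ← A.centralizer_centralizer]
    exact Set.isClosed_centralizer _
  exact h.completeSpace_coe

/-- `φ` is a unital, positive, faithful, tracial and weakly continuous linear functional on `A`
(continuity for the weak operator topology is asked on the unit ball only). -/
structure IsTrace (A : VonNeumannAlgebra H) (φ : A.toStarSubalgebra →ₗ[ℂ] ℂ) : Prop where
  map_one : φ 1 = 1
  nonneg : ∀ a, 0 ≤ (φ (a * star a)).re ∧ (φ (a * star a)).im = 0
  faithful : ∀ a, φ (a * star a) = 0 → a = 0
  tracial : ∀ a b, φ (a * b) = φ (b * a)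
  weak_cont : @Continuous {a : A.toStarSubalgebra // ‖a‖ ≤ 1} ℂ
    (TopologicalSpace.induced
      (fun a => (ContinuousLinearMapWOT.ofCLM (a.1 : H →L[ℂ] H) : H →WOT[ℂ] H)) inferInstance)
    inferInstance (fun a => φ a.1)

/-- An increasing family of *-subalgebras indexed by time. -/
structure Filtr (A : Type*) [NormedRing A] [NormedAlgebra ℂ A] [StarRing A] [StarModule ℂ A] where
  alg : ℝ → StarSubalgebra ℂ A
  mono : ∀ {s t}, s ≤ t → alg s ≤ alg t

/-- The filtration generated by the path `X`: at time `t`, the von Neumann subalgebra of `A`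
generated by `X_s`, `0 ≤ s ≤ t` (the double commutant of these operators). -/
def genFiltr (A : VonNeumannAlgebra H) (X : ℝ → A.toStarSubalgebra) : Filtr A.toStarSubalgebra where
  alg t := (StarSubalgebra.centralizer ℂ (StarSubalgebra.centralizer ℂ
    {x : H →L[ℂ] H | ∃ s, 0 ≤ s ∧ s ≤ t ∧ x = X s} : Set (H →L[ℂ] H))).comap
      A.toStarSubalgebra.subtype
  mono {s t} hst := by
    apply StarSubalgebra.comap_mono
    apply StarSubalgebra.centralizer_le
    apply StarSubalgebra.centralizer_le
    rintro x ⟨r, h0, hr, rfl⟩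
    exact ⟨r, h0, hr.trans hst, rfl⟩

end Prob

/-! ### Product Lévy area, controlled processes and biprocesses, integral -/

section Rough

variable {A : Type*} [NormedRing A] [NormedAlgebra ℂ A] [StarRing A] [StarModule ℂ A]
  [CStarRing A] [CompleteSpace A]

/-- The path in `A ⊗ ⋯ ⊗ A` underlying an adapted path with values in `A_t ⊗ ⋯ ⊗ A_t`. -/
def emb (F : Filtr A) {k : ℕ} (U : ∀ t, PT (F.alg t) k) (t : ℝ) : PT A k :=
  mapPT (incl (F.alg t)) k (U t)

/-- The norm of `C_2^λ(L(A_→))` on `[0, T]`: the supremum over `s < t` of the operator norms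
divided by `|t - s|^λ`. -/
def areaNorm (F : Filtr A) (lam T : ℝ) (XX : ∀ s : ℝ, ℝ → (PT (F.alg s) 2 →L[ℂ] A)) : ℝ≥0∞ :=
  holderSup lam (Set.Icc 0 T) fun s t => ‖XX s t‖

/-- `XX` is a product Lévy area above `X`. Only the operators `XX_{st}` with `s < t` matter; by
convention `XX_{tt} = 0`. -/
structure IsProductLevyArea (F : Filtr A) (γ T : ℝ) (X : ℝ → A)
    (XX : ∀ s : ℝ, ℝ → (PT (F.alg s) 2 →L[ℂ] A)) : Prop where
  diag : ∀ t, XX t t = 0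
  adapted : ∀ s t, 0 ≤ s → s < t → t ≤ T → ∀ U, XX s t U ∈ F.alg t
  holder : areaNorm F (2 * γ) T XX ≠ ∞
  chen : ∀ s r t (hsr : s < r), 0 ≤ s → r < t → t ≤ T → ∀ U : PT (F.alg s) 2,
    XX s t U - XX s r U - XX r t (mapPT (inclLE (F.mono hsr.le)) 2 U) =
      sharp (mapPT (incl (F.alg s)) 2 U) (incr X s r) * incr X r t

/-- The remainder `Y^♭` of a process `Y` with derivative `Y'`. -/
def rem (F : Filtr A) (X Y : ℝ → A) (Y' : ∀ t, PT (F.alg t) 2) (s t : ℝ) : A :=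
  incr Y s t - sharp (emb F Y' s) (incr X s t)

/-- `Y ∈ Q(X)`, with `Y^X = Y'` in its decomposition. -/
structure IsControlled (F : Filtr A) (γ T : ℝ) (X Y : ℝ → A) (Y' : ∀ t, PT (F.alg t) 2) :
    Prop where
  adapted : ∀ t ∈ Set.Icc 0 T, Y t ∈ F.alg t
  holder : MemC1 γ (Set.Icc 0 T) Y
  holder_deriv : MemC1 γ (Set.Icc 0 T) (emb F Y')
  rem_mem : MemC2 (2 * γ) (Set.Icc 0 T) (rem F X Y Y')

/-- The seminorm `N[Y; Q(I; X)]` for the decomposition with `Y^X = Y'`. -/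
def normQ (F : Filtr A) (γ : ℝ) (I : Set ℝ) (X Y : ℝ → A) (Y' : ∀ t, PT (F.alg t) 2) : ℝ≥0∞ :=
  N1 γ I Y + N0 I (emb F Y') + N1 γ I (emb F Y') + N2 (2 * γ) I (rem F X Y Y')

/-- The remainder `U^♭` of a biprocess `U` with derivatives `U1, U2`. -/
def birem (F : Filtr A) (X : ℝ → A) (U : ∀ t, PT (F.alg t) 2) (U1 U2 : ∀ t, PT (F.alg t) 3)
    (s t : ℝ) : PT A 2 :=
  incr (emb F U) s t - sharpL (incr X s t) (emb F U1 s) - sharpR (emb F U2 s) (incr X s t)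

/-- `U ∈ 𝐐(X)`, with the derivatives `U1, U2` in its decomposition. -/
structure IsBicontrolled (F : Filtr A) (γ T : ℝ) (X : ℝ → A) (U : ∀ t, PT (F.alg t) 2)
    (U1 U2 : ∀ t, PT (F.alg t) 3) : Prop where
  holder : MemC1 γ (Set.Icc 0 T) (emb F U)
  holder_deriv1 : MemC1 γ (Set.Icc 0 T) (emb F U1)
  holder_deriv2 : MemC1 γ (Set.Icc 0 T) (emb F U2)
  rem_mem : MemC2 (2 * γ) (Set.Icc 0 T) (birem F X U U1 U2)

/-- The seminorm `N[U; 𝐐(I; X)]` for the decomposition with derivatives `U1, U2`. -/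
def normBQ (F : Filtr A) (γ : ℝ) (I : Set ℝ) (X : ℝ → A) (U : ∀ t, PT (F.alg t) 2)
    (U1 U2 : ∀ t, PT (F.alg t) 3) : ℝ≥0∞ :=
  N1 γ I (emb F U) + ((N0 I (emb F U1) + N1 γ I (emb F U1)) + (N0 I (emb F U2) + N1 γ I (emb F U2)))
    + N2 (2 * γ) I (birem F X U U1 U2)

/-- `M_{st} = U_s ♯ (δX)_{st} + [XX_{st} × Id](U1_s) + [Id × XX*_{st}](U2_s)`. -/
def expansion (F : Filtr A) (X : ℝ → A) (XX : ∀ s : ℝ, ℝ → (PT (F.alg s) 2 →L[ℂ] A))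
    (U : ∀ t, PT (F.alg t) 2) (U1 U2 : ∀ t, PT (F.alg t) 3) (s t : ℝ) : A :=
  sharp (emb F U s) (incr X s t) + timesId (XX s t) (U1 s) + idTimes (adjOp (XX s t)) (U2 s)

/-- The integral `J(U ♯ dX) = (Id - Λ δ)(M)`. -/
def roughInt (F : Filtr A) (γ T : ℝ) (X : ℝ → A) (XX : ∀ s : ℝ, ℝ → (PT (F.alg s) 2 →L[ℂ] A))
    (U : ∀ t, PT (F.alg t) 2) (U1 U2 : ∀ t, PT (F.alg t) 3) (s t : ℝ) : A :=
  expansion F X XX U U1 U2 s t - sewing (3 * γ) T (cobd (expansion F X XX U U1 U2)) s t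

end Rough

end ProductArea

end

/-! By the Chen relation and the decomposition of `δU`, every term of `δM` is a product of two
increments or remainders whose Hölder exponents add up to `3γ > 1`, so the sewing lemma corrects
the germ `M` to an additive function `J`, the limit of the Riemann sums of `M`. Adaptedness of the
primitive and, for differentiable `X`, the equality with the Lebesgue integral pass to this limit.

The area acts on `A_s ⊗ A_s` with its own projective norm, while `U` is Hölder in `A ⊗ A`. The two
norms agree on `A_s ⊗ A_s`, because the trace yields a contractive conditional expectation
`A → A_s`, and projective tensor powers are functorial for contractions. -/

namespace ProductArea

/-! ### Projective tensor powers -/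

section TensorPower

variable {B C D E G : Type*}
  [NormedRing B] [NormedAlgebra ℂ B] [NormedRing C] [NormedAlgebra ℂ C]
  [NormedRing D] [NormedAlgebra ℂ D] [NormedAddCommGroup E] [NormedSpace ℂ E]
  [NormedAddCommGroup G] [NormedSpace ℂ G] {k : ℕ}

theorem PT.induction_on {p : PT B k → Prop} (hp : IsClosed {w | p w})
    (htens : ∀ (c : ℂ) v, p (c • tens B k v)) (hadd : ∀ w w', p w → p w' → p (w + w'))
    (w : PT B k) : p w := by
  refine UniformSpace.Completion.induction_on (α := ⨂[ℂ] _ : Fin k, B) (p := p) w hp fun x ↦ ?_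
  change p (toPT B k x)
  induction x using PiTensorProduct.induction_on with
  | smul_tprod c v => simpa [tens] using htens c v
  | add x y hx hy => simpa using hadd _ _ hx hy

theorem PT.hom_ext {f g : PT B k →L[ℂ] G} (h : ∀ v, f (tens B k v) = g (tens B k v)) :
    f = g := by
  ext w
  refine PT.induction_on (p := fun w ↦ f w = g w) (isClosed_eq f.continuous g.continuous)
    (fun c v ↦ ?_) (fun w w' hw hw' ↦ ?_) w
  · simp [h]
  · simp [hw, hw']

theorem PT.map_mem (f : PT B k →L[ℂ] G) {S : Submodule ℂ G} (hS : IsClosed (S : Set G))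
    (h : ∀ v, f (tens B k v) ∈ S) (w : PT B k) : f w ∈ S := by
  refine PT.induction_on (p := fun w ↦ f w ∈ S) (hS.preimage f.continuous)
    (fun c v ↦ ?_) (fun w w' hw hw' ↦ ?_) w
  · exact map_smul f c _ ▸ S.smul_mem c (h v)
  · exact map_add f w w' ▸ S.add_mem hw hw'

theorem norm_extPT_le [CompleteSpace G] (f : ContinuousMultilinearMap ℂ (fun _ : Fin k ↦ B) G) :
    ‖extPT f‖ ≤ ‖f‖ := by
  refine ContinuousLinearMap.opNorm_le_bound _ (norm_nonneg f) fun w ↦ ?_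
  refine UniformSpace.Completion.induction_on (α := ⨂[ℂ] _ : Fin k, B)
    (p := fun w : PT B k ↦ ‖extPT f w‖ ≤ ‖f‖ * ‖w‖) w
    (isClosed_le (extPT f).continuous.norm (continuous_const.mul continuous_norm)) fun x ↦ ?_
  have norm_toPT : ‖toPT B k x‖ = ‖x‖ := UniformSpace.Completion.norm_coe _
  change ‖extPT f (toPT B k x)‖ ≤ ‖f‖ * ‖toPT B k x‖
  rw [extPT_toPT, ← PiTensorProduct.liftIsometry_apply_apply, norm_toPT,
    ← (PiTensorProduct.liftIsometry ℂ (fun _ : Fin k ↦ B) G).norm_map f]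
  exact ContinuousLinearMap.le_opNorm _ _

theorem norm_extPT_apply_le [CompleteSpace G]
    (f : ContinuousMultilinearMap ℂ (fun _ : Fin k ↦ B) G) {c : ℝ} (hf : ‖f‖ ≤ c) (w : PT B k) :
    ‖extPT f w‖ ≤ c * ‖w‖ :=
  (extPT f).le_of_opNorm_le ((norm_extPT_le f).trans hf) w

theorem norm_mk₂_le {f : B → B → G} {c : ℝ} {hal hsl har hsr hC} (hc : 0 ≤ c) :
    ‖mk₂ (B := B) f c hal hsl har hsr hC‖ ≤ c :=
  MultilinearMap.mkContinuous_norm_le _ hc _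

theorem norm_mk₃_le {f : B → B → B → G} {c : ℝ} {h1 s1 h2 s2 h3 s3 hC} (hc : 0 ≤ c) :
    ‖mk₃ (B := B) f c h1 s1 h2 s2 h3 s3 hC‖ ≤ c :=
  MultilinearMap.mkContinuous_norm_le _ hc _

theorem tens_two (v : Fin 2 → B) : tens B 2 v = tens₂ (v 0) (v 1) := by
  rw [tens₂]
  congr 1
  ext i
  fin_cases i <;> rfl

/-- The bounded bilinear map with values `f x w`, where additivity and homogeneity in `x` are only
required for elementary tensors `w`. -/
noncomputable def bilinOfTens (f : E → PT B k → G) (hf : ∀ x, IsBoundedLinearMap ℂ (f x))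
    (hadd : ∀ x y v, f (x + y) (tens B k v) = f x (tens B k v) + f y (tens B k v))
    (hsmul : ∀ (c : ℂ) x v, f (c • x) (tens B k v) = c • f x (tens B k v))
    (hle : ∀ x w, ‖f x w‖ ≤ ‖x‖ * ‖w‖) : E →L[ℂ] PT B k →L[ℂ] G :=
  LinearMap.mkContinuous
    { toFun := fun x ↦ (hf x).toContinuousLinearMap
      map_add' := fun x y ↦ PT.hom_ext (hadd x y)
      map_smul' := fun c x ↦ PT.hom_ext (hsmul c x) }
    1 fun x ↦ ContinuousLinearMap.opNorm_le_bound _ (by positivity)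
      fun w ↦ (one_mul ‖x‖).symm ▸ hle x w

theorem sharp_tens [CompleteSpace B] (v : Fin 2 → B) (x : B) :
    sharp (tens B 2 v) x = v 0 * x * v 1 :=
  extPT_tens _ v

theorem sharp_tens₂ [CompleteSpace B] (a b x : B) : sharp (tens₂ a b) x = a * x * b :=
  sharp_tens _ _

theorem sharpL_tens (x : B) (v : Fin 3 → B) :
    sharpL x (tens B 3 v) = tens₂ (v 0 * x * v 1) (v 2) :=
  extPT_tens _ v

theorem sharpR_tens (v : Fin 3 → B) (x : B) :
    sharpR (tens B 3 v) x = tens₂ (v 0) (v 1 * x * v 2) :=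
  extPT_tens _ v

theorem norm_sharp_le [CompleteSpace B] (U : PT B 2) (x : B) : ‖sharp U x‖ ≤ ‖x‖ * ‖U‖ :=
  norm_extPT_apply_le _ (norm_mk₂_le (norm_nonneg _)) _

theorem norm_sharpL_le (x : B) (W : PT B 3) : ‖sharpL x W‖ ≤ ‖x‖ * ‖W‖ :=
  norm_extPT_apply_le _ (norm_mk₃_le (norm_nonneg _)) _

theorem norm_sharpR_le (W : PT B 3) (x : B) : ‖sharpR W x‖ ≤ ‖x‖ * ‖W‖ :=
  norm_extPT_apply_le _ (norm_mk₃_le (norm_nonneg _)) _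

variable (B) in
/-- The product `U ♯ x`, as a bounded bilinear map in `x` and `U`. -/
noncomputable def sharpCLM [CompleteSpace B] : B →L[ℂ] PT B 2 →L[ℂ] B :=
  bilinOfTens (fun x U ↦ sharp U x) (fun _ ↦ (extPT _).isBoundedLinearMap)
    (by simp [sharp_tens, mul_add, add_mul]) (by simp [sharp_tens])
    fun x U ↦ norm_sharp_le U x

variable (B) in
/-- The product `x ♯ W`, as a bounded bilinear map. -/
noncomputable def sharpLCLM : B →L[ℂ] PT B 3 →L[ℂ] PT B 2 :=
  bilinOfTens sharpL (fun _ ↦ (extPT _).isBoundedLinearMap)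
    (by simp [sharpL_tens, mul_add, add_mul, tens₂_add_left])
    (by simp [sharpL_tens, tens₂_smul_left]) norm_sharpL_le

variable (B) in
/-- The product `W ♯ x` for a triple tensor `W`, as a bounded bilinear map in `x` and `W`. -/
noncomputable def sharpRCLM : B →L[ℂ] PT B 3 →L[ℂ] PT B 2 :=
  bilinOfTens (fun x W ↦ sharpR W x) (fun _ ↦ (extPT _).isBoundedLinearMap)
    (by simp [sharpR_tens, mul_add, add_mul, tens₂_add_right])
    (by simp [sharpR_tens, tens₂_smul_right]) fun x W ↦ norm_sharpR_le W x

theorem sharpCLM_apply [CompleteSpace B] (x : B) (U : PT B 2) : sharpCLM B x U = sharp U x := rfl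

theorem sharpLCLM_apply (x : B) (W : PT B 3) : sharpLCLM B x W = sharpL x W := rfl

theorem sharpRCLM_apply (x : B) (W : PT B 3) : sharpRCLM B x W = sharpR W x := rfl

theorem mapPT_tens (j : B →L[ℂ] C) (v : Fin k → B) :
    mapPT j k (tens B k v) = tens C k fun i ↦ j (v i) :=
  extPT_tens _ v

theorem mapPT_tens₂ (j : B →L[ℂ] C) (a b : B) :
    mapPT j 2 (tens₂ a b) = tens₂ (j a) (j b) := by
  rw [tens₂, mapPT_tens, tens_two]
  rfl

theorem norm_mapPT_le {j : B →L[ℂ] C} (hj : ‖j‖ ≤ 1) (w : PT B k) : ‖mapPT j k w‖ ≤ ‖w‖ := by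
  refine (norm_extPT_apply_le _ (c := 1) ?_ w).trans_eq (one_mul _)
  refine ContinuousMultilinearMap.opNorm_le_bound zero_le_one fun v ↦ ?_
  calc ‖tens C k fun i ↦ j (v i)‖ ≤ ∏ i, ‖j (v i)‖ := norm_tens_le _
    _ ≤ ∏ i, ‖v i‖ := Finset.prod_le_prod (fun _ _ ↦ norm_nonneg _) fun i _ ↦
        (j.le_of_opNorm_le hj _).trans_eq (one_mul _)
    _ = 1 * ∏ i, ‖v i‖ := (one_mul _).symm

theorem mapPT_mapPT (j : B →L[ℂ] C) (l : C →L[ℂ] D) (w : PT B k) :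
    mapPT l k (mapPT j k w) = mapPT (l.comp j) k w := by
  have h : (mapPT l k).comp (mapPT j k) = mapPT (l.comp j) k :=
    PT.hom_ext fun v ↦ by simp [mapPT_tens]
  exact DFunLike.congr_fun h w

theorem mapPT_id (w : PT B k) : mapPT (ContinuousLinearMap.id ℂ B) k w = w := by
  have h : mapPT (ContinuousLinearMap.id ℂ B) k = ContinuousLinearMap.id ℂ (PT B k) :=
    PT.hom_ext fun v ↦ by simp [mapPT_tens]
  exact DFunLike.congr_fun h w

theorem norm_mapPT_of_leftInverse {j : B →L[ℂ] C} {e : C →L[ℂ] B} (hj : ‖j‖ ≤ 1) (he : ‖e‖ ≤ 1)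
    (h : Function.LeftInverse e j) (w : PT B k) : ‖mapPT j k w‖ = ‖w‖ := by
  refine le_antisymm (norm_mapPT_le hj w) ?_
  have hw : mapPT e k (mapPT j k w) = w := by
    rw [mapPT_mapPT, show e.comp j = ContinuousLinearMap.id ℂ B from
      ContinuousLinearMap.ext h, mapPT_id]
  calc ‖w‖ = ‖mapPT e k (mapPT j k w)‖ := by rw [hw]
    _ ≤ ‖mapPT j k w‖ := norm_mapPT_le he _

end TensorPower

section SubalgebraTensor

variable {A : Type*} [NormedRing A] [NormedAlgebra ℂ A] [StarRing A] [StarModule ℂ A]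
  {S S' : StarSubalgebra ℂ A}

theorem norm_incl_le (S : StarSubalgebra ℂ A) : ‖incl S‖ ≤ 1 :=
  LinearMap.mkContinuous_norm_le _ zero_le_one _

theorem incl_apply (x : S) : incl S x = x := rfl

theorem coe_inclLE (h : S ≤ S') (x : S) : (inclLE h x : A) = x := rfl

theorem mapPT_incl_inclLE (h : S ≤ S') {k : ℕ} (w : PT S k) :
    mapPT (incl S') k (mapPT (inclLE h) k w) = mapPT (incl S) k w :=
  mapPT_mapPT _ _ _

variable [CompleteSpace A]

theorem timesId_tens (L : PT S 2 →L[ℂ] A) (v : Fin 3 → S) :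
    timesId L (tens S 3 v) = L (tens₂ (v 0) (v 1)) * (v 2 : A) :=
  extPT_tens _ v

theorem idTimes_tens (L : PT S 2 →L[ℂ] A) (v : Fin 3 → S) :
    idTimes L (tens S 3 v) = (v 0 : A) * L (tens₂ (v 1) (v 2)) :=
  extPT_tens _ v

theorem norm_timesId_le (L : PT S 2 →L[ℂ] A) (w : PT S 3) : ‖timesId L w‖ ≤ ‖L‖ * ‖w‖ :=
  norm_extPT_apply_le _ (norm_mk₃_le (norm_nonneg _)) _

theorem timesId_chen (h : S ≤ S') {L₁ L₂ : PT S 2 →L[ℂ] A} {L₃ : PT S' 2 →L[ℂ] A} {x y : A}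
    (hL : ∀ w, L₁ w - L₂ w - L₃ (mapPT (inclLE h) 2 w) = sharp (mapPT (incl S) 2 w) x * y)
    (w : PT S 3) :
    timesId L₁ w - timesId L₂ w - timesId L₃ (mapPT (inclLE h) 3 w) =
      sharp (sharpL x (mapPT (incl S) 3 w)) y := by
  have hCLM : timesId L₁ - timesId L₂ - (timesId L₃).comp (mapPT (inclLE h) 3) =
      (sharpCLM A y).comp ((sharpLCLM A x).comp (mapPT (incl S) 3)) := by
    refine PT.hom_ext fun v ↦ ?_
    have hv := hL (tens₂ (v 0) (v 1))
    rw [mapPT_tens₂, mapPT_tens₂, sharp_tens₂] at hv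
    simp only [sub_apply, ContinuousLinearMap.comp_apply, mapPT_tens, timesId_tens,
      sharpLCLM_apply, sharpCLM_apply, sharpL_tens, sharp_tens₂, coe_inclLE, incl_apply,
      ← sub_mul, hv]
  exact DFunLike.congr_fun hCLM w

variable [CStarRing A]

theorem adjOp_tens₂ (L : PT S 2 →L[ℂ] A) (a b : S) :
    adjOp L (tens₂ a b) = star (L (tens₂ (star b) (star a))) :=
  extPT_tens _ _

theorem norm_adjOp_le (L : PT S 2 →L[ℂ] A) : ‖adjOp L‖ ≤ ‖L‖ :=
  (norm_extPT_le _).trans (norm_mk₂_le (norm_nonneg _))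

theorem norm_idTimes_adjOp_le (L : PT S 2 →L[ℂ] A) (w : PT S 3) :
    ‖idTimes (adjOp L) w‖ ≤ ‖L‖ * ‖w‖ :=
  norm_extPT_apply_le _ ((norm_mk₃_le (norm_nonneg _)).trans (norm_adjOp_le L)) _

theorem idTimes_adjOp_chen (h : S ≤ S') {L₁ L₂ : PT S 2 →L[ℂ] A} {L₃ : PT S' 2 →L[ℂ] A} {x y : A}
    (hx : IsSelfAdjoint x) (hy : IsSelfAdjoint y)
    (hL : ∀ w, L₁ w - L₂ w - L₃ (mapPT (inclLE h) 2 w) = sharp (mapPT (incl S) 2 w) x * y)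
    (w : PT S 3) :
    idTimes (adjOp L₁) w - idTimes (adjOp L₂) w - idTimes (adjOp L₃) (mapPT (inclLE h) 3 w) =
      sharp (sharpR (mapPT (incl S) 3 w) x) y := by
  have hCLM : idTimes (adjOp L₁) - idTimes (adjOp L₂) -
      (idTimes (adjOp L₃)).comp (mapPT (inclLE h) 3) =
      (sharpCLM A y).comp ((sharpRCLM A x).comp (mapPT (incl S) 3)) := by
    refine PT.hom_ext fun v ↦ ?_
    have hv := congrArg star (hL (tens₂ (star (v 2)) (star (v 1))))
    have inclLE_star (a : S) : inclLE h (star a) = star (inclLE h a) := rfl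
    rw [mapPT_tens₂, mapPT_tens₂, sharp_tens₂, inclLE_star, inclLE_star] at hv
    simp only [star_sub, star_mul, incl_apply, hx.star_eq, hy.star_eq, StarMemClass.coe_star,
      star_star] at hv
    simp only [sub_apply, ContinuousLinearMap.comp_apply, mapPT_tens, idTimes_tens,
      sharpRCLM_apply, sharpCLM_apply, sharpR_tens, sharp_tens₂, coe_inclLE, incl_apply,
      adjOp_tens₂, ← mul_sub, hv, mul_assoc]
  exact DFunLike.congr_fun hCLM w

end SubalgebraTensor

/-! ### The sewing lemma -/

section Additive

open Filter Topology

/-- The `i`-th point of the subdivision of `[s, t]` into `n` intervals of equal length. -/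
noncomputable def gridPt (s t : ℝ) (n i : ℕ) : ℝ := s + i * ((t - s) / n)

theorem gridPt_zero (s t : ℝ) (n : ℕ) : gridPt s t n 0 = s := by simp [gridPt]

theorem gridPt_self (s t : ℝ) {n : ℕ} (hn : n ≠ 0) : gridPt s t n n = t := by
  simp [gridPt, mul_div_cancel₀ (t - s) (Nat.cast_ne_zero.2 hn)]

theorem gridPt_succ_sub (s t : ℝ) (n i : ℕ) :
    gridPt s t n (i + 1) - gridPt s t n i = (t - s) / n := by
  simp only [gridPt]
  push_cast
  ring

theorem gridPt_mono {s t : ℝ} (hst : s ≤ t) (n : ℕ) : Monotone (gridPt s t n) := by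
  intro i j hij
  have := sub_nonneg.2 hst
  simp only [gridPt]
  gcongr

theorem le_gridPt {s t : ℝ} (hst : s ≤ t) (n i : ℕ) : s ≤ gridPt s t n i :=
  (gridPt_zero s t n).symm.trans_le (gridPt_mono hst n i.zero_le)

theorem gridPt_le {s t : ℝ} (hst : s ≤ t) {n i : ℕ} (hi : i < n) : gridPt s t n (i + 1) ≤ t :=
  (gridPt_mono hst n hi).trans_eq (gridPt_self s t hi.ne_bot)

variable {V : Type*} [NormedAddCommGroup V] {a b s t μ : ℝ} {J J' M : ℝ → ℝ → V}

/-- The function `J` of two times is additive over adjacent subintervals of `[a, b]`. -/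
def AdditiveOn (a b : ℝ) (J : ℝ → ℝ → V) : Prop :=
  ∀ s r t, a ≤ s → s ≤ r → r ≤ t → t ≤ b → J s t = J s r + J r t

theorem AdditiveOn.mono (hJ : AdditiveOn a b J) (has : a ≤ s) (htb : t ≤ b) :
    AdditiveOn s t J :=
  fun _ _ _ hs hr ht htt ↦ hJ _ _ _ (has.trans hs) hr ht (htt.trans htb)

theorem AdditiveOn.diag (hJ : AdditiveOn a b J) (has : a ≤ s) (hsb : s ≤ b) : J s s = 0 := by
  simpa using hJ s s s has le_rfl le_rfl hsb

theorem AdditiveOn.eq_sum (hJ : AdditiveOn s t J) (hst : s ≤ t) {n : ℕ} (hn : n ≠ 0) :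
    J s t = ∑ i ∈ Finset.range n, J (gridPt s t n i) (gridPt s t n (i + 1)) := by
  have partial_sum (k : ℕ) (hk : k ≤ n) : J s (gridPt s t n k) =
      ∑ i ∈ Finset.range k, J (gridPt s t n i) (gridPt s t n (i + 1)) := by
    induction k with
    | zero => rw [gridPt_zero, hJ.diag le_rfl hst, Finset.sum_range_zero]
    | succ k ih =>
      rw [hJ _ _ _ le_rfl (le_gridPt hst n k) (gridPt_mono hst n k.le_succ) (gridPt_le hst hk),
        Finset.sum_range_succ, ih (Nat.le_of_succ_le hk)]
  simpa only [gridPt_self s t hn] using partial_sum n le_rfl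

theorem AdditiveOn.norm_sub_sum_le (hJ : AdditiveOn s t J) {ω : ℝ → ℝ → ℝ}
    (hω : AdditiveOn s t ω) (hst : s ≤ t) {n : ℕ} (hn : n ≠ 0) {c : ℝ}
    (h : ∀ i < n, ‖J (gridPt s t n i) (gridPt s t n (i + 1)) -
      M (gridPt s t n i) (gridPt s t n (i + 1))‖ ≤
        c * ω (gridPt s t n i) (gridPt s t n (i + 1))) :
    ‖J s t - ∑ i ∈ Finset.range n, M (gridPt s t n i) (gridPt s t n (i + 1))‖ ≤ c * ω s t := by
  rw [hJ.eq_sum hst hn, hω.eq_sum hst hn, ← Finset.sum_sub_distrib, Finset.mul_sum]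
  exact norm_sum_le_of_le _ fun i hi ↦ h i (Finset.mem_range.1 hi)

theorem additiveOn_length : AdditiveOn s t fun x y ↦ y - x :=
  fun _ _ _ _ _ _ _ ↦ by ring

theorem tendsto_mesh_nhdsGE_zero (hst : s ≤ t) :
    Tendsto (fun n : ℕ ↦ (t - s) / (n : ℝ)) atTop (𝓝[≥] 0) :=
  tendsto_nhdsWithin_iff.2 ⟨tendsto_const_div_atTop_nhds_zero_nat _,
    Eventually.of_forall fun n ↦ div_nonneg (sub_nonneg.2 hst) n.cast_nonneg⟩

theorem AdditiveOn.tendsto_sum (hJ : AdditiveOn s t J) {ω : ℝ → ℝ → ℝ} (hω : AdditiveOn s t ω)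
    {ψ : ℝ → ℝ} (hψ : Tendsto ψ (𝓝[≥] 0) (𝓝 0)) (hst : s ≤ t)
    (h : ∀ x y, s ≤ x → x ≤ y → y ≤ t → ‖J x y - M x y‖ ≤ ψ (y - x) * ω x y) :
    Tendsto (fun n : ℕ ↦ ∑ i ∈ Finset.range n, M (gridPt s t n i) (gridPt s t n (i + 1))) atTop
      (𝓝 (J s t)) := by
  have hlim : Tendsto (fun n : ℕ ↦ ψ ((t - s) / n) * ω s t) atTop (𝓝 0) := by
    simpa using (hψ.comp (tendsto_mesh_nhdsGE_zero hst)).mul_const (ω s t)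
  rw [tendsto_iff_norm_sub_tendsto_zero]
  refine squeeze_zero' (Eventually.of_forall fun n ↦ norm_nonneg _) ?_ hlim
  filter_upwards [eventually_ne_atTop 0] with n hn
  rw [norm_sub_rev]
  refine hJ.norm_sub_sum_le hω hst hn fun i hi ↦ ?_
  simpa only [gridPt_succ_sub] using
    h _ _ (le_gridPt hst n i) (gridPt_mono hst n i.le_succ) (gridPt_le hst hi)

theorem tendsto_const_mul_rpow_nhdsGE_zero (c : ℝ) {α : ℝ} (hα : 0 < α) :
    Tendsto (fun x : ℝ ↦ c * x ^ α) (𝓝[≥] 0) (𝓝 0) := by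
  have h := ((Real.continuousAt_rpow_const 0 α (Or.inr hα.le)).tendsto).const_mul c
  rw [Real.zero_rpow hα.ne', mul_zero] at h
  exact h.mono_left nhdsWithin_le_nhds

theorem rpow_eq_rpow_sub_one_mul {x : ℝ} (hx : 0 ≤ x) (hμ : 1 < μ) : x ^ μ = x ^ (μ - 1) * x := by
  simpa using Real.rpow_add_one' hx (y := μ - 1) (by linarith)

theorem AdditiveOn.tendsto_sum_of_rpow (hJ : AdditiveOn s t J) {c : ℝ} (hμ : 1 < μ) (hst : s ≤ t)
    (h : ∀ x y, s ≤ x → x ≤ y → y ≤ t → ‖J x y - M x y‖ ≤ c * (y - x) ^ μ) :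
    Tendsto (fun n : ℕ ↦ ∑ i ∈ Finset.range n, M (gridPt s t n i) (gridPt s t n (i + 1))) atTop
      (𝓝 (J s t)) := by
  refine hJ.tendsto_sum additiveOn_length
    (tendsto_const_mul_rpow_nhdsGE_zero c (sub_pos.2 hμ)) hst fun x y hx hxy hy ↦ ?_
  rw [mul_assoc, ← rpow_eq_rpow_sub_one_mul (sub_nonneg.2 hxy) hμ]
  exact h x y hx hxy hy

theorem AdditiveOn.eq_of_rpow (hJ : AdditiveOn s t J) (hJ' : AdditiveOn s t J') {c c' : ℝ}
    (hμ : 1 < μ) (hst : s ≤ t)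
    (h : ∀ x y, s ≤ x → x ≤ y → y ≤ t → ‖J x y - M x y‖ ≤ c * (y - x) ^ μ)
    (h' : ∀ x y, s ≤ x → x ≤ y → y ≤ t → ‖J' x y - M x y‖ ≤ c' * (y - x) ^ μ) :
    J s t = J' s t :=
  tendsto_nhds_unique (hJ.tendsto_sum_of_rpow hμ hst h) (hJ'.tendsto_sum_of_rpow hμ hst h')

end Additive

section PartitionSum

variable {α V : Type*} [LinearOrder α]

/-- The pairs of consecutive points of a finite set. -/
def consecutivePairs (D : Finset α) : Finset (α × α) :=
  {p ∈ D ×ˢ D | p.1 < p.2 ∧ ∀ z ∈ D, z ≤ p.1 ∨ p.2 ≤ z}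

theorem mem_consecutivePairs {D : Finset α} {u v : α} :
    (u, v) ∈ consecutivePairs D ↔ u ∈ D ∧ v ∈ D ∧ u < v ∧ ∀ z ∈ D, z ≤ u ∨ v ≤ z := by
  simp [consecutivePairs, and_assoc]

theorem card_filter_lt {D : Finset α} {s t u x y : α} (huD : u ∈ D)
    (hsu : s ≤ u) (hut : u < t) (hx : s ≤ x) (hy : y ≤ t) (hu : y ≤ u ∨ u < x) :
    Finset.card {z ∈ D | x ≤ z ∧ z < y} < Finset.card {z ∈ D | s ≤ z ∧ z < t} := by
  refine Finset.card_lt_card ((Finset.ssubset_iff_of_subset fun z hz ↦ ?_).2 ⟨u, ?_, ?_⟩) <;> grind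

variable [AddCommMonoid V] (M : α → α → V) (D : Finset α)

/-- The sum of `M` over the consecutive points of `D` between `s` and `t`, for `s, t ∈ D`. Selecting
the pairs by their left end only makes it additive for arbitrary times. -/
def partSum (s t : α) : V :=
  ∑ p ∈ consecutivePairs D with s ≤ p.1 ∧ p.1 < t, M p.1 p.2

theorem partSum_add {s r t : α} (hsr : s ≤ r) (hrt : r ≤ t) :
    partSum M D s r + partSum M D r t = partSum M D s t := by
  rw [partSum, partSum, partSum, ← Finset.sum_union]
  · congr 1
    grind
  · rw [Finset.disjoint_filter]
    grind

theorem partSum_self (s : α) : partSum M D s s = 0 := by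
  rw [partSum, Finset.filter_false_of_mem, Finset.sum_empty]
  grind

theorem partSum_of_mem_consecutivePairs {u v : α} (h : (u, v) ∈ consecutivePairs D) :
    partSum M D u v = M u v := by
  rw [partSum, ← Finset.sum_singleton (fun p : α × α ↦ M p.1 p.2) (u, v)]
  congr 1
  ext ⟨x, y⟩
  simp only [Finset.mem_filter, Finset.mem_singleton, Prod.mk.injEq]
  grind [mem_consecutivePairs]

theorem exists_consecutivePair {s t m : α} (hs : s ∈ D) (ht : t ∈ D) (hsm : s ≤ m) (hmt : m < t) :
    ∃ u v, (u, v) ∈ consecutivePairs D ∧ s ≤ u ∧ u ≤ m ∧ m < v ∧ v ≤ t := by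
  have hL : {x ∈ D | x ≤ m}.Nonempty := ⟨s, by grind⟩
  have hR : {x ∈ D | m < x}.Nonempty := ⟨t, by grind⟩
  have hu := Finset.max'_mem _ hL
  have hv := Finset.min'_mem _ hR
  rw [Finset.mem_filter] at hu hv
  refine ⟨_, _, mem_consecutivePairs.2 ⟨hu.1, hv.1, hu.2.trans_lt hv.2, fun z hz ↦ ?_⟩,
    Finset.le_max' _ _ (by grind), hu.2, hv.2, Finset.min'_le _ _ (by grind)⟩
  rcases le_or_gt z m with hzm | hzm
  · exact .inl (Finset.le_max' _ _ (by grind))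
  · exact .inr (Finset.min'_le _ _ (by grind))

end PartitionSum

section Sewing

open Filter Topology

variable {V : Type*} [NormedAddCommGroup V] {M : ℝ → ℝ → V} {a b s t μ T : ℝ} {C : ℝ≥0}

/-- The constant of the sewing lemma with exponent `μ > 1`: the fixed point of
`x ↦ 2 ^ (1 - μ) * x + 2`. -/
noncomputable def sewC (μ : ℝ) : ℝ≥0 := 2 / (1 - 2 ^ (1 - μ))

theorem sewC_mul_add (hμ : 1 < μ) : (sewC μ * 2 ^ (1 - μ) + 2 : ℝ) = sewC μ := by
  have hlt : (2 : ℝ≥0) ^ (1 - μ) < 1 := NNReal.rpow_lt_one_of_one_lt_of_neg one_lt_two (by linarith)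
  have hne : 1 - (2 : ℝ) ^ (1 - μ) ≠ 0 :=
    sub_ne_zero.2 fun h ↦ hlt.ne' (NNReal.coe_injective (by simpa using h))
  rw [sewC, NNReal.coe_div, NNReal.coe_sub hlt.le]
  simp only [NNReal.coe_ofNat, NNReal.coe_one, NNReal.coe_rpow]
  field_simp
  ring

theorem two_mul_half_rpow {x : ℝ} (hx : 0 ≤ x) : 2 * (x / 2) ^ μ = 2 ^ (1 - μ) * x ^ μ := by
  rw [Real.div_rpow hx zero_le_two, Real.rpow_sub zero_lt_two, Real.rpow_one]
  ring

theorem partSum_sub_eq {D : Finset ℝ} {u v : ℝ} (huv : (u, v) ∈ consecutivePairs D) (hsu : s ≤ u)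
    (hvt : v ≤ t) : partSum M D s t - M s t =
      (partSum M D s u - M s u) + (partSum M D v t - M v t) - (cobd M s u v + cobd M s v t) := by
  have huv' : u ≤ v := (mem_consecutivePairs.1 huv).2.2.1.le
  rw [← partSum_add M D (hsu.trans huv') hvt, ← partSum_add M D hsu huv',
    partSum_of_mem_consecutivePairs M D huv, cobd, cobd]
  abel

theorem norm_partSum_sub_le (hμ : 1 < μ)
    (hM : ∀ s r t, a ≤ s → s ≤ r → r ≤ t → t ≤ b → ‖cobd M s r t‖ ≤ C * (t - s) ^ μ)
    (D : Finset ℝ) (hsD : s ∈ D) (htD : t ∈ D) (has : a ≤ s) (hst : s ≤ t) (htb : t ≤ b) :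
    ‖partSum M D s t - M s t‖ ≤ sewC μ * C * (t - s) ^ μ := by
  induction hn : {x ∈ D | s ≤ x ∧ x < t}.card using Nat.strong_induction_on generalizing s t with
  | h n ih =>
  subst hn
  obtain rfl | hlt := hst.eq_or_lt
  · have hdiag : M s s = 0 := by
      simpa [cobd, Real.zero_rpow (zero_lt_one.trans hμ).ne'] using hM s s s has le_rfl le_rfl htb
    simp [partSum_self, hdiag, Real.zero_rpow (zero_lt_one.trans hμ).ne']
  -- Cutting out the interval of `D` around the midpoint leaves parts of at most half the length.
  obtain ⟨u, v, huv, hsu, hum, hmv, hvt⟩ := exists_consecutivePair D (m := (s + t) / 2) hsD htD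
    (by linarith) (by linarith)
  obtain ⟨huD, hvD, huv', -⟩ := mem_consecutivePairs.1 huv
  have left_le := ih _ (card_filter_lt huD hsu (huv'.trans_le hvt) le_rfl (huv'.le.trans hvt)
    (.inl le_rfl)) hsD huD has hsu (by linarith) rfl
  have right_le := ih _ (card_filter_lt huD hsu (huv'.trans_le hvt) (hsu.trans huv'.le) le_rfl
    (.inr huv')) hvD htD (by linarith) hvt htb rfl
  have : 0 ≤ μ := zero_le_one.trans hμ.le
  calc ‖partSum M D s t - M s t‖
      ≤ ‖partSum M D s u - M s u‖ + ‖partSum M D v t - M v t‖ +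
          (‖cobd M s u v‖ + ‖cobd M s v t‖) := by
        rw [partSum_sub_eq huv hsu hvt]
        exact (norm_sub_le _ _).trans (add_le_add (norm_add_le _ _) (norm_add_le _ _))
    _ ≤ sewC μ * C * ((t - s) / 2) ^ μ + sewC μ * C * ((t - s) / 2) ^ μ +
          (C * (t - s) ^ μ + C * (t - s) ^ μ) := by
        gcongr ?_ + ?_ + (?_ + ?_)
        · refine left_le.trans ?_
          have := sub_nonneg.2 hsu
          gcongr
          linarith
        · refine right_le.trans ?_
          have := sub_nonneg.2 hvt
          gcongr
          linarith
        · refine (hM s u v has hsu huv'.le (hvt.trans htb)).trans ?_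
          have : 0 ≤ v - s := by linarith
          gcongr
        · exact hM s v t has (hsu.trans huv'.le) hvt htb
    _ = C * ((sewC μ * 2 ^ (1 - μ) + 2) * (t - s) ^ μ) := by
        linear_combination sewC μ * C * two_mul_half_rpow (μ := μ) (sub_nonneg.2 hst)
    _ = sewC μ * C * (t - s) ^ μ := by rw [sewC_mul_add hμ]; ring

theorem cauchySeq_partSum (hμ : 1 < μ)
    (hM : ∀ s r t, a ≤ s → s ≤ r → r ≤ t → t ≤ b → ‖cobd M s r t‖ ≤ C * (t - s) ^ μ)
    (has : a ≤ s) (hst : s ≤ t) (htb : t ≤ b) :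
    CauchySeq fun D : Finset ℝ ↦ partSum M D s t := by
  refine Metric.cauchySeq_iff'.2 fun ε hε ↦ ?_
  have hlim : Tendsto (fun n : ℕ ↦ sewC μ * C * ((t - s) / (n : ℝ)) ^ (μ - 1) * (t - s))
      atTop (𝓝 0) := by
    simpa using ((tendsto_const_mul_rpow_nhdsGE_zero (sewC μ * C)
      (sub_pos.2 hμ)).comp (tendsto_mesh_nhdsGE_zero hst)).mul_const (t - s)
  obtain ⟨n, hn, hn0⟩ :=
    ((hlim.eventually (gt_mem_nhds (half_pos hε))).and (eventually_ne_atTop 0)).exists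
  let grid := (Finset.range (n + 1)).image (gridPt s t n)
  have near_sum (D : Finset ℝ) (hD : grid ⊆ D) : ‖partSum M D s t -
      ∑ i ∈ Finset.range n, M (gridPt s t n i) (gridPt s t n (i + 1))‖ < ε / 2 := by
    have hadd : AdditiveOn s t (partSum M D) := fun _ _ _ _ h h' _ ↦ (partSum_add M D h h').symm
    have mem (i : ℕ) (hi : i ≤ n) : gridPt s t n i ∈ D :=
      hD (Finset.mem_image_of_mem _ (Finset.mem_range_succ_iff.2 hi))
    refine (hadd.norm_sub_sum_le additiveOn_length hst hn0 fun i hi ↦ ?_).trans_lt hn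
    refine (norm_partSum_sub_le hμ hM D (mem i hi.le) (mem (i + 1) hi)
      (has.trans (le_gridPt hst n i)) (gridPt_mono hst n i.le_succ)
      ((gridPt_le hst hi).trans htb)).trans_eq ?_
    rw [gridPt_succ_sub, mul_assoc _ _ ((t - s) / (n : ℝ)), ← rpow_eq_rpow_sub_one_mul
      (div_nonneg (sub_nonneg.2 hst) n.cast_nonneg) hμ]
  refine ⟨grid, fun D hD ↦ ?_⟩
  rw [dist_eq_norm]
  linarith [norm_sub_le_norm_sub_add_norm_sub (partSum M D s t)
    (∑ i ∈ Finset.range n, M (gridPt s t n i) (gridPt s t n (i + 1))) (partSum M grid s t),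
    near_sum D hD, norm_sub_rev (partSum M grid s t) _ ▸ near_sum grid subset_rfl]

theorem exists_additiveOn_norm_sub_le [CompleteSpace V] (hμ : 1 < μ)
    (hM : ∀ s r t, a ≤ s → s ≤ r → r ≤ t → t ≤ b → ‖cobd M s r t‖ ≤ C * (t - s) ^ μ) :
    ∃ J : ℝ → ℝ → V, AdditiveOn a b J ∧
      ∀ s t, a ≤ s → s ≤ t → t ≤ b → ‖J s t - M s t‖ ≤ sewC μ * C * (t - s) ^ μ := by
  have hlim (s t : ℝ) (has : a ≤ s) (hst : s ≤ t) (htb : t ≤ b) :=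
    (cauchySeq_partSum hμ hM has hst htb).tendsto_limUnder
  refine ⟨fun s t ↦ limUnder atTop fun D ↦ partSum M D s t, fun s r t has hsr hrt htb ↦ ?_,
    fun s t has hst htb ↦ ?_⟩
  · refine tendsto_nhds_unique (hlim s t has (hsr.trans hrt) htb) ?_
    simpa only [partSum_add M _ hsr hrt] using
      (hlim s r has hsr (hrt.trans htb)).add (hlim r t (has.trans hsr) hrt htb)
  · refine le_of_tendsto ((hlim s t has hst htb).sub_const (M s t)).norm ?_
    filter_upwards [eventually_ge_atTop {s, t}] with D hD
    exact norm_partSum_sub_le hμ hM D (hD (by simp)) (hD (by simp)) has hst htb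

/-- The pairs of times `s ≤ t` in `I`. -/
abbrev simplex (I : Set ℝ) : Set (ℝ × ℝ) := {p | p.1 ∈ I ∧ p.2 ∈ I ∧ p.1 ≤ p.2}

theorem norm_sub_le_of_nested {c γ : ℝ}
    (hM : ∀ s t, 0 ≤ s → s ≤ t → t ≤ T → ‖M s t‖ ≤ c * (t - s) ^ γ)
    (hl : ∀ s r t, 0 ≤ s → s ≤ r → r ≤ t → t ≤ T → ‖cobd M s r t‖ ≤ c * (r - s) ^ γ)
    (hr : ∀ s r t, 0 ≤ s → s ≤ r → r ≤ t → t ≤ T → ‖cobd M s r t‖ ≤ c * (t - r) ^ γ)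
    {s' s t t' : ℝ} (hs' : 0 ≤ s') (hs : s' ≤ s) (hst : s ≤ t) (ht : t ≤ t') (ht' : t' ≤ T) :
    ‖M s' t' - M s t‖ ≤ 2 * c * ((s - s') ^ γ + (t' - t) ^ γ) := by
  have split : M s' t' - M s t = M s' s + cobd M s' s t' + M t t' + cobd M s t t' := by
    rw [cobd, cobd]
    abel
  rw [split]
  refine norm_add₄_le.trans ?_
  linarith [hM s' s hs' hs (by linarith), hM t t' (by linarith) ht ht',
    hl s' s t' hs' hs (by linarith) ht', hr s t t' (by linarith) hst ht ht']

theorem continuousOn_simplex_of_cobd_le {γ : ℝ} {c : ℝ≥0} (hγ : 0 < γ)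
    (hM : ∀ s t, 0 ≤ s → s ≤ t → t ≤ T → ‖M s t‖ ≤ c * (t - s) ^ γ)
    (hl : ∀ s r t, 0 ≤ s → s ≤ r → r ≤ t → t ≤ T → ‖cobd M s r t‖ ≤ c * (r - s) ^ γ)
    (hr : ∀ s r t, 0 ≤ s → s ≤ r → r ≤ t → t ≤ T → ‖cobd M s r t‖ ≤ c * (t - r) ^ γ) :
    ContinuousOn (fun p : ℝ × ℝ ↦ M p.1 p.2) (simplex (Set.Icc 0 T)) := by
  rintro ⟨s, t⟩ ⟨hs, ht, hst⟩
  rw [ContinuousWithinAt, tendsto_iff_norm_sub_tendsto_zero]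
  let modulus (p : ℝ × ℝ) : ℝ := 2 * c * (|p.1 - s| ^ γ + |p.2 - t| ^ γ)
  have hlim : Tendsto (fun p ↦ 2 * modulus p) (𝓝 (s, t)) (𝓝 0) := by
    have hrpow (f : ℝ × ℝ → ℝ) (hf : Continuous f) : Continuous fun p ↦ f p ^ γ :=
      hf.rpow_const fun _ ↦ Or.inr hγ.le
    have hcont : Continuous fun p ↦ 2 * modulus p :=
      continuous_const.mul (continuous_const.mul
        ((hrpow (fun p ↦ |p.1 - s|) (by fun_prop)).add (hrpow (fun p ↦ |p.2 - t|) (by fun_prop))))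
    simpa [modulus, Real.zero_rpow hγ.ne'] using hcont.tendsto (s, t)
  refine squeeze_zero' (Eventually.of_forall fun n ↦ norm_nonneg _) ?_
    (hlim.mono_left nhdsWithin_le_nhds)
  filter_upwards [self_mem_nhdsWithin] with ⟨s', t'⟩ ⟨hs', ht', hst'⟩
  -- Both intervals are compared with their hull `[min s s', max t t']`.
  have hull (x y : ℝ) (hxy : x ≤ y) (hx : min s s' ≤ x) (hx' : x - min s s' ≤ |s' - s|)
      (hy : y ≤ max t t') (hy' : max t t' - y ≤ |t' - t|) :
      ‖M (min s s') (max t t') - M x y‖ ≤ modulus (s', t') := by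
    refine (norm_sub_le_of_nested hM hl hr (le_min hs.1 hs'.1) hx hxy hy
      (max_le ht.2 ht'.2)).trans ?_
    have := sub_nonneg.2 hx
    have := sub_nonneg.2 hy
    simp only [modulus]
    gcongr
  have hs_abs := max_sub_min_eq_abs s s'
  have ht_abs := max_sub_min_eq_abs t t'
  have near := hull s t hst (min_le_left _ _) (by linarith [le_max_left s s'])
    (le_max_left _ _) (by linarith [min_le_left t t'])
  have near' := hull s' t' hst' (min_le_right _ _) (by linarith [le_max_right s s'])
    (le_max_right _ _) (by linarith [min_le_right t t'])
  rw [← sub_sub_sub_cancel_left _ _ (M (min s s') (max t t'))]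
  exact (norm_sub_le _ _).trans (by linarith)

end Sewing

section Holder

variable {V : Type*} [NormedAddCommGroup V] {α β s t : ℝ} {c : ℝ≥0} {I I' : Set ℝ}
  {n : ℝ → ℝ → ℝ} {f : ℝ → V} {h : ℝ → ℝ → V}

theorem holderSup_le (hn : ∀ s ∈ I, ∀ t ∈ I, s < t → n s t ≤ c * (t - s) ^ α) :
    holderSup α I n ≤ c := by
  refine iSup₂_le fun s hs ↦ iSup₂_le fun t ht ↦ iSup_le fun hst ↦ ?_
  rw [← ENNReal.ofReal_coe_nnreal]
  refine ENNReal.ofReal_le_ofReal ?_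
  rw [div_le_iff₀ (Real.rpow_pos_of_pos (sub_pos.2 hst) _)]
  exact hn s hs t ht hst

theorem holderSup_ne_top (hn : ∀ s ∈ I, ∀ t ∈ I, s < t → n s t ≤ c * (t - s) ^ α) :
    holderSup α I n ≠ ∞ :=
  ne_top_of_le_ne_top ENNReal.coe_ne_top (holderSup_le hn)

theorem le_of_holderSup_ne_top (hfin : holderSup α I n ≠ ∞) (hs : s ∈ I) (ht : t ∈ I)
    (hst : s < t) : n s t ≤ (holderSup α I n).toNNReal * (t - s) ^ α := by
  rw [← div_le_iff₀ (Real.rpow_pos_of_pos (sub_pos.2 hst) _)]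
  exact (ENNReal.ofReal_le_iff_le_toReal hfin).1
    (le_iSup₂_of_le s hs (le_iSup₂_of_le t ht (le_iSup_of_le hst le_rfl)))

theorem holderSup_mono (hI : I ⊆ I') : holderSup α I n ≤ holderSup α I' n :=
  iSup₂_le fun s hs ↦ iSup₂_le fun t ht ↦
    le_iSup₂_of_le s (hI hs) (le_iSup₂_of_le t (hI ht) le_rfl)

theorem incr_self (f : ℝ → V) (t : ℝ) : incr f t t = 0 := sub_self _

theorem norm_incr_le (hα : α ≠ 0) (hfin : N1 α I f ≠ ∞) (hs : s ∈ I) (ht : t ∈ I) (hst : s ≤ t) :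
    ‖incr f s t‖ ≤ (N1 α I f).toNNReal * (t - s) ^ α := by
  obtain rfl | hst := hst.eq_or_lt
  · simp [incr_self, Real.zero_rpow hα]
  · exact le_of_holderSup_ne_top hfin hs ht hst

theorem norm_le_of_N2_ne_top (hα : α ≠ 0) (hfin : N2 α I h ≠ ∞) (hdiag : h t t = 0) (hs : s ∈ I)
    (ht : t ∈ I) (hst : s ≤ t) : ‖h s t‖ ≤ (N2 α I h).toNNReal * (t - s) ^ α := by
  obtain rfl | hst := hst.eq_or_lt
  · simp [hdiag, Real.zero_rpow hα]
  · exact le_of_holderSup_ne_top hfin hs ht hst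

theorem MemC2.norm_le (hα : α ≠ 0) (hh : MemC2 α I h) (hs : s ∈ I) (ht : t ∈ I) (hst : s ≤ t) :
    ‖h s t‖ ≤ (N2 α I h).toNNReal * (t - s) ^ α :=
  norm_le_of_N2_ne_top hα hh.finite (hh.diag t ht) hs ht hst

theorem N0_le (hf : ∀ t ∈ I, ‖f t‖ ≤ c) : N0 I f ≤ c :=
  iSup₂_le fun t ht ↦ (ENNReal.ofReal_le_ofReal (hf t ht)).trans_eq ENNReal.ofReal_coe_nnreal

theorem norm_le_of_N0_ne_top (hfin : N0 I f ≠ ∞) (ht : t ∈ I) : ‖f t‖ ≤ (N0 I f).toNNReal :=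
  (ENNReal.ofReal_le_iff_le_toReal hfin).1
    (le_iSup₂_of_le (f := fun t (_ : t ∈ I) ↦ ENNReal.ofReal ‖f t‖) t ht le_rfl)

theorem N0_ne_top (hI : IsCompact I) (hf : ContinuousOn f I) : N0 I f ≠ ∞ := by
  obtain ⟨c, hc⟩ := hI.exists_bound_of_continuousOn hf
  exact ne_top_of_le_ne_top ENNReal.coe_ne_top
    (N0_le fun t ht ↦ (hc t ht).trans (Real.le_coe_toNNReal c))

theorem N3_ne_top {h : ℝ → ℝ → ℝ → V} (hh : ∀ s ∈ I, ∀ r ∈ I, ∀ t ∈ I, s < r → r < t →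
      ‖h s r t‖ ≤ c * ((t - r) ^ α * (r - s) ^ β)) : N3 α β I h ≠ ∞ := by
  refine ne_top_of_le_ne_top (ENNReal.coe_ne_top (r := c)) ?_
  refine iSup₂_le fun s hs ↦ iSup₂_le fun r hr ↦ iSup₂_le fun t ht ↦ iSup₂_le fun hsr hrt ↦ ?_
  rw [← ENNReal.ofReal_coe_nnreal]
  refine ENNReal.ofReal_le_ofReal ?_
  rw [div_le_iff₀ (mul_pos (Real.rpow_pos_of_pos (sub_pos.2 hrt) _)
    (Real.rpow_pos_of_pos (sub_pos.2 hsr) _))]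
  exact hh s hs r hr t ht hsr hrt

end Holder

section SewingMap

open Filter Topology

variable {V : Type*} [NormedAddCommGroup V] {M N N' J : ℝ → ℝ → V} {h : ℝ → ℝ → ℝ → V}
  {μ T a b s t : ℝ} {C L : ℝ≥0}

theorem additiveOn_zero : AdditiveOn a b fun _ _ ↦ (0 : V) :=
  fun _ _ _ _ _ _ _ ↦ (add_zero 0).symm

theorem AdditiveOn.cobd_eq_zero {r : ℝ} (hJ : AdditiveOn a b J) (has : a ≤ s) (hsr : s ≤ r)
    (hrt : r ≤ t) (htb : t ≤ b) : cobd J s r t = 0 := by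
  rw [cobd, hJ s r t has hsr hrt htb]
  abel

theorem cobd_sub (M N : ℝ → ℝ → V) (s r t : ℝ) :
    cobd (fun s t ↦ M s t - N s t) s r t = cobd M s r t - cobd N s r t := by
  simp only [cobd]
  abel

theorem additiveOn_sub_of_cobd_eq
    (hMN : ∀ s r t, a ≤ s → s ≤ r → r ≤ t → t ≤ b → cobd M s r t = cobd N s r t) :
    AdditiveOn a b fun s t ↦ M s t - N s t := by
  intro s r t has hsr hrt htb
  have h := cobd_sub M N s r t
  rw [hMN s r t has hsr hrt htb, sub_self, cobd, sub_sub, sub_eq_zero] at h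
  exact h

theorem AdditiveOn.continuousOn (hJ : AdditiveOn 0 T J) {ω : ℝ × ℝ → ℝ}
    (hω : ContinuousOn ω (simplex (Set.Icc 0 T))) (hω_diag : ∀ t ∈ Set.Icc 0 T, ω (t, t) = 0)
    (hJω : ∀ s t, 0 ≤ s → s ≤ t → t ≤ T → ‖J s t‖ ≤ ω (s, t)) :
    ContinuousOn (fun p : ℝ × ℝ ↦ J p.1 p.2) (simplex (Set.Icc 0 T)) := by
  have norm_sub_le (s t : ℝ) (hs : 0 ≤ s) (hst : s ≤ t) (ht : t ≤ T) :
      ‖J 0 t - J 0 s‖ ≤ ω (s, t) := by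
    rw [hJ 0 s t le_rfl hs hst ht, add_sub_cancel_left]
    exact hJω s t hs hst ht
  have from_zero : ContinuousOn (J 0) (Set.Icc 0 T) := by
    intro t ht
    have hlim : Tendsto (fun r ↦ ω (min r t, max r t)) (𝓝[Set.Icc 0 T] t) (𝓝 0) := by
      have hcont : Continuous fun r : ℝ ↦ (min r t, max r t) := by fun_prop
      have hmem : Set.MapsTo (fun r : ℝ ↦ (min r t, max r t)) (Set.Icc 0 T)
          (simplex (Set.Icc 0 T)) := fun r hr ↦
        ⟨⟨le_min hr.1 ht.1, min_le_of_left_le hr.2⟩, ⟨le_max_of_le_left hr.1, max_le hr.2 ht.2⟩,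
          min_le_max⟩
      simpa [ContinuousWithinAt, Function.comp_def, hω_diag t ht] using
        hω.comp hcont.continuousOn hmem t ht
    rw [ContinuousWithinAt, tendsto_iff_norm_sub_tendsto_zero]
    refine squeeze_zero' (Eventually.of_forall fun r ↦ norm_nonneg _) ?_ hlim
    filter_upwards [self_mem_nhdsWithin] with r hr
    rcases le_total r t with hrt | htr
    · rw [min_eq_left hrt, max_eq_right hrt, norm_sub_rev]
      exact norm_sub_le r t hr.1 hrt ht.2
    · rw [min_eq_right htr, max_eq_left htr]
      exact norm_sub_le t r ht.1 htr hr.2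
  refine ((from_zero.comp continuousOn_snd fun p hp ↦ hp.2.1).sub
    (from_zero.comp continuousOn_fst fun p hp ↦ hp.1)).congr fun p hp ↦ ?_
  simp [hJ 0 p.1 p.2 le_rfl hp.1.1 hp.2.2 hp.2.1.2]

theorem exists_isSewing [CompleteSpace V] (hμ : 1 < μ)
    (hcont : ContinuousOn (fun p : ℝ × ℝ ↦ M p.1 p.2) (simplex (Set.Icc 0 T)))
    (hM : ∀ s r t, 0 ≤ s → s ≤ r → r ≤ t → t ≤ T → ‖cobd M s r t‖ ≤ C * (t - s) ^ μ) :
    ∃ N, IsSewing μ T (cobd M) N := by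
  have hμ0 : 0 < μ := zero_lt_one.trans hμ
  obtain ⟨J, hJ, hJM⟩ := exists_additiveOn_norm_sub_le hμ hM
  have diag (t : ℝ) (ht : t ∈ Set.Icc 0 T) : M t t = 0 := by
    simpa [cobd, Real.zero_rpow hμ0.ne'] using hM t t t ht.1 le_rfl le_rfl ht.2
  have hJ_cont : ContinuousOn (fun p : ℝ × ℝ ↦ J p.1 p.2) (simplex (Set.Icc 0 T)) := by
    refine hJ.continuousOn (ω := fun p ↦ sewC μ * C * (p.2 - p.1) ^ μ + ‖M p.1 p.2‖) ?_ ?_ ?_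
    · refine ContinuousOn.add (Continuous.continuousOn ?_) hcont.norm
      exact continuous_const.mul ((continuous_snd.sub continuous_fst).rpow_const
        fun _ ↦ Or.inr hμ0.le)
    · intro t ht
      simp [diag t ht, Real.zero_rpow hμ0.ne']
    · exact fun s t hs hst ht ↦ norm_le_norm_sub_add (J s t) (M s t) |>.trans
        (by gcongr; exact hJM s t hs hst ht)
  refine ⟨fun s t ↦ M s t - J s t, ⟨hcont.sub hJ_cont, fun t ht ↦ ?_, ?_⟩,
    fun s r t hs hsr hrt ht ↦ ?_⟩
  · rw [diag t ht, hJ.diag ht.1 ht.2, sub_zero]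
  · refine holderSup_ne_top (c := sewC μ * C) fun s hs t ht hst ↦ ?_
    rw [norm_sub_rev]
    exact hJM s t hs.1 hst.le ht.2
  · rw [cobd_sub, hJ.cobd_eq_zero hs hsr hrt ht, sub_zero]

theorem isSewing_sewing (hN : ∃ N, IsSewing μ T h N) : IsSewing μ T h (sewing μ T h) := by
  rw [sewing, dif_pos hN]
  exact hN.choose_spec

theorem IsSewing.norm_le_toNNReal (hμ : 1 < μ) (hN : IsSewing μ T h N) (hs : 0 ≤ s) (hst : s ≤ t)
    (ht : t ≤ T) : ‖N s t‖ ≤ (N2 μ (Set.Icc 0 T) N).toNNReal * (t - s) ^ μ :=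
  hN.1.norm_le (zero_lt_one.trans hμ).ne' ⟨hs, hst.trans ht⟩ ⟨hs.trans hst, ht⟩ hst

theorem IsSewing.unique (hμ : 1 < μ) (hN : IsSewing μ T h N) (hN' : IsSewing μ T h N')
    (hs : 0 ≤ s) (hst : s ≤ t) (ht : t ≤ T) : N s t = N' s t := by
  have hadd : AdditiveOn s t fun x y ↦ N x y - N' x y :=
    additiveOn_sub_of_cobd_eq fun x r y hx hxr hry hy ↦
      (hN.2 x r y (hs.trans hx) hxr hry (hy.trans ht)).trans
        (hN'.2 x r y (hs.trans hx) hxr hry (hy.trans ht)).symm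
  refine sub_eq_zero.1 (hadd.eq_of_rpow (M := N) (c := (N2 μ (Set.Icc 0 T) N').toNNReal)
    (c' := (N2 μ (Set.Icc 0 T) N).toNNReal) additiveOn_zero hμ hst ?_ ?_)
  · intro x y hx hxy hy
    simpa using hN'.norm_le_toNNReal hμ (hs.trans hx) hxy (hy.trans ht)
  · intro x y hx hxy hy
    simpa using hN.norm_le_toNNReal hμ (hs.trans hx) hxy (hy.trans ht)

theorem norm_le_of_cobd_le [CompleteSpace V] (hμ : 1 < μ)
    (hL : ∀ s t, a ≤ s → s ≤ t → t ≤ b → ‖M s t‖ ≤ L * (t - s) ^ μ)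
    (hM : ∀ s r t, a ≤ s → s ≤ r → r ≤ t → t ≤ b → ‖cobd M s r t‖ ≤ C * (t - s) ^ μ)
    (has : a ≤ s) (hst : s ≤ t) (htb : t ≤ b) : ‖M s t‖ ≤ sewC μ * C * (t - s) ^ μ := by
  obtain ⟨J, hJ, hJM⟩ := exists_additiveOn_norm_sub_le hμ hM
  have hJ_zero : J s t = 0 := by
    refine (hJ.mono has htb).eq_of_rpow (M := M) (c := sewC μ * C) (c' := L) additiveOn_zero hμ hst
      ?_ ?_
    · exact fun x y hx hxy hy ↦ hJM x y (has.trans hx) hxy (hy.trans htb)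
    · intro x y hx hxy hy
      simpa using hL x y (has.trans hx) hxy (hy.trans htb)
  simpa [hJ_zero] using hJM s t has hst htb

end SewingMap

/-! ### Conditional expectations on tracial von Neumann algebras -/

section PositiveFunctional

open scoped ComplexOrder

theorem re_map_mono {B : Type*} [CStarAlgebra B] [PartialOrder B] {φ : B →ₚ[ℂ] ℂ} {x y : B}
    (h : x ≤ y) : (φ x).re ≤ (φ y).re :=
  (Complex.le_def.1 (OrderHomClass.mono φ h)).1

variable {B : Type*} [CStarAlgebra B] [PartialOrder B] [StarOrderedRing B]

theorem norm_le_one_of_mul_star_add_mul_star_eq_one {x y : B}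
    (h : x * star x + y * star y = 1) : ‖x‖ ≤ 1 := by
  have hx : x * star x ≤ 1 := h ▸ le_add_of_nonneg_right (mul_star_self_nonneg y)
  have hnorm := (CStarAlgebra.norm_le_one_iff_of_nonneg _ (mul_star_self_nonneg x)).2 hx
  rw [CStarRing.norm_self_mul_star, ← sq] at hnorm
  exact (sq_le_one_iff₀ (norm_nonneg x)).1 hnorm

theorem mul_star_le_one_of_norm_le_one {a : B} (ha : ‖a‖ ≤ 1) : a * star a ≤ 1 := by
  refine (CStarAlgebra.norm_le_one_iff_of_nonneg _ (mul_star_self_nonneg a)).1 ?_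
  rw [CStarRing.norm_self_mul_star]
  exact mul_le_one₀ ha (norm_nonneg a) ha

theorem exists_selfAdjoint_unit_pow_four_eq {a : B} (ha : IsStrictlyPositive a) :
    ∃ c : Bˣ, star c = c ∧ (c : B) ^ 4 = a := by
  refine ⟨⟨a ^ (1 / 4 : ℝ), a ^ (-(1 / 4) : ℝ), CFC.rpow_mul_rpow_neg _,
    CFC.rpow_neg_mul_rpow _⟩, Units.ext ?_, ?_⟩
  · exact (IsSelfAdjoint.of_nonneg CFC.rpow_nonneg).star_eq
  · simp only [pow_succ, pow_zero, one_mul, ← CFC.rpow_add ha.isUnit]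
    norm_num [CFC.rpow_one a ha.nonneg]

theorem exists_selfAdjoint_unit_pow_four_eq_star_mul_self_add (b : B) {ε : ℝ} (hε : 0 < ε) :
    ∃ c : Bˣ, star c = c ∧ (c : B) ^ 4 = star b * b + ε ^ 2 • 1 :=
  exists_selfAdjoint_unit_pow_four_eq <|
    (isStrictlyPositive_one.smul (pow_pos hε 2)).nonneg_add (star_mul_self_nonneg b)

theorem two_mul_re_map_mul_le {φ : B →ₚ[ℂ] ℂ} (x y : B) :
    2 * (φ (x * y)).re ≤ (φ (x * star x)).re + (φ (star y * y)).re := by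
  have hpos : 0 ≤ (φ ((x - star y) * star (x - star y))).re := by
    simpa using re_map_mono (φ := φ) (mul_star_self_nonneg (x - star y))
  have hstar : (φ (star (x * y))).re = (φ (x * y)).re := by rw [map_star]; rfl
  have hexpand : (x - star y) * star (x - star y) =
      x * star x - x * y - star (x * y) + star y * y := by
    simp only [star_sub, star_star, star_mul]; noncomm_ring
  rw [hexpand] at hpos
  simp only [map_add, map_sub, Complex.add_re, Complex.sub_re, hstar] at hpos
  linarith

section Polar

-- `c² = (b* b + ε²) ^ (1 / 2)`, so that `c⁻² b*` is a regularized polar part of `b*`.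
variable {b c d : B} {ε : ℝ}

omit [PartialOrder B] [StarOrderedRing B] in
theorem polar_mul_star_add (hcd : c * d = 1) (hdc : d * c = 1) (hd : star d = d)
    (h : c ^ 4 = star b * b + ε ^ 2 • 1) :
    d * d * star b * star (d * d * star b) + ε • (d * d) * star (ε • (d * d)) = 1 := by
  calc _ = d * d * (star b * b + ε ^ 2 • 1) * (d * d) := by
        simp only [star_mul, star_smul, hd, star_star, star_trivial, sq ε, mul_smul,
          mul_add, add_mul, mul_smul_comm, smul_mul_assoc, mul_one, mul_assoc]
    _ = d * (d * c) * c * (c * (c * d) * d) := by rw [← h]; noncomm_ring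
    _ = 1 := by simp only [hcd, hdc, mul_one]

theorem norm_polar_le_one (hcd : c * d = 1) (hdc : d * c = 1) (hd : star d = d)
    (h : c ^ 4 = star b * b + ε ^ 2 • 1) : ‖d * d * star b‖ ≤ 1 :=
  norm_le_one_of_mul_star_add_mul_star_eq_one (polar_mul_star_add hcd hdc hd h)

theorem re_map_mul_le_polar {φ : B →ₚ[ℂ] ℂ} (hφ : ∀ x y, φ (x * y) = φ (y * x)) {a : B}
    (ha : ‖a‖ ≤ 1) (hε : 0 ≤ ε) (hcd : c * d = 1) (hdc : d * c = 1) (hc : star c = c)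
    (hd : star d = d) (h : c ^ 4 = star b * b + ε ^ 2 • 1) :
    (φ (a * b)).re ≤ (φ (d * d * star b * b)).re + ε * (φ 1).re := by
  have hsplit : φ (a * b) = φ (c * a * (b * d)) := by
    calc φ (a * b) = φ (a * b * d * c) := by rw [mul_assoc _ d, hdc, mul_one]
      _ = φ (c * (a * b * d)) := hφ _ _
      _ = φ (c * a * (b * d)) := by simp only [mul_assoc]
  have hca : (φ (c * a * star (c * a))).re ≤ (φ (c * c)).re := by
    refine re_map_mono ?_
    simpa [hc, mul_assoc] using
      star_right_conjugate_le_conjugate (mul_star_le_one_of_norm_le_one ha) c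
  have hbd : φ (star (b * d) * (b * d)) = φ (d * d * star b * b) := by
    rw [star_mul, hd, ← mul_assoc, hφ _ d]; simp only [mul_assoc]
  have hcc : c * c = star (b * d) * (b * d) + ε ^ 2 • (d * d) := by
    calc c * c = d * c ^ 4 * d := by
          rw [show d * c ^ 4 * d = d * c * c * c * (c * d) by noncomm_ring, hcd, hdc]; simp
      _ = star (b * d) * (b * d) + ε ^ 2 • (d * d) := by
        simp only [h, star_mul, hd, mul_add, add_mul, mul_smul_comm, smul_mul_assoc, mul_one,
          mul_assoc]
  have hεd : ε * (φ (d * d)).re ≤ (φ 1).re := by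
    have hnorm : ‖ε • (d * d)‖ ≤ 1 := norm_le_one_of_mul_star_add_mul_star_eq_one
      ((add_comm _ _).trans (polar_mul_star_add hcd hdc hd h))
    have hnonneg : 0 ≤ ε • (d * d) := smul_nonneg hε (by simpa [hd] using mul_star_self_nonneg d)
    simpa using re_map_mono (φ := φ) ((CStarAlgebra.norm_le_one_iff_of_nonneg _ hnonneg).1 hnorm)
  have hone : 0 ≤ (φ 1).re := by simpa using re_map_mono (φ := φ) (zero_le_one (α := B))
  have hcauchy := two_mul_re_map_mul_le (φ := φ) (c * a) (b * d)
  have hφcc : (φ (c * c)).re = (φ (d * d * star b * b)).re + ε ^ 2 * (φ (d * d)).re := by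
    rw [hcc, map_add, hbd, PositiveLinearMap.map_smul_of_tower, Complex.add_re,
      Complex.smul_re, smul_eq_mul]
  rw [hbd] at hcauchy
  rw [hsplit]
  nlinarith [mul_le_mul_of_nonneg_left hεd hε]

end Polar

end PositiveFunctional

section WeakOperatorTopology

open Filter Topology

variable {H : Type*} [NormedAddCommGroup H] [InnerProductSpace ℂ H] [CompleteSpace H]

theorem exists_continuousLinearMap_of_tendsto_inner {l : Filter (H →WOT[ℂ] H)} [l.NeBot] {r : ℝ}
    (hr : 0 ≤ r) (hl : ∀ᶠ x in l, ‖x.toCLM‖ ≤ r) {β : H → H → ℂ}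
    (hβ : ∀ h k, Tendsto (fun x : H →WOT[ℂ] H ↦ inner ℂ (x h) k) l (𝓝 (β h k))) :
    ∃ y : H →L[ℂ] H, ‖y‖ ≤ r ∧ ∀ h k, inner ℂ (y h) k = β h k := by
  have hβr : ∀ h k, ‖β h k‖ ≤ r * ‖h‖ * ‖k‖ := fun h k ↦
    le_of_tendsto (hβ h k).norm <| hl.mono fun x hx ↦
      (norm_inner_le_norm _ _).trans (by gcongr; exact x.toCLM.le_of_opNorm_le hx h)
  let L : H →L⋆[ℂ] H →L[ℂ] ℂ := LinearMap.mkContinuous₂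
    (LinearMap.mk₂'ₛₗ (starRingEnd ℂ) (RingHom.id ℂ) β
      (fun h h' k ↦ tendsto_nhds_unique (hβ _ _)
        (((hβ h k).add (hβ h' k)).congr fun x ↦ by rw [map_add, inner_add_left]))
      (fun c h k ↦ tendsto_nhds_unique (hβ _ _)
        (((hβ h k).const_mul (starRingEnd ℂ c)).congr fun x ↦ by rw [map_smul, inner_smul_left]))
      (fun h k k' ↦ tendsto_nhds_unique (hβ _ _)
        (((hβ h k).add (hβ h k')).congr fun x ↦ by rw [inner_add_right]))
      (fun c h k ↦ tendsto_nhds_unique (hβ _ _)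
        (((hβ h k).const_mul c).congr fun x ↦ by rw [inner_smul_right]))) r hβr
  have hL : ∀ h k, inner ℂ (InnerProductSpace.continuousLinearMapOfBilin L h) k = β h k :=
    fun h k ↦ InnerProductSpace.continuousLinearMapOfBilin_apply L h k
  refine ⟨_, ContinuousLinearMap.opNorm_le_of_re_inner_le hr fun h k hh hk ↦ ?_, hL⟩
  rw [hL]
  simpa [hh, hk] using (RCLike.re_le_norm _).trans (hβr h k)

theorem isCompact_wot_closedBall {r : ℝ} (hr : 0 ≤ r) :
    IsCompact {x : H →WOT[ℂ] H | ‖x.toCLM‖ ≤ r} := by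
  rw [isCompact_iff_ultrafilter_le_nhds']
  intro l hl
  have hlim : ∀ h k, ∃ z, Tendsto (fun x : H →WOT[ℂ] H ↦ inner ℂ (x h) k) l (𝓝 z) := fun h k ↦ by
    obtain ⟨z, -, hz⟩ := (isCompact_closedBall (0 : ℂ) (r * ‖h‖ * ‖k‖)).ultrafilter_le_nhds'
      (l.map fun x : H →WOT[ℂ] H ↦ inner ℂ (x h) k) <| by
        refine Ultrafilter.mem_map.2 <| mem_of_superset hl fun x (hx : ‖x.toCLM‖ ≤ r) ↦ ?_
        simpa using (norm_inner_le_norm _ _).trans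
          (by gcongr; exact x.toCLM.le_of_opNorm_le hx h)
    exact ⟨z, hz⟩
  choose β hβ using hlim
  obtain ⟨y, hy, hyβ⟩ := exists_continuousLinearMap_of_tendsto_inner hr hl hβ
  refine ⟨.ofCLM y, hy, ?_⟩
  rw [ContinuousLinearMapWOT.le_nhds_iff_forall_inner_apply_le_nhds]
  intro h k
  have hconj := (continuous_star.tendsto _).comp (hβ h k)
  rw [← hyβ] at hconj
  simpa only [Tendsto, Function.comp_def, RCLike.star_def, inner_conj_symm,
    ContinuousLinearMapWOT.ofCLM_apply] using hconj

theorem continuous_wot_mul_left (q : H →WOT[ℂ] H) : Continuous fun x : H →WOT[ℂ] H ↦ q * x :=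
  ContinuousLinearMapWOT.continuous_iff.2 fun h k ↦ by
    simpa [ContinuousLinearMap.adjoint_inner_left] using
      ContinuousLinearMapWOT.continuous_inner_apply (continuous_id (X := H →WOT[ℂ] H)) h
        (ContinuousLinearMap.adjoint q.toCLM k)

theorem continuous_wot_mul_right (q : H →WOT[ℂ] H) : Continuous fun x : H →WOT[ℂ] H ↦ x * q :=
  ContinuousLinearMapWOT.continuous_iff.2 fun h k ↦
    ContinuousLinearMapWOT.continuous_inner_apply (continuous_id (X := H →WOT[ℂ] H)) (q h) k

theorem isClosed_wot_centralizer (Q : Set (H →L[ℂ] H)) :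
    IsClosed {x : H →WOT[ℂ] H | x.toCLM ∈ Q.centralizer} := by
  simp only [Set.mem_centralizer_iff, Set.ofPred_forall]
  refine isClosed_biInter fun q _ ↦ ?_
  simpa only [← ContinuousLinearMapWOT.toCLM_injective.eq_iff, ContinuousLinearMapWOT.toCLM_mul,
    ContinuousLinearMapWOT.toCLM_ofCLM] using
    isClosed_eq (continuous_wot_mul_left (.ofCLM q)) (continuous_wot_mul_right (.ofCLM q))

end WeakOperatorTopology

section Expectation

variable {H : Type*} [NormedAddCommGroup H] [InnerProductSpace ℂ H] [CompleteSpace H]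

/-- The C⋆-algebra structure of a von Neumann algebra. -/
noncomputable abbrev vonNeumannCStar (A : VonNeumannAlgebra H) :
    CStarAlgebra A.toStarSubalgebra where
  toCompleteSpace := inferInstance
  norm_mul_self_le x := CStarRing.norm_star_mul_self (x := (x : H →L[ℂ] H)) |>.symm.le

/-- `N` is the set of operators that commute with `Q`, all of which lie in `A`: the commutant form
of a von Neumann subalgebra of `A`. -/
structure IsCommutantOf (A : VonNeumannAlgebra H) (N : StarSubalgebra ℂ A.toStarSubalgebra)
    (Q : Set (H →L[ℂ] H)) : Prop where
  mem_iff : ∀ x : A.toStarSubalgebra, x ∈ N ↔ (x : H →L[ℂ] H) ∈ Q.centralizer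
  mem_of_mem : ∀ x ∈ Q.centralizer, x ∈ A.toStarSubalgebra

variable {A : VonNeumannAlgebra H} {N : StarSubalgebra ℂ A.toStarSubalgebra}
  {Q : Set (H →L[ℂ] H)} {φ : A.toStarSubalgebra →ₗ[ℂ] ℂ}

theorem IsCommutantOf.isClosed (hN : IsCommutantOf A N Q) :
    IsClosed (N : Set A.toStarSubalgebra) := by
  rw [show (N : Set A.toStarSubalgebra) = Subtype.val ⁻¹' Q.centralizer from Set.ext hN.mem_iff]
  exact (Set.isClosed_centralizer _).preimage continuous_subtype_val

theorem IsCommutantOf.isCompact_range_unitBall (hN : IsCommutantOf A N Q) :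
    IsCompact (Set.range fun y : {y : N // ‖y‖ ≤ 1} ↦
      (.ofCLM ((y.1 : A.toStarSubalgebra) : H →L[ℂ] H) : H →WOT[ℂ] H)) := by
  convert (isCompact_wot_closedBall zero_le_one).inter_right (isClosed_wot_centralizer Q) using 1
  ext x
  constructor
  · rintro ⟨y, rfl⟩
    exact ⟨y.2, (hN.mem_iff _).1 y.1.2⟩
  · exact fun ⟨hx, hxQ⟩ ↦ ⟨⟨⟨⟨_, hN.mem_of_mem _ hxQ⟩, (hN.mem_iff _).2 hxQ⟩, hx⟩, rfl⟩

theorem IsTrace.continuous_map_mul (hφ : IsTrace A φ) {ι : Type*} [TopologicalSpace ι]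
    {y : ι → A.toStarSubalgebra} (hy : ∀ i, ‖y i‖ ≤ 1)
    (hcont : Continuous fun i ↦ (.ofCLM (y i : H →L[ℂ] H) : H →WOT[ℂ] H))
    (b : A.toStarSubalgebra) : Continuous fun i ↦ φ (y i * b) := by
  set τ : ℂ := ((‖b‖ + 1 : ℝ) : ℂ)⁻¹
  have hpos : 0 < ‖b‖ + 1 := by positivity
  have hτ : τ ≠ 0 := inv_ne_zero (by exact_mod_cast hpos.ne')
  have hτb : ‖τ • b‖ ≤ 1 := by
    rw [norm_smul, norm_inv, Complex.norm_real, Real.norm_of_nonneg hpos.le,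
      inv_mul_le_one₀ hpos]
    linarith
  have hball : ∀ i, ‖y i * τ • b‖ ≤ 1 := fun i ↦
    (norm_mul_le _ _).trans (mul_le_one₀ (hy i) (norm_nonneg _) hτb)
  let _ : TopologicalSpace {a : A.toStarSubalgebra // ‖a‖ ≤ 1} :=
    .induced (fun a ↦ (.ofCLM (a.1 : H →L[ℂ] H) : H →WOT[ℂ] H)) inferInstance
  have hscaled : Continuous fun i ↦ φ (y i * τ • b) :=
    hφ.weak_cont.comp (f := fun i ↦ ⟨y i * τ • b, hball i⟩) <| continuous_induced_rng.2 <|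
      (continuous_wot_mul_right (.ofCLM ((τ • b : A.toStarSubalgebra) : H →L[ℂ] H))).comp hcont
  simpa [mul_smul_comm, hτ] using hscaled.const_mul τ⁻¹

open scoped ComplexOrder in
theorem IsTrace.exists_re_map_mul_le (hφ : IsTrace A φ) (hN : IsCommutantOf A N Q) {b : N} {ε : ℝ}
    (hε : 0 < ε) {a : A.toStarSubalgebra} (ha : ‖a‖ ≤ 1) :
    ∃ x : N, ‖x‖ ≤ 1 ∧ (φ (a * b)).re ≤ (φ (x * b)).re + ε := by
  let _ : CStarAlgebra A.toStarSubalgebra := vonNeumannCStar A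
  let _ := CStarAlgebra.spectralOrder A.toStarSubalgebra
  have _ := CStarAlgebra.spectralOrderedRing A.toStarSubalgebra
  have _ : IsClosed (N : Set A.toStarSubalgebra) := hN.isClosed
  let _ : CStarAlgebra N := StarSubalgebra.cstarAlgebra N
  let _ := CStarAlgebra.spectralOrder N
  have _ := CStarAlgebra.spectralOrderedRing N
  let ψ : A.toStarSubalgebra →ₚ[ℂ] ℂ := PositiveLinearMap.mk₀ φ fun x hx ↦ by
    obtain ⟨y, rfl⟩ := CStarAlgebra.nonneg_iff_eq_star_mul_self.1 hx
    rw [hφ.tracial]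
    exact Complex.nonneg_iff.2 ⟨(hφ.nonneg y).1, (hφ.nonneg y).2.symm⟩
  obtain ⟨c, hc, h⟩ := exists_selfAdjoint_unit_pow_four_eq_star_mul_self_add b hε
  have hd : star (↑c⁻¹ : N) = ↑c⁻¹ := by rw [← Units.coe_star_inv, hc]
  refine ⟨_, norm_polar_le_one c.mul_inv c.inv_mul hd h, ?_⟩
  have := re_map_mul_le_polar (φ := ψ) (b := (b : A.toStarSubalgebra)) hφ.tracial ha hε.le
    (congrArg Subtype.val c.mul_inv) (congrArg Subtype.val c.inv_mul)
    (congrArg Subtype.val (Units.ext_iff.1 hc)) (congrArg Subtype.val hd) (congrArg Subtype.val h)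
  have hψ : ψ 1 = 1 := hφ.map_one
  rwa [hψ, Complex.one_re, mul_one] at this

/-- The duality pairing `⟨x, b⟩ = φ(x b)` between `A` and `N`. -/
noncomputable def tracePairing (φ : A.toStarSubalgebra →ₗ[ℂ] ℂ)
    (N : StarSubalgebra ℂ A.toStarSubalgebra) : A.toStarSubalgebra →ₗ[ℂ] N →ₗ[ℂ] ℂ :=
  ((LinearMap.mul ℂ A.toStarSubalgebra).compr₂ φ).compl₂ (incl N).toLinearMap

theorem convex_image_unitBall {E F : Type*} [NormedAddCommGroup E] [NormedSpace ℂ E]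
    [AddCommGroup F] [Module ℂ F] [Module ℝ F] [IsScalarTower ℝ ℂ F] (L : E →ₗ[ℂ] F) :
    Convex ℝ (Set.range fun x : {x : E // ‖x‖ ≤ 1} ↦ L x) := by
  have h := (convex_closedBall (0 : E) 1).linear_image (L.restrictScalars ℝ)
  simpa [Set.range, Set.image, Subtype.exists] using h

theorem IsTrace.exists_expectation_of_norm_le_one (hφ : IsTrace A φ) (hN : IsCommutantOf A N Q)
    {a : A.toStarSubalgebra} (ha : ‖a‖ ≤ 1) :
    ∃ x : N, ‖x‖ ≤ 1 ∧ ∀ b : N, φ (x * b) = φ (a * b) := by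
  let Bil : (N →ₗ[ℂ] ℂ) →ₗ[ℂ] N →ₗ[ℂ] ℂ := LinearMap.id
  let L : N →ₗ[ℂ] WeakBilin Bil := (tracePairing φ N).comp (incl N).toLinearMap
  let K : Set (WeakBilin Bil) := Set.range fun x : {x : N // ‖x‖ ≤ 1} ↦ L x
  have hKconv : Convex ℝ K := convex_image_unitBall L
  have hKclosed : IsClosed K := by
    have _ : T2Space (WeakBilin Bil) :=
      (WeakBilin.isEmbedding (B := Bil) Function.injective_id).t2Space
    let _ : TopologicalSpace {x : N // ‖x‖ ≤ 1} :=
      .induced (fun y ↦ (.ofCLM ((y.1 : A.toStarSubalgebra) : H →L[ℂ] H) : H →WOT[ℂ] H))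
        inferInstance
    have _ : CompactSpace {x : N // ‖x‖ ≤ 1} := by
      rw [← isCompact_univ_iff, Topology.IsInducing.isCompact_iff ⟨rfl⟩, Set.image_univ]
      exact hN.isCompact_range_unitBall
    have hcont : Continuous fun x : {x : N // ‖x‖ ≤ 1} ↦ L x :=
      WeakBilin.continuous_of_continuous_eval Bil fun b ↦
        hφ.continuous_map_mul (fun x ↦ x.2) continuous_induced_dom b
    exact (isCompact_range hcont).isClosed
  by_contra! hcon
  have hnot : (tracePairing φ N a : WeakBilin Bil) ∉ K := by
    rintro ⟨x, h⟩
    obtain ⟨b, hb⟩ := hcon x x.2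
    exact hb (LinearMap.congr_fun h b)
  obtain ⟨f, u, hf1, hf2⟩ :=
    RCLike.geometric_hahn_banach_closed_point (𝕜 := ℂ) hKconv hKclosed hnot
  obtain ⟨b, rfl⟩ := LinearMap.dualEmbedding_surjective Bil f
  have hfa : u < (φ (a * b)).re := hf2
  obtain ⟨x, hx, h⟩ := hφ.exists_re_map_mul_le hN (b := b) (sub_pos.2 hfa) ha
  have hfx : (φ (x * b)).re < u := hf1 _ ⟨⟨x, hx⟩, rfl⟩
  linarith

end Expectation

section Retraction

variable {H : Type*} [NormedAddCommGroup H] [InnerProductSpace ℂ H] [CompleteSpace H]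
  {A : VonNeumannAlgebra H} {N : StarSubalgebra ℂ A.toStarSubalgebra}
  {Q : Set (H →L[ℂ] H)} {φ : A.toStarSubalgebra →ₗ[ℂ] ℂ}

theorem IsTrace.exists_expectation (hφ : IsTrace A φ) (hN : IsCommutantOf A N Q)
    (a : A.toStarSubalgebra) : ∃ x : N, ‖x‖ ≤ ‖a‖ ∧ ∀ b : N, φ (x * b) = φ (a * b) := by
  rcases eq_or_ne a 0 with rfl | ha
  · exact ⟨0, by simp, fun b ↦ by simp⟩
  set r : ℂ := ((‖a‖ : ℝ) : ℂ)
  have hr : r ≠ 0 := by simpa [r] using ha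
  obtain ⟨x, hx, h⟩ := hφ.exists_expectation_of_norm_le_one hN (a := r⁻¹ • a)
    (by simp [r, norm_smul, ha])
  refine ⟨r • x, ?_, fun b ↦ ?_⟩
  · simpa [r, norm_smul] using mul_le_of_le_one_right (norm_nonneg a) hx
  · calc φ (r • (x : A.toStarSubalgebra) * b) = r * φ (x * b) := by
          rw [smul_mul_assoc, map_smul, smul_eq_mul]
      _ = φ (a * b) := by
          rw [h b, smul_mul_assoc, map_smul, smul_eq_mul, mul_inv_cancel_left₀ hr]

theorem IsTrace.eq_of_map_mul_eq (hφ : IsTrace A φ) {x y : N}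
    (h : ∀ b : N, φ (x * b) = φ (y * b)) : x = y := by
  refine sub_eq_zero.1 (Subtype.ext (hφ.faithful (x - y : N) ?_))
  simpa [sub_mul, sub_eq_zero] using h (star (x - y))

-- The projection is the `φ`-preserving conditional expectation onto `N`.
theorem IsTrace.exists_retraction (hφ : IsTrace A φ) (hN : IsCommutantOf A N Q) :
    ∃ E : A.toStarSubalgebra →L[ℂ] N, ‖E‖ ≤ 1 ∧ Function.LeftInverse E (incl N) := by
  choose E hE_norm hE using hφ.exists_expectation hN
  let L : A.toStarSubalgebra →ₗ[ℂ] N :=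
    { toFun := E
      map_add' := fun x y ↦ hφ.eq_of_map_mul_eq fun b ↦ by
        simp only [hE, AddMemClass.coe_add, add_mul, map_add]
      map_smul' := fun c x ↦ hφ.eq_of_map_mul_eq fun b ↦ by
        simp only [hE, RingHom.id_apply, SetLike.val_smul, smul_mul_assoc, map_smul] }
  exact ⟨L.mkContinuous 1 fun x ↦ (hE_norm x).trans_eq (one_mul _).symm,
    LinearMap.mkContinuous_norm_le _ zero_le_one _, fun x ↦ hφ.eq_of_map_mul_eq fun b ↦ hE _ b⟩

theorem genFiltr_isCommutantOf (A : VonNeumannAlgebra H) (X : ℝ → A.toStarSubalgebra) (t : ℝ) :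
    ∃ Q, IsCommutantOf A ((genFiltr A X).alg t) Q := by
  set C : StarSubalgebra ℂ (H →L[ℂ] H) := StarSubalgebra.centralizer ℂ
    {x : H →L[ℂ] H | ∃ s, 0 ≤ s ∧ s ≤ t ∧ x = X s}
  have hmem : ∀ x : A.toStarSubalgebra, x ∈ (genFiltr A X).alg t ↔
      (x : H →L[ℂ] H) ∈ StarSubalgebra.centralizer ℂ (C : Set (H →L[ℂ] H)) := fun x ↦ Iff.rfl
  refine ⟨(C : Set (H →L[ℂ] H)) ∪ (A : Set (H →L[ℂ] H)).centralizer, fun x ↦ ?_, fun x hx ↦ ?_⟩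
  · rw [hmem, StarSubalgebra.mem_centralizer_iff]
    constructor
    · rintro h q (hq | hq)
      · exact (h q hq).1
      · exact (hq _ x.2).symm
    · exact fun h q hq ↦ ⟨h q (.inl hq), h _ (.inl (star_mem (s := C) hq))⟩
  · have hx' : x ∈ (A : Set (H →L[ℂ] H)).centralizer.centralizer := fun q hq ↦ hx q (.inr hq)
    rwa [VonNeumannAlgebra.centralizer_centralizer] at hx'

theorem mem_genFiltr (A : VonNeumannAlgebra H) (X : ℝ → A.toStarSubalgebra) {s t : ℝ} (hs : 0 ≤ s)
    (hst : s ≤ t) : X s ∈ (genFiltr A X).alg t := by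
  change (X s : H →L[ℂ] H) ∈ StarSubalgebra.centralizer ℂ _
  have hcomm : ∀ q ∈ StarSubalgebra.centralizer ℂ
      {x : H →L[ℂ] H | ∃ s, 0 ≤ s ∧ s ≤ t ∧ x = X s}, q * X s = X s * q := fun q hq ↦
    (((StarSubalgebra.mem_centralizer_iff ℂ).1 hq (X s) ⟨s, hs, hst, rfl⟩).1).symm
  exact (StarSubalgebra.mem_centralizer_iff ℂ).2 fun q hq ↦ ⟨hcomm q hq, hcomm _ (star_mem hq)⟩

end Retraction

/-! ### The rough integral -/

section RoughData

variable {A : Type*} [NormedRing A] [NormedAlgebra ℂ A] [StarRing A] [StarModule ℂ A]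
  [CompleteSpace A]

/-- A path with a product Lévy area and a bicontrolled biprocess, adapted to an abstract filtration
that has contractive projections onto the subalgebras `F.alg t`: in a tracial von Neumann algebra
these are the conditional expectations. -/
structure IsRoughData (F : Filtr A) (γ T : ℝ) (X : ℝ → A)
    (XX : ∀ s : ℝ, ℝ → (PT (F.alg s) 2 →L[ℂ] A)) (U : ∀ t, PT (F.alg t) 2)
    (U1 U2 : ∀ t, PT (F.alg t) 3) : Prop where
  one_lt : 1 < 3 * γ
  pos : 0 < T
  retraction : ∀ t, ∃ E : A →L[ℂ] F.alg t, ‖E‖ ≤ 1 ∧ Function.LeftInverse E (incl (F.alg t))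
  mem : ∀ s t, 0 ≤ s → s ≤ t → X s ∈ F.alg t
  selfAdjoint : ∀ t ∈ Set.Icc 0 T, IsSelfAdjoint (X t)
  holder : MemC1 γ (Set.Icc 0 T) X
  area : IsProductLevyArea F γ T X XX
  bicontrolled : IsBicontrolled F γ T X U U1 U2

variable {F : Filtr A} {γ T : ℝ} {X : ℝ → A} {XX : ∀ s : ℝ, ℝ → (PT (F.alg s) 2 →L[ℂ] A)}
  {U : ∀ t, PT (F.alg t) 2} {U1 U2 : ∀ t, PT (F.alg t) 3} {s r t : ℝ}

namespace IsRoughData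

variable (h : IsRoughData F γ T X XX U U1 U2)
include h

theorem γ_pos : 0 < γ := by linarith [h.one_lt]

theorem norm_mapPT_incl (t : ℝ) {k : ℕ} (w : PT (F.alg t) k) :
    ‖mapPT (incl (F.alg t)) k w‖ = ‖w‖ := by
  obtain ⟨E, hE, hE_left⟩ := h.retraction t
  exact norm_mapPT_of_leftInverse (norm_incl_le _) hE hE_left w

theorem isClosed_alg (t : ℝ) : IsClosed (F.alg t : Set A) := by
  obtain ⟨E, -, hE_left⟩ := h.retraction t
  have hE_fix : (F.alg t : Set A) = {x | incl (F.alg t) (E x) = x} := by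
    ext x
    exact ⟨fun hx ↦ congrArg (incl (F.alg t)) (hE_left ⟨x, hx⟩), fun hx ↦ hx ▸ (E x).2⟩
  exact hE_fix ▸ isClosed_eq ((incl _).comp E).continuous continuous_id

theorem norm_inclLE_sub {k : ℕ} (W : ∀ t, PT (F.alg t) k) (hst : s ≤ t) :
    ‖mapPT (inclLE (F.mono hst)) k (W s) - W t‖ = ‖incr (emb F W) s t‖ := by
  rw [← h.norm_mapPT_incl, map_sub, mapPT_incl_inclLE, norm_sub_rev, incr, emb, emb]

theorem chen (hs : 0 ≤ s) (hsr : s ≤ r) (hrt : r ≤ t) (ht : t ≤ T) (w : PT (F.alg s) 2) :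
    XX s t w - XX s r w - XX r t (mapPT (inclLE (F.mono hsr)) 2 w) =
      sharp (mapPT (incl (F.alg s)) 2 w) (incr X s r) * incr X r t := by
  obtain rfl | hsr' := hsr.eq_or_lt
  · have map_inclLE : mapPT (inclLE (F.mono hsr)) 2 w = w := mapPT_id w
    simp [map_inclLE, h.area.diag, incr_self, ← sharpCLM_apply]
  obtain rfl | hrt' := hrt.eq_or_lt
  · simp [h.area.diag, incr_self]
  · exact h.area.chen s r t hsr' hs hrt' ht w

theorem area_mem (hs : 0 ≤ s) (hst : s ≤ t) (ht : t ≤ T) (W : PT (F.alg s) 2) :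
    XX s t W ∈ F.alg t := by
  obtain rfl | hst := hst.eq_or_lt
  · simp [h.area.diag]
  · exact h.area.adapted s t hs hst ht W

theorem isSelfAdjoint_incr (hs : s ∈ Set.Icc 0 T) (ht : t ∈ Set.Icc 0 T) :
    IsSelfAdjoint (incr X s t) :=
  (h.selfAdjoint t ht).sub (h.selfAdjoint s hs)

end IsRoughData

/-- Rough data with explicit constants on `[l₁, l₂] ⊆ [0, T]`: Hölder constants `x`, `ξ`, `w`, `v`
of `X`, of the area, of the derivatives of the biprocess and of its remainder, and bounds `u` and
`m` of the biprocess and of its derivatives. -/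
structure HolderBounds (F : Filtr A) (γ T : ℝ) (X : ℝ → A)
    (XX : ∀ s : ℝ, ℝ → (PT (F.alg s) 2 →L[ℂ] A)) (U : ∀ t, PT (F.alg t) 2)
    (U1 U2 : ∀ t, PT (F.alg t) 3) (l₁ l₂ : ℝ) (x ξ u m w v : ℝ≥0) : Prop
    extends IsRoughData F γ T X XX U U1 U2 where
  zero_le : 0 ≤ l₁
  le_T : l₂ ≤ T
  path : ∀ s t, l₁ ≤ s → s ≤ t → t ≤ l₂ → ‖incr X s t‖ ≤ x * (t - s) ^ γ
  norm_area : ∀ s t, l₁ ≤ s → s ≤ t → t ≤ l₂ → ‖XX s t‖ ≤ ξ * (t - s) ^ (2 * γ)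
  biprocess : ∀ s ∈ Set.Icc l₁ l₂, ‖emb F U s‖ ≤ u
  derivs : ∀ s ∈ Set.Icc l₁ l₂, ‖emb F U1 s‖ + ‖emb F U2 s‖ ≤ m
  incr_derivs : ∀ s t, l₁ ≤ s → s ≤ t → t ≤ l₂ →
    ‖incr (emb F U1) s t‖ + ‖incr (emb F U2) s t‖ ≤ w * (t - s) ^ γ
  remainder : ∀ s t, l₁ ≤ s → s ≤ t → t ≤ l₂ → ‖birem F X U U1 U2 s t‖ ≤ v * (t - s) ^ (2 * γ)

namespace IsRoughData

variable (h : IsRoughData F γ T X XX U U1 U2)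
include h

theorem norm_area_le (hs : 0 ≤ s) (hst : s ≤ t) (ht : t ≤ T) :
    ‖XX s t‖ ≤ (areaNorm F (2 * γ) T XX).toNNReal * (t - s) ^ (2 * γ) := by
  obtain rfl | hst := hst.eq_or_lt
  · simp [h.area.diag, Real.zero_rpow (mul_pos two_pos h.γ_pos).ne']
  · exact le_of_holderSup_ne_top h.area.holder ⟨hs, hst.le.trans ht⟩ ⟨hs.trans hst.le, ht⟩ hst

theorem norm_derivs_le {l₁ l₂ : ℝ} {w : ℝ≥0}
    (hw : ∀ s t, l₁ ≤ s → s ≤ t → t ≤ l₂ →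
      ‖incr (emb F U1) s t‖ + ‖incr (emb F U2) s t‖ ≤ w * (t - s) ^ γ) (hs : s ∈ Set.Icc l₁ l₂) :
    ‖emb F U1 s‖ + ‖emb F U2 s‖ ≤
      ‖emb F U1 l₁‖ + ‖emb F U2 l₁‖ + ((l₂ - l₁) ^ γ).toNNReal * w := by
  have hl : 0 ≤ s - l₁ := sub_nonneg.2 hs.1
  have hγ := h.γ_pos
  calc ‖emb F U1 s‖ + ‖emb F U2 s‖
      ≤ (‖emb F U1 l₁‖ + ‖incr (emb F U1) l₁ s‖) + (‖emb F U2 l₁‖ + ‖incr (emb F U2) l₁ s‖) :=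
        add_le_add (norm_le_norm_add_norm_sub' _ _) (norm_le_norm_add_norm_sub' _ _)
    _ ≤ ‖emb F U1 l₁‖ + ‖emb F U2 l₁‖ + w * (s - l₁) ^ γ := by
        linarith [hw l₁ s le_rfl hs.1 hs.2]
    _ ≤ ‖emb F U1 l₁‖ + ‖emb F U2 l₁‖ + w * (l₂ - l₁) ^ γ := by gcongr; exact hs.2
    _ ≤ ‖emb F U1 l₁‖ + ‖emb F U2 l₁‖ + ((l₂ - l₁) ^ γ).toNNReal * w := by
        rw [mul_comm]
        gcongr
        exact Real.le_coe_toNNReal _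

theorem holderBounds {l₁ l₂ : ℝ} (hl₁ : 0 ≤ l₁) (hl₂ : l₂ ≤ T) :
    HolderBounds F γ T X XX U U1 U2 l₁ l₂ (N1 γ (Set.Icc 0 T) X).toNNReal
      (areaNorm F (2 * γ) T XX).toNNReal (N0 (Set.Icc l₁ l₂) (emb F U)).toNNReal
      (‖emb F U1 l₁‖₊ + ‖emb F U2 l₁‖₊ + ((l₂ - l₁) ^ γ).toNNReal *
        ((N1 γ (Set.Icc l₁ l₂) (emb F U1)).toNNReal + (N1 γ (Set.Icc l₁ l₂) (emb F U2)).toNNReal))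
      ((N1 γ (Set.Icc l₁ l₂) (emb F U1)).toNNReal + (N1 γ (Set.Icc l₁ l₂) (emb F U2)).toNNReal)
      (N2 (2 * γ) (Set.Icc l₁ l₂) (birem F X U U1 U2)).toNNReal := by
  have hγ := h.γ_pos.ne'
  have hsub : Set.Icc l₁ l₂ ⊆ Set.Icc 0 T := Set.Icc_subset_Icc hl₁ hl₂
  have mono {n : ℝ → ℝ → ℝ} {α : ℝ} (hn : holderSup α (Set.Icc 0 T) n ≠ ∞) :
      holderSup α (Set.Icc l₁ l₂) n ≠ ∞ := ne_top_of_le_ne_top hn (holderSup_mono hsub)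
  have incr_derivs (s t : ℝ) (hs : l₁ ≤ s) (hst : s ≤ t) (ht : t ≤ l₂) :
      ‖incr (emb F U1) s t‖ + ‖incr (emb F U2) s t‖ ≤
        ((N1 γ (Set.Icc l₁ l₂) (emb F U1)).toNNReal +
          (N1 γ (Set.Icc l₁ l₂) (emb F U2)).toNNReal : ℝ≥0) * (t - s) ^ γ := by
    have hsI : s ∈ Set.Icc l₁ l₂ := ⟨hs, hst.trans ht⟩
    have htI : t ∈ Set.Icc l₁ l₂ := ⟨hs.trans hst, ht⟩
    rw [NNReal.coe_add, add_mul]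
    exact add_le_add
      (norm_incr_le hγ (mono h.bicontrolled.holder_deriv1.finite) hsI htI hst)
      (norm_incr_le hγ (mono h.bicontrolled.holder_deriv2.finite) hsI htI hst)
  exact
    { h with
      zero_le := hl₁
      le_T := hl₂
      path := fun s t hs hst ht ↦ norm_incr_le hγ h.holder.finite
        (hsub ⟨hs, hst.trans ht⟩) (hsub ⟨hs.trans hst, ht⟩) hst
      norm_area := fun s t hs hst ht ↦ h.norm_area_le (hl₁.trans hs) hst (ht.trans hl₂)
      biprocess := fun s hs ↦
        norm_le_of_N0_ne_top (N0_ne_top isCompact_Icc (h.bicontrolled.holder.cont.mono hsub)) hs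
      derivs := fun s hs ↦ by exact_mod_cast h.norm_derivs_le incr_derivs hs
      incr_derivs := incr_derivs
      remainder := fun s t hs hst ht ↦
        norm_le_of_N2_ne_top (mul_ne_zero two_ne_zero hγ) (mono h.bicontrolled.rem_mem.finite)
          (h.bicontrolled.rem_mem.diag t (hsub ⟨hs.trans hst, ht⟩)) ⟨hs, hst.trans ht⟩
          ⟨hs.trans hst, ht⟩ hst }

end IsRoughData

namespace HolderBounds

theorem rpow_two_mul_le {p L : ℝ} (hγ : 0 ≤ γ) (hp : 0 ≤ p) (hpL : p ≤ L) :
    p ^ (2 * γ) ≤ L ^ γ * p ^ γ := by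
  rw [two_mul, Real.rpow_add_of_nonneg hp hγ hγ]
  gcongr

variable {l₁ l₂ : ℝ} {x ξ u m w v : ℝ≥0} (h : HolderBounds F γ T X XX U U1 U2 l₁ l₂ x ξ u m w v)
include h

theorem norm_sharp_birem_le (hs : l₁ ≤ s) (hsr : s ≤ r) (hrt : r ≤ t) (ht : t ≤ l₂) :
    ‖sharp (birem F X U U1 U2 s r) (incr X r t)‖ ≤ x * v * ((t - r) ^ γ * (r - s) ^ (2 * γ)) :=
  calc ‖sharp (birem F X U U1 U2 s r) (incr X r t)‖
      ≤ ‖incr X r t‖ * ‖birem F X U U1 U2 s r‖ := norm_sharp_le _ _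
    _ ≤ (x * (t - r) ^ γ) * (v * (r - s) ^ (2 * γ)) :=
      have hX := h.path r t (hs.trans hsr) hrt ht
      mul_le_mul hX (h.remainder s r hs hsr (hrt.trans ht)) (norm_nonneg _)
        ((norm_nonneg _).trans hX)
    _ = x * v * ((t - r) ^ γ * (r - s) ^ (2 * γ)) := by ring

theorem norm_sharp_emb_le (hs : l₁ ≤ s) (hst : s ≤ t) (ht : t ≤ l₂) :
    ‖sharp (emb F U s) (incr X s t)‖ ≤ x * u * (t - s) ^ γ := by
  have hX := h.path s t hs hst ht
  calc ‖sharp (emb F U s) (incr X s t)‖ ≤ ‖incr X s t‖ * ‖emb F U s‖ := norm_sharp_le _ _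
    _ ≤ (x * (t - s) ^ γ) * u :=
        mul_le_mul hX (h.biprocess s ⟨hs, hst.trans ht⟩) (norm_nonneg _) ((norm_nonneg _).trans hX)
    _ = x * u * (t - s) ^ γ := by ring

theorem norm_incr_emb_le (hs : l₁ ≤ s) (hst : s ≤ t) (ht : t ≤ l₂) :
    ‖incr (emb F U) s t‖ ≤ ((l₂ - l₁) ^ γ * v + x * m) * (t - s) ^ γ := by
  have hX := h.path s t hs hst ht
  calc ‖incr (emb F U) s t‖
      = ‖birem F X U U1 U2 s t +
          (sharpL (incr X s t) (emb F U1 s) + sharpR (emb F U2 s) (incr X s t))‖ := by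
        rw [birem]
        congr 1
        abel
    _ ≤ ‖birem F X U U1 U2 s t‖ +
          (‖incr X s t‖ * ‖emb F U1 s‖ + ‖incr X s t‖ * ‖emb F U2 s‖) :=
        norm_add_le_of_le le_rfl (norm_add_le_of_le (norm_sharpL_le _ _) (norm_sharpR_le _ _))
    _ = ‖birem F X U U1 U2 s t‖ + ‖incr X s t‖ * (‖emb F U1 s‖ + ‖emb F U2 s‖) := by ring
    _ ≤ v * (t - s) ^ (2 * γ) + x * (t - s) ^ γ * m :=
        add_le_add (h.remainder s t hs hst ht) (mul_le_mul hX (h.derivs s ⟨hs, hst.trans ht⟩)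
          (by positivity) ((norm_nonneg _).trans hX))
    _ ≤ v * ((l₂ - l₁) ^ γ * (t - s) ^ γ) + x * (t - s) ^ γ * m := by
        gcongr
        exact rpow_two_mul_le h.γ_pos.le (sub_nonneg.2 hst) (by linarith)
    _ = ((l₂ - l₁) ^ γ * v + x * m) * (t - s) ^ γ := by ring

end HolderBounds

variable [CStarRing A]

theorem IsRoughData.cobd_expansion (h : IsRoughData F γ T X XX U U1 U2)
    (hs : 0 ≤ s) (hsr : s ≤ r) (hrt : r ≤ t) (ht : t ≤ T) :
    cobd (expansion F X XX U U1 U2) s r t =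
      timesId (XX r t) (mapPT (inclLE (F.mono hsr)) 3 (U1 s) - U1 r) +
      idTimes (adjOp (XX r t)) (mapPT (inclLE (F.mono hsr)) 3 (U2 s) - U2 r) -
      sharp (birem F X U U1 U2 s r) (incr X r t) := by
  have hrT : r ∈ Set.Icc 0 T := ⟨hs.trans hsr, hrt.trans ht⟩
  have incr_sr := h.isSelfAdjoint_incr ⟨hs, hsr.trans hrT.2⟩ hrT
  have incr_rt := h.isSelfAdjoint_incr hrT ⟨hrT.1.trans hrt, ht⟩
  have chen_left := timesId_chen (F.mono hsr) (h.chen hs hsr hrt ht) (U1 s)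
  have chen_right :=
    idTimes_adjOp_chen (F.mono hsr) incr_sr incr_rt (h.chen hs hsr hrt ht) (U2 s)
  rw [sub_sub, sub_eq_iff_eq_add] at chen_left chen_right
  have incr_st : incr X s t = incr X s r + incr X r t := by simp [incr]
  have emb_r : emb F U r = birem F X U U1 U2 s r + emb F U s +
      sharpL (incr X s r) (emb F U1 s) + sharpR (emb F U2 s) (incr X s r) := by
    rw [birem, incr]
    abel
  simp only [cobd, expansion]
  rw [incr_st, chen_left, chen_right, emb_r]
  simp only [← sharpCLM_apply, map_add, map_sub, add_apply, emb]
  abel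

namespace HolderBounds

variable {l₁ l₂ : ℝ} {x ξ u m w v : ℝ≥0} (h : HolderBounds F γ T X XX U U1 U2 l₁ l₂ x ξ u m w v)
include h

theorem norm_cobd_add_le (hs : l₁ ≤ s) (hsr : s ≤ r) (hrt : r ≤ t) (ht : t ≤ l₂) :
    ‖cobd (expansion F X XX U U1 U2) s r t + sharp (birem F X U U1 U2 s r) (incr X r t)‖ ≤
      ξ * w * ((t - r) ^ (2 * γ) * (r - s) ^ γ) := by
  rw [h.cobd_expansion (h.zero_le.trans hs) hsr hrt (ht.trans h.le_T), sub_add_cancel]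
  have h_area := h.norm_area r t (hs.trans hsr) hrt ht
  calc ‖timesId (XX r t) (mapPT (inclLE (F.mono hsr)) 3 (U1 s) - U1 r) +
        idTimes (adjOp (XX r t)) (mapPT (inclLE (F.mono hsr)) 3 (U2 s) - U2 r)‖
      ≤ ‖XX r t‖ * ‖incr (emb F U1) s r‖ + ‖XX r t‖ * ‖incr (emb F U2) s r‖ := by
        rw [← h.norm_inclLE_sub U1 hsr, ← h.norm_inclLE_sub U2 hsr]
        exact norm_add_le_of_le (norm_timesId_le _ _) (norm_idTimes_adjOp_le _ _)
    _ = ‖XX r t‖ * (‖incr (emb F U1) s r‖ + ‖incr (emb F U2) s r‖) := (mul_add _ _ _).symm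
    _ ≤ (ξ * (t - r) ^ (2 * γ)) * (w * (r - s) ^ γ) :=
        mul_le_mul h_area (h.incr_derivs s r hs hsr (hrt.trans ht)) (by positivity)
          ((norm_nonneg _).trans h_area)
    _ = ξ * w * ((t - r) ^ (2 * γ) * (r - s) ^ γ) := by ring

theorem norm_cobd_le (hs : l₁ ≤ s) (hsr : s ≤ r) (hrt : r ≤ t) (ht : t ≤ l₂) :
    ‖cobd (expansion F X XX U U1 U2) s r t‖ ≤ ξ * w * ((t - r) ^ (2 * γ) * (r - s) ^ γ) +
      x * v * ((t - r) ^ γ * (r - s) ^ (2 * γ)) :=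
  (norm_le_add_norm_add _ (sharp (birem F X U U1 U2 s r) (incr X r t))).trans
    (add_le_add (h.norm_cobd_add_le hs hsr hrt ht) (h.norm_sharp_birem_le hs hsr hrt ht))

theorem norm_cobd_le_rpow (hs : l₁ ≤ s) (hsr : s ≤ r) (hrt : r ≤ t) (ht : t ≤ l₂) :
    ‖cobd (expansion F X XX U U1 U2) s r t‖ ≤ (ξ * w + x * v : ℝ≥0) * (t - s) ^ (3 * γ) := by
  have hγ := h.γ_pos
  have hr : 0 ≤ t - r := sub_nonneg.2 hrt
  have hts : (t - s) ^ (3 * γ) = (t - s) ^ (2 * γ) * (t - s) ^ γ := by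
    rw [← Real.rpow_add_of_nonneg (by linarith) (by linarith) hγ.le]
    ring_nf
  calc ‖cobd (expansion F X XX U U1 U2) s r t‖
      ≤ ξ * w * ((t - r) ^ (2 * γ) * (r - s) ^ γ) + x * v * ((t - r) ^ γ * (r - s) ^ (2 * γ)) :=
        h.norm_cobd_le hs hsr hrt ht
    _ ≤ ξ * w * ((t - s) ^ (2 * γ) * (t - s) ^ γ) + x * v * ((t - s) ^ γ * (t - s) ^ (2 * γ)) := by
        have := Real.rpow_nonneg (hr.trans (sub_le_sub_left hsr t)) γ
        have := Real.rpow_nonneg (hr.trans (sub_le_sub_left hsr t)) (2 * γ)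
        gcongr
    _ = (ξ * w + x * v : ℝ≥0) * (t - s) ^ (3 * γ) := by
        rw [hts]
        push_cast
        ring

theorem norm_cobd_le_mul (hs : l₁ ≤ s) (hsr : s ≤ r) (hrt : r ≤ t) (ht : t ≤ l₂) :
    ‖cobd (expansion F X XX U U1 U2) s r t‖ ≤
      (ξ * w + x * v) * T ^ γ * ((t - r) ^ γ * (r - s) ^ γ) := by
  have hγ := h.γ_pos.le
  have hr : 0 ≤ t - r := sub_nonneg.2 hrt
  have hs' : 0 ≤ r - s := sub_nonneg.2 hsr
  have hr_le := rpow_two_mul_le hγ hr (L := T) (by linarith [h.zero_le, h.le_T])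
  have hs_le := rpow_two_mul_le hγ hs' (L := T) (by linarith [h.zero_le, h.le_T])
  calc ‖cobd (expansion F X XX U U1 U2) s r t‖
      ≤ ξ * w * ((t - r) ^ (2 * γ) * (r - s) ^ γ) + x * v * ((t - r) ^ γ * (r - s) ^ (2 * γ)) :=
        h.norm_cobd_le hs hsr hrt ht
    _ ≤ ξ * w * (T ^ γ * (t - r) ^ γ * (r - s) ^ γ) +
          x * v * ((t - r) ^ γ * (T ^ γ * (r - s) ^ γ)) := by gcongr
    _ = (ξ * w + x * v) * T ^ γ * ((t - r) ^ γ * (r - s) ^ γ) := by ring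

theorem norm_expansion_sub_le (hs : l₁ ≤ s) (hst : s ≤ t) (ht : t ≤ l₂) :
    ‖expansion F X XX U U1 U2 s t - sharp (emb F U s) (incr X s t)‖ ≤
      ξ * m * (t - s) ^ (2 * γ) := by
  have h_area := h.norm_area s t hs hst ht
  rw [expansion, add_assoc, add_sub_cancel_left]
  calc ‖timesId (XX s t) (U1 s) + idTimes (adjOp (XX s t)) (U2 s)‖
      ≤ ‖XX s t‖ * ‖U1 s‖ + ‖XX s t‖ * ‖U2 s‖ :=
        norm_add_le_of_le (norm_timesId_le _ _) (norm_idTimes_adjOp_le _ _)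
    _ = ‖XX s t‖ * (‖emb F U1 s‖ + ‖emb F U2 s‖) := by
        rw [emb, emb, h.norm_mapPT_incl, h.norm_mapPT_incl, mul_add]
    _ ≤ (ξ * (t - s) ^ (2 * γ)) * m :=
        mul_le_mul h_area (h.derivs s ⟨hs, hst.trans ht⟩) (by positivity)
          ((norm_nonneg _).trans h_area)
    _ = ξ * m * (t - s) ^ (2 * γ) := by ring

theorem norm_expansion_le (hs : l₁ ≤ s) (hst : s ≤ t) (ht : t ≤ l₂) :
    ‖expansion F X XX U U1 U2 s t‖ ≤ (ξ * m * T ^ γ + x * u) * (t - s) ^ γ :=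
  calc ‖expansion F X XX U U1 U2 s t‖
      ≤ ‖expansion F X XX U U1 U2 s t - sharp (emb F U s) (incr X s t)‖ +
          ‖sharp (emb F U s) (incr X s t)‖ := norm_le_norm_sub_add _ _
    _ ≤ ξ * m * (T ^ γ * (t - s) ^ γ) + x * u * (t - s) ^ γ := by
        refine add_le_add ((h.norm_expansion_sub_le hs hst ht).trans ?_)
          (h.norm_sharp_emb_le hs hst ht)
        gcongr
        exact rpow_two_mul_le h.γ_pos.le (sub_nonneg.2 hst) (by linarith [h.zero_le, h.le_T])
    _ = (ξ * m * T ^ γ + x * u) * (t - s) ^ γ := by ring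

end HolderBounds

end RoughData

section Simplices

variable {V : Type*} [NormedAddCommGroup V] {α β c : ℝ} {I : Set ℝ} {f : ℝ → V} {h : ℝ → ℝ → V}

/-- The set of the triples `s ≤ r ≤ t` in `I`, the domain of the elements of `C_3(I; V)`. -/
def simplex₃ (I : Set ℝ) : Set (ℝ × ℝ × ℝ) :=
  {p | p.1 ∈ I ∧ p.2.1 ∈ I ∧ p.2.2 ∈ I ∧ p.1 ≤ p.2.1 ∧ p.2.1 ≤ p.2.2}

theorem continuousOn_incr (hf : ContinuousOn f I) :
    ContinuousOn (fun p : ℝ × ℝ ↦ incr f p.1 p.2) (simplex I) :=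
  (hf.comp continuousOn_snd fun _ hp ↦ hp.2.1).sub (hf.comp continuousOn_fst fun _ hp ↦ hp.1)

theorem continuousOn_simplex₃_left
    (hh : ContinuousOn (fun p : ℝ × ℝ ↦ h p.1 p.2) (simplex I)) :
    ContinuousOn (fun p : ℝ × ℝ × ℝ ↦ h p.1 p.2.1) (simplex₃ I) :=
  hh.comp (f := fun p : ℝ × ℝ × ℝ ↦ (p.1, p.2.1)) (by fun_prop)
    fun _ ⟨hs, hr, _, hsr, _⟩ ↦ ⟨hs, hr, hsr⟩

theorem continuousOn_simplex₃_right
    (hh : ContinuousOn (fun p : ℝ × ℝ ↦ h p.1 p.2) (simplex I)) :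
    ContinuousOn (fun p : ℝ × ℝ × ℝ ↦ h p.2.1 p.2.2) (simplex₃ I) :=
  hh.comp (f := fun p : ℝ × ℝ × ℝ ↦ (p.2.1, p.2.2)) (by fun_prop)
    fun _ ⟨_, hr, ht, _, hrt⟩ ↦ ⟨hr, ht, hrt⟩

theorem continuousOn_cobd (hh : ContinuousOn (fun p : ℝ × ℝ ↦ h p.1 p.2) (simplex I)) :
    ContinuousOn (fun p : ℝ × ℝ × ℝ ↦ cobd h p.1 p.2.1 p.2.2) (simplex₃ I) :=
  ((hh.comp (s := simplex₃ I) (f := fun p : ℝ × ℝ × ℝ ↦ (p.1, p.2.2)) (by fun_prop)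
    fun _ ⟨hs, _, ht, hsr, hrt⟩ ↦ ⟨hs, ht, hsr.trans hrt⟩).sub
      (continuousOn_simplex₃_left hh)).sub (continuousOn_simplex₃_right hh)

theorem memC2_of_norm_le (hα : α ≠ 0)
    (hcont : ContinuousOn (fun p : ℝ × ℝ ↦ h p.1 p.2) (simplex I))
    (hh : ∀ s ∈ I, ∀ t ∈ I, s ≤ t → ‖h s t‖ ≤ c * (t - s) ^ α) : MemC2 α I h where
  cont := hcont
  diag t ht := by simpa [Real.zero_rpow hα] using hh t ht t ht le_rfl
  finite := holderSup_ne_top (c := c.toNNReal) fun s hs t ht hst ↦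
    (hh s hs t ht hst.le).trans (mul_le_mul_of_nonneg_right (Real.le_coe_toNNReal c)
      (Real.rpow_nonneg (sub_nonneg.2 hst.le) α))

theorem memC3'_of_norm_le {h : ℝ → ℝ → ℝ → V} (hα : α ≠ 0) (hβ : β ≠ 0)
    (hcont : ContinuousOn (fun p : ℝ × ℝ × ℝ ↦ h p.1 p.2.1 p.2.2) (simplex₃ I))
    (hh : ∀ s ∈ I, ∀ r ∈ I, ∀ t ∈ I, s ≤ r → r ≤ t →
      ‖h s r t‖ ≤ c * ((t - r) ^ α * (r - s) ^ β)) : MemC3' α β I h where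
  cont := hcont
  diag_left s hs t ht hst := by simpa [Real.zero_rpow hβ] using hh s hs s hs t ht le_rfl hst
  diag_right s hs t ht hst := by simpa [Real.zero_rpow hα] using hh s hs t ht t ht hst le_rfl
  finite := N3_ne_top (c := c.toNNReal) fun s hs r hr t ht hsr hrt ↦
    (hh s hs r hr t ht hsr.le hrt.le).trans (mul_le_mul_of_nonneg_right (Real.le_coe_toNNReal c)
      (mul_nonneg (Real.rpow_nonneg (sub_nonneg.2 hrt.le) α)
        (Real.rpow_nonneg (sub_nonneg.2 hsr.le) β)))

end Simplices

section RoughIntegral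

variable {A : Type*} [NormedRing A] [NormedAlgebra ℂ A] [StarRing A] [StarModule ℂ A]
  [CompleteSpace A]
  {F : Filtr A} {γ T : ℝ} {X : ℝ → A} {XX : ∀ s : ℝ, ℝ → (PT (F.alg s) 2 →L[ℂ] A)}
  {U : ∀ t, PT (F.alg t) 2} {U1 U2 : ∀ t, PT (F.alg t) 3} {s t : ℝ}

theorem IsRoughData.continuousOn_sharp_incr (h : IsRoughData F γ T X XX U U1 U2) :
    ContinuousOn (fun p : ℝ × ℝ ↦ sharp (emb F U p.1) (incr X p.1 p.2))
      (simplex (Set.Icc 0 T)) := by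
  simp only [← sharpCLM_apply]
  exact ((sharpCLM A).continuous.comp_continuousOn (continuousOn_incr h.holder.cont)).clm_apply
    (h.bicontrolled.holder.cont.comp continuousOn_fst fun _ hp ↦ hp.1)

theorem IsRoughData.continuousOn_sharp_birem (h : IsRoughData F γ T X XX U U1 U2) : ContinuousOn
    (fun p : ℝ × ℝ × ℝ ↦ sharp (birem F X U U1 U2 p.1 p.2.1) (incr X p.2.1 p.2.2))
    (simplex₃ (Set.Icc 0 T)) := by
  simp only [← sharpCLM_apply]
  exact ((sharpCLM A).continuous.comp_continuousOn
    (continuousOn_simplex₃_right (continuousOn_incr h.holder.cont))).clm_apply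
      (continuousOn_simplex₃_left h.bicontrolled.rem_mem.cont)

variable [CStarRing A]

namespace IsRoughData

variable (h : IsRoughData F γ T X XX U U1 U2)
include h

theorem continuousOn_expansion :
    ContinuousOn (fun p : ℝ × ℝ ↦ expansion F X XX U U1 U2 p.1 p.2) (simplex (Set.Icc 0 T)) := by
  have hb := h.holderBounds le_rfl le_rfl
  have hγ := h.γ_pos
  have hT := Real.rpow_nonneg h.pos.le γ
  obtain ⟨b, hb₀, hM⟩ : ∃ b : ℝ, 0 ≤ b ∧ ∀ s t, 0 ≤ s → s ≤ t → t ≤ T →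
      ‖expansion F X XX U U1 U2 s t‖ ≤ b * (t - s) ^ γ :=
    ⟨_, by positivity, fun _ _ ↦ hb.norm_expansion_le⟩
  obtain ⟨c, hc₀, hδM⟩ : ∃ c : ℝ, 0 ≤ c ∧ ∀ s r t, 0 ≤ s → s ≤ r → r ≤ t → t ≤ T →
      ‖cobd (expansion F X XX U U1 U2) s r t‖ ≤ c * ((t - r) ^ γ * (r - s) ^ γ) :=
    ⟨_, by positivity, fun _ _ _ ↦ hb.norm_cobd_le_mul⟩
  lift b to ℝ≥0 using hb₀
  lift c to ℝ≥0 using hc₀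
  have coe_const : ((b + c * (T ^ γ).toNNReal : ℝ≥0) : ℝ) = b + c * T ^ γ := by
    simp [Real.coe_toNNReal _ hT]
  refine continuousOn_simplex_of_cobd_le (c := b + c * (T ^ γ).toNNReal) hγ
    (fun s t hs hst ht ↦ (hM s t hs hst ht).trans ?_)
    (fun s r t hs hsr hrt ht ↦ (hδM s r t hs hsr hrt ht).trans ?_)
    (fun s r t hs hsr hrt ht ↦ (hδM s r t hs hsr hrt ht).trans ?_) <;> rw [coe_const]
  · have := Real.rpow_nonneg (sub_nonneg.2 hst) γ
    gcongr
    exact le_add_of_nonneg_right (by positivity)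
  · have := Real.rpow_nonneg (sub_nonneg.2 hsr) γ
    calc (c : ℝ) * ((t - r) ^ γ * (r - s) ^ γ) ≤ c * (T ^ γ * (r - s) ^ γ) := by
          gcongr
          linarith
      _ ≤ (b + c * T ^ γ) * (r - s) ^ γ := by
          rw [← mul_assoc]
          gcongr
          exact le_add_of_nonneg_left b.2
  · have := Real.rpow_nonneg (sub_nonneg.2 hrt) γ
    calc (c : ℝ) * ((t - r) ^ γ * (r - s) ^ γ) ≤ c * ((t - r) ^ γ * T ^ γ) := by
          gcongr
          linarith
      _ ≤ (b + c * T ^ γ) * (t - r) ^ γ := by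
          rw [mul_comm _ (T ^ γ), ← mul_assoc]
          gcongr
          exact le_add_of_nonneg_left b.2

theorem exists_isSewing : ∃ N, IsSewing (3 * γ) T (cobd (expansion F X XX U U1 U2)) N :=
  ProductArea.exists_isSewing h.one_lt h.continuousOn_expansion fun _ _ _ ↦
    (h.holderBounds le_rfl le_rfl).norm_cobd_le_rpow

theorem isSewing_sewing : IsSewing (3 * γ) T (cobd (expansion F X XX U U1 U2))
    (sewing (3 * γ) T (cobd (expansion F X XX U U1 U2))) :=
  ProductArea.isSewing_sewing h.exists_isSewing

theorem additiveOn_roughInt : AdditiveOn 0 T (roughInt F γ T X XX U U1 U2) :=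
  additiveOn_sub_of_cobd_eq fun s r t hs hsr hrt ht ↦
    (h.isSewing_sewing.2 s r t hs hsr hrt ht).symm

theorem continuousOn_roughInt :
    ContinuousOn (fun p : ℝ × ℝ ↦ roughInt F γ T X XX U U1 U2 p.1 p.2) (simplex (Set.Icc 0 T)) :=
  h.continuousOn_expansion.sub h.isSewing_sewing.1.cont

theorem memC3_cobd_expansion :
    MemC3 (3 * γ) (Set.Icc 0 T) (cobd (expansion F X XX U U1 U2)) := by
  have hb := h.holderBounds le_rfl le_rfl
  have hγ := h.γ_pos
  have mem_remainder : MemC3' γ (3 * γ - γ) (Set.Icc 0 T)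
      fun s r t ↦ -sharp (birem F X U U1 U2 s r) (incr X r t) := by
    rw [show 3 * γ - γ = 2 * γ by ring]
    exact memC3'_of_norm_le hγ.ne' (by positivity) h.continuousOn_sharp_birem.neg
      fun s hs r _ t ht hsr hrt ↦
        (norm_neg _).trans_le (hb.norm_sharp_birem_le hs.1 hsr hrt ht.2)
  have mem_area : MemC3' (2 * γ) (3 * γ - 2 * γ) (Set.Icc 0 T) fun s r t ↦
      cobd (expansion F X XX U U1 U2) s r t + sharp (birem F X U U1 U2 s r) (incr X r t) := by
    rw [show 3 * γ - 2 * γ = γ by ring]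
    exact memC3'_of_norm_le (by positivity) hγ.ne'
      ((continuousOn_cobd h.continuousOn_expansion).add h.continuousOn_sharp_birem)
      fun s hs r _ t ht hsr hrt ↦ hb.norm_cobd_add_le hs.1 hsr hrt ht.2
  refine ⟨2, ![γ, 2 * γ], ![_, _], Fin.forall_fin_two.2
    ⟨⟨hγ.le, ?_, mem_remainder⟩, ?_, ?_, mem_area⟩, fun s _ r _ t _ _ _ ↦ ?_⟩
  · exact le_mul_of_one_le_left hγ.le (by norm_num)
  · exact mul_nonneg two_pos.le hγ.le
  · exact mul_le_mul_of_nonneg_right (by norm_num) hγ.le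
  · simp [Fin.sum_univ_two]

theorem isSelfAdjoint_deriv {X' : ℝ → A}
    (hX' : ∀ t ∈ Set.Icc 0 T, HasDerivWithinAt X (X' t) (Set.Icc 0 T) t)
    (ht : t ∈ Set.Icc 0 T) : IsSelfAdjoint (X' t) := by
  have deriv_star : HasDerivWithinAt X (star (X' t)) (Set.Icc 0 T) t :=
    (hX' t ht).star.congr (fun r hr ↦ (h.selfAdjoint r hr).star_eq.symm)
      (h.selfAdjoint t ht).star_eq.symm
  exact (uniqueDiffOn_Icc h.pos t ht).eq_deriv _ deriv_star (hX' t ht)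

end IsRoughData

namespace HolderBounds

variable {l₁ l₂ : ℝ} {x ξ u m w v : ℝ≥0} (h : HolderBounds F γ T X XX U U1 U2 l₁ l₂ x ξ u m w v)
include h

theorem norm_roughInt_sub_expansion_le (hs : l₁ ≤ s) (hst : s ≤ t) (ht : t ≤ l₂) :
    ‖roughInt F γ T X XX U U1 U2 s t - expansion F X XX U U1 U2 s t‖ ≤
      sewC (3 * γ) * (ξ * w + x * v) * (t - s) ^ (3 * γ) := by
  rw [roughInt, sub_sub_cancel_left, norm_neg]
  exact_mod_cast norm_le_of_cobd_le h.one_lt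
    (fun s t hs hst ht ↦ h.isSewing_sewing.norm_le_toNNReal h.one_lt (h.zero_le.trans hs) hst
      (ht.trans h.le_T))
    (fun s r t hs hsr hrt ht ↦ by
      rw [h.isSewing_sewing.2 s r t (h.zero_le.trans hs) hsr hrt (ht.trans h.le_T)]
      exact h.norm_cobd_le_rpow hs hsr hrt ht)
    hs hst ht

theorem norm_roughInt_sub_sharp_le (hs : l₁ ≤ s) (hst : s ≤ t) (ht : t ≤ l₂) :
    ‖roughInt F γ T X XX U U1 U2 s t - sharp (emb F U s) (incr X s t)‖ ≤
      (sewC (3 * γ) * (ξ * w + x * v) * (l₂ - l₁) ^ γ + ξ * m) * (t - s) ^ (2 * γ) := by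
  have hγ := h.γ_pos.le
  have hts : 0 ≤ t - s := sub_nonneg.2 hst
  have rpow_le : (t - s) ^ (3 * γ) ≤ (l₂ - l₁) ^ γ * (t - s) ^ (2 * γ) := by
    rw [show 3 * γ = γ + 2 * γ by ring, Real.rpow_add_of_nonneg hts hγ (by positivity)]
    gcongr
  calc ‖roughInt F γ T X XX U U1 U2 s t - sharp (emb F U s) (incr X s t)‖
      ≤ sewC (3 * γ) * (ξ * w + x * v) * (t - s) ^ (3 * γ) + ξ * m * (t - s) ^ (2 * γ) :=
        norm_sub_le_norm_sub_add_norm_sub .. |>.trans <| add_le_add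
          (h.norm_roughInt_sub_expansion_le hs hst ht) (h.norm_expansion_sub_le hs hst ht)
    _ ≤ sewC (3 * γ) * (ξ * w + x * v) * ((l₂ - l₁) ^ γ * (t - s) ^ (2 * γ)) +
          ξ * m * (t - s) ^ (2 * γ) := by gcongr
    _ = (sewC (3 * γ) * (ξ * w + x * v) * (l₂ - l₁) ^ γ + ξ * m) * (t - s) ^ (2 * γ) := by ring

theorem norm_roughInt_le (hs : l₁ ≤ s) (hst : s ≤ t) (ht : t ≤ l₂) :
    ‖roughInt F γ T X XX U U1 U2 s t‖ ≤
      ((sewC (3 * γ) * (ξ * w + x * v) * (l₂ - l₁) ^ γ + ξ * m) * T ^ γ + x * u) *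
        (t - s) ^ γ := by
  have := Real.rpow_nonneg (sub_nonneg.2 ((hs.trans hst).trans ht)) γ
  calc ‖roughInt F γ T X XX U U1 U2 s t‖
      ≤ (sewC (3 * γ) * (ξ * w + x * v) * (l₂ - l₁) ^ γ + ξ * m) * (t - s) ^ (2 * γ) +
          x * u * (t - s) ^ γ :=
        (norm_le_norm_sub_add _ _).trans <| add_le_add
          (h.norm_roughInt_sub_sharp_le hs hst ht) (h.norm_sharp_emb_le hs hst ht)
    _ ≤ (sewC (3 * γ) * (ξ * w + x * v) * (l₂ - l₁) ^ γ + ξ * m) * (T ^ γ * (t - s) ^ γ) +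
          x * u * (t - s) ^ γ := by
        gcongr
        exact rpow_two_mul_le h.γ_pos.le (sub_nonneg.2 hst) (by linarith [h.zero_le, h.le_T])
    _ = ((sewC (3 * γ) * (ξ * w + x * v) * (l₂ - l₁) ^ γ + ξ * m) * T ^ γ + x * u) *
          (t - s) ^ γ := by ring

end HolderBounds

theorem IsRoughData.memC2_roughInt (h : IsRoughData F γ T X XX U U1 U2) :
    MemC2 γ (Set.Icc 0 T) (roughInt F γ T X XX U U1 U2) :=
  memC2_of_norm_le h.γ_pos.ne' h.continuousOn_roughInt fun _ hs _ ht hst ↦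
    (h.holderBounds le_rfl le_rfl).norm_roughInt_le hs.1 hst ht.2

end RoughIntegral

/-! ### The differentiable case -/

section SmoothCase

open Filter Topology MeasureTheory

theorem intervalIntegrable_bilin {E₁ E₂ E₃ : Type*} [NormedAddCommGroup E₁] [NormedSpace ℂ E₁]
    [NormedAddCommGroup E₂] [NormedSpace ℂ E₂] [NormedAddCommGroup E₃] [NormedSpace ℂ E₃]
    (L : E₁ →L[ℂ] E₂ →L[ℂ] E₃) {f : ℝ → E₁} {g : ℝ → E₂} {s t : ℝ} (hst : s ≤ t)
    (hf : ContinuousOn f (Set.Icc s t)) (hg : IntervalIntegrable g volume s t) :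
    IntervalIntegrable (fun r ↦ L (f r) (g r)) volume s t := by
  rw [intervalIntegrable_iff_integrableOn_Icc_of_le hst] at hg ⊢
  obtain ⟨c, hc⟩ := isCompact_Icc.exists_bound_of_continuousOn hf
  exact L.integrable_of_bilin_of_bdd_left c (hf.aestronglyMeasurable measurableSet_Icc)
    ((ae_restrict_iff' measurableSet_Icc).2 (Eventually.of_forall hc)) hg

theorem intervalIntegrable_mono {V : Type*} [NormedAddCommGroup V] {f : ℝ → V} {T s t : ℝ}
    (hf : IntervalIntegrable f volume 0 T) (hs : 0 ≤ s) (hst : s ≤ t) (ht : t ≤ T) :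
    IntervalIntegrable f volume s t :=
  hf.mono_set <| by
    rw [Set.uIcc_of_le hst, Set.uIcc_of_le (hs.trans (hst.trans ht))]
    exact Set.Icc_subset_Icc hs ht

theorem additiveOn_integral {V : Type*} [NormedAddCommGroup V] [NormedSpace ℝ V] {f : ℝ → V}
    {T : ℝ} (hf : IntervalIntegrable f volume 0 T) : AdditiveOn 0 T fun s t ↦ ∫ r in s..t, f r :=
  fun _ _ _ hs hsr hrt ht ↦ (intervalIntegral.integral_add_adjacent_intervals
    (intervalIntegrable_mono hf hs hsr (hrt.trans ht))
    (intervalIntegrable_mono hf (hs.trans hsr) hrt ht)).symm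

theorem integral_deriv_eq_incr {V : Type*} [NormedAddCommGroup V] [NormedSpace ℝ V]
    [CompleteSpace V] {X X' : ℝ → V} {T s t : ℝ}
    (hX' : ∀ t ∈ Set.Icc 0 T, HasDerivWithinAt X (X' t) (Set.Icc 0 T) t)
    (hint : IntervalIntegrable X' volume 0 T) (hs : 0 ≤ s) (hst : s ≤ t) (ht : t ≤ T) :
    ∫ r in s..t, X' r = incr X s t := by
  have hsub : Set.Icc s t ⊆ Set.Icc 0 T := Set.Icc_subset_Icc hs ht
  refine intervalIntegral.integral_eq_sub_of_hasDerivAt_of_le hst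
    (fun r hr ↦ (hX' r (hsub hr)).continuousWithinAt.mono hsub) (fun r hr ↦ ?_)
    (intervalIntegrable_mono hint hs hst ht)
  exact (hX' r (hsub (Set.Ioo_subset_Icc_self hr))).hasDerivAt
    (Icc_mem_nhds (hs.trans_lt hr.1) (hr.2.trans_le ht))

variable {A : Type*} [NormedRing A] [NormedAlgebra ℂ A] [CompleteSpace A]

section Operators

variable [StarRing A] [StarModule ℂ A] {S : StarSubalgebra ℂ A} {L : PT S 2 →L[ℂ] A}
  {x y : ℝ → A} {s t : ℝ}

theorem eq_integral_sharp (hst : s ≤ t) (hx : ContinuousOn x (Set.Icc s t))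
    (hy : IntervalIntegrable y volume s t) (Φ : A →L[ℂ] PT A 3 →L[ℂ] PT A 2) (Ψ : PT S 3 →L[ℂ] A)
    (h : ∀ v, Ψ (tens S 3 v) =
      ∫ r in s..t, sharp (Φ (x r) (mapPT (incl S) 3 (tens S 3 v))) (y r)) (w : PT S 3) :
    Ψ w = ∫ r in s..t, sharp (Φ (x r) (mapPT (incl S) 3 w)) (y r) := by
  let integrand (r : ℝ) : PT S 3 →L[ℂ] A :=
    (sharpCLM A (y r)).comp ((Φ (x r)).comp (mapPT (incl S) 3))
  have hy' : IntervalIntegrable (fun r ↦ sharpCLM A (y r)) volume s t :=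
    ⟨(sharpCLM A).integrable_comp hy.1, (sharpCLM A).integrable_comp hy.2⟩
  have hint : IntervalIntegrable integrand volume s t :=
    intervalIntegrable_bilin (ContinuousLinearMap.compL ℂ (PT S 3) (PT A 2) A).flip hst
      ((Φ.continuous.comp_continuousOn hx).clm_comp continuousOn_const) hy'
  have integral_apply (w : PT S 3) : (∫ r in s..t, integrand r) w =
      ∫ r in s..t, sharp (Φ (x r) (mapPT (incl S) 3 w)) (y r) :=
    ContinuousLinearMap.intervalIntegral_apply hint w
  have eq_integral : Ψ = ∫ r in s..t, integrand r :=
    PT.hom_ext fun v ↦ (h v).trans (integral_apply _).symm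
  rw [← integral_apply, ← eq_integral]

theorem timesId_eq_integral (hst : s ≤ t) (hx : ContinuousOn x (Set.Icc s t))
    (hy : IntervalIntegrable y volume s t)
    (hL : ∀ W, L W = ∫ r in s..t, sharp (mapPT (incl S) 2 W) (x r) * y r) (w : PT S 3) :
    timesId L w = ∫ r in s..t, sharp (sharpL (x r) (mapPT (incl S) 3 w)) (y r) := by
  refine eq_integral_sharp hst hx hy (sharpLCLM A) (timesId L) (fun v ↦ ?_) w
  have hint : IntervalIntegrable (fun r ↦ (v 0 : A) * x r * v 1 * y r) volume s t :=
    intervalIntegrable_bilin (ContinuousLinearMap.mul ℂ A) hst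
      ((continuousOn_const.mul hx).mul continuousOn_const) hy
  rw [timesId_tens, hL, mapPT_tens₂]
  simp only [mapPT_tens, sharpLCLM_apply, sharpL_tens, sharp_tens₂, incl_apply]
  exact (((ContinuousLinearMap.mul ℂ A).flip (v 2 : A)).intervalIntegral_comp_comm hint).symm

theorem idTimes_adjOp_eq_integral [CStarRing A] (hst : s ≤ t) (hx : ContinuousOn x (Set.Icc s t))
    (hy : IntervalIntegrable y volume s t) (hxs : ∀ r ∈ Set.Icc s t, IsSelfAdjoint (x r))
    (hys : ∀ r ∈ Set.Icc s t, IsSelfAdjoint (y r))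
    (hL : ∀ W, L W = ∫ r in s..t, sharp (mapPT (incl S) 2 W) (x r) * y r) (w : PT S 3) :
    idTimes (adjOp L) w = ∫ r in s..t, sharp (sharpR (mapPT (incl S) 3 w) (x r)) (y r) := by
  refine eq_integral_sharp hst hx hy (sharpRCLM A) (idTimes (adjOp L)) (fun v ↦ ?_) w
  let integrand (r : ℝ) : A := star (v 2 : A) * x r * star (v 1 : A) * y r
  have hint : IntervalIntegrable integrand volume s t :=
    intervalIntegrable_bilin (ContinuousLinearMap.mul ℂ A) hst
      ((continuousOn_const.mul hx).mul continuousOn_const) hy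
  let starL : A →L[ℝ] A := (starL' ℝ : A ≃L[ℝ] A)
  have hint_star : IntervalIntegrable (fun r ↦ star (integrand r)) volume s t :=
    ⟨starL.integrable_comp hint.1, starL.integrable_comp hint.2⟩
  have star_integrand {r : ℝ} (hr : r ∈ Set.Icc s t) :
      star (integrand r) = y r * v 1 * x r * v 2 := by
    simp only [integrand, star_mul, star_star, (hxs r hr).star_eq, (hys r hr).star_eq, mul_assoc]
  calc idTimes (adjOp L) (tens S 3 v)
      = v 0 * star (∫ r in s..t, integrand r) := by
        rw [idTimes_tens, adjOp_tens₂, hL, mapPT_tens₂]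
        simp only [sharp_tens₂, incl_apply, StarMemClass.coe_star, integrand]
    _ = v 0 * ∫ r in s..t, star (integrand r) :=
        congrArg _ (starL.intervalIntegral_comp_comm hint).symm
    _ = ∫ r in s..t, v 0 * star (integrand r) :=
        ((ContinuousLinearMap.mul ℂ A (v 0)).intervalIntegral_comp_comm hint_star).symm
    _ = ∫ r in s..t, sharp (sharpRCLM A (x r) (mapPT (incl S) 3 (tens S 3 v))) (y r) := by
        refine intervalIntegral.integral_congr fun r hr ↦ ?_
        rw [Set.uIcc_of_le hst] at hr
        simp only [star_integrand hr, mapPT_tens, sharpRCLM_apply, sharpR_tens, sharp_tens₂,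
          incl_apply, mul_assoc]

end Operators

variable [StarRing A] [StarModule ℂ A]
  {F : Filtr A} {γ T : ℝ} {X X' : ℝ → A} {XX : ∀ s : ℝ, ℝ → (PT (F.alg s) 2 →L[ℂ] A)}
  {U : ∀ t, PT (F.alg t) 2} {U1 U2 : ∀ t, PT (F.alg t) 3} {s t : ℝ}

namespace IsRoughData

theorem intervalIntegrable_sharp (h : IsRoughData F γ T X XX U U1 U2)
    (hint : IntervalIntegrable X' volume 0 T) :
    IntervalIntegrable (fun r ↦ sharp (emb F U r) (X' r)) volume 0 T :=
  intervalIntegrable_bilin (sharpCLM A).flip h.pos.le h.bicontrolled.holder.cont hint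

theorem intervalIntegrable_sharp_sub_birem (h : IsRoughData F γ T X XX U U1 U2)
    (hint : IntervalIntegrable X' volume 0 T) (hs : 0 ≤ s) (hst : s ≤ t) (ht : t ≤ T) :
    IntervalIntegrable (fun r ↦ sharp (emb F U r - birem F X U U1 U2 s r) (X' r)) volume s t := by
  have hsub : Set.Icc s t ⊆ Set.Icc 0 T := Set.Icc_subset_Icc hs ht
  have hbirem : ContinuousOn (birem F X U U1 U2 s) (Set.Icc s t) :=
    h.bicontrolled.rem_mem.cont.comp (f := fun r ↦ (s, r)) (by fun_prop)
      fun r hr ↦ ⟨hsub (Set.left_mem_Icc.2 hst), hsub hr, hr.1⟩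
  exact intervalIntegrable_bilin (sharpCLM A).flip hst
    ((h.bicontrolled.holder.cont.mono hsub).sub hbirem) (intervalIntegrable_mono hint hs hst ht)

variable [CStarRing A] (h : IsRoughData F γ T X XX U U1 U2)
  (hX' : ∀ t ∈ Set.Icc 0 T, HasDerivWithinAt X (X' t) (Set.Icc 0 T) t)
  (hint : IntervalIntegrable X' volume 0 T)
  (hXX : ∀ s t, 0 ≤ s → s ≤ t → t ≤ T → ∀ W : PT (F.alg s) 2,
    XX s t W = ∫ r in s..t, sharp (mapPT (incl (F.alg s)) 2 W) (incr X s r) * X' r)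
include h hX' hint hXX

theorem expansion_eq_integral (hs : 0 ≤ s) (hst : s ≤ t) (ht : t ≤ T) :
    expansion F X XX U U1 U2 s t =
      ∫ r in s..t, sharp (emb F U r - birem F X U U1 U2 s r) (X' r) := by
  have hsub : Set.Icc s t ⊆ Set.Icc 0 T := Set.Icc_subset_Icc hs ht
  have hsT : s ∈ Set.Icc 0 T := hsub (Set.left_mem_Icc.2 hst)
  have hX : ContinuousOn (fun r ↦ incr X s r) (Set.Icc s t) :=
    (h.holder.cont.mono hsub).sub continuousOn_const
  have hX'_int := intervalIntegrable_mono hint hs hst ht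
  let sharpFlip := (sharpCLM A).flip
  have int_const := intervalIntegrable_bilin sharpFlip hst
    (f := fun _ ↦ emb F U s) continuousOn_const hX'_int
  have int_left := intervalIntegrable_bilin sharpFlip hst
    (f := fun r ↦ sharpLCLM A (incr X s r) (emb F U1 s))
    (((sharpLCLM A).continuous.comp_continuousOn hX).clm_apply continuousOn_const) hX'_int
  have int_right := intervalIntegrable_bilin sharpFlip hst
    (f := fun r ↦ sharpRCLM A (incr X s r) (emb F U2 s))
    (((sharpRCLM A).continuous.comp_continuousOn hX).clm_apply continuousOn_const) hX'_int
  have const_eq : sharp (emb F U s) (incr X s t) = ∫ r in s..t, sharpFlip (emb F U s) (X' r) := by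
    rw [ContinuousLinearMap.intervalIntegral_comp_comm _ hX'_int,
      integral_deriv_eq_incr hX' hint hs hst ht]
    rfl
  have left_eq : timesId (XX s t) (U1 s) =
      ∫ r in s..t, sharpFlip (sharpLCLM A (incr X s r) (emb F U1 s)) (X' r) :=
    timesId_eq_integral hst hX hX'_int (hXX s t hs hst ht) (U1 s)
  have right_eq : idTimes (adjOp (XX s t)) (U2 s) =
      ∫ r in s..t, sharpFlip (sharpRCLM A (incr X s r) (emb F U2 s)) (X' r) :=
    idTimes_adjOp_eq_integral hst hX hX'_int
      (fun r hr ↦ h.isSelfAdjoint_incr hsT (hsub hr))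
      (fun r hr ↦ h.isSelfAdjoint_deriv hX' (hsub hr)) (hXX s t hs hst ht) (U2 s)
  have integrand_eq (r : ℝ) : sharp (emb F U r - birem F X U U1 U2 s r) (X' r) =
      sharpFlip (emb F U s) (X' r) + sharpFlip (sharpLCLM A (incr X s r) (emb F U1 s)) (X' r) +
        sharpFlip (sharpRCLM A (incr X s r) (emb F U2 s)) (X' r) := by
    rw [← add_apply, ← add_apply, ← map_add, ← map_add]
    refine congrArg (sharp · (X' r)) ?_
    rw [birem, incr, sharpLCLM_apply, sharpRCLM_apply]
    abel
  simp only [integrand_eq]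
  rw [expansion, const_eq, left_eq, right_eq, ← intervalIntegral.integral_add int_const int_left,
    ← intervalIntegral.integral_add (int_const.add int_left) int_right]

theorem norm_integral_sub_expansion_le (hs : 0 ≤ s) (hst : s ≤ t) (ht : t ≤ T) :
    ‖(∫ r in s..t, sharp (emb F U r) (X' r)) - expansion F X XX U U1 U2 s t‖ ≤
      (N2 (2 * γ) (Set.Icc 0 T) (birem F X U U1 U2)).toNNReal * (t - s) ^ (2 * γ) *
        ∫ r in s..t, ‖X' r‖ := by
  have hγ := h.γ_pos
  rw [h.expansion_eq_integral hX' hint hXX hs hst ht, ← intervalIntegral.integral_sub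
    (intervalIntegrable_mono (h.intervalIntegrable_sharp hint) hs hst ht)
    (h.intervalIntegrable_sharp_sub_birem hint hs hst ht), ← intervalIntegral.integral_const_mul]
  refine intervalIntegral.norm_integral_le_of_norm_le hst (Eventually.of_forall fun r hr ↦ ?_)
    ((intervalIntegrable_mono hint hs hst ht).norm.const_mul _)
  obtain ⟨hsr, hrt⟩ := hr
  have integrand_eq : sharp (emb F U r) (X' r) - sharp (emb F U r - birem F X U U1 U2 s r) (X' r) =
      sharp (birem F X U U1 U2 s r) (X' r) := by
    rw [← sharpCLM_apply, ← sharpCLM_apply, ← map_sub, sub_sub_cancel, sharpCLM_apply]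
  rw [integrand_eq, mul_comm _ ‖X' r‖]
  refine (norm_sharp_le _ _).trans (mul_le_mul_of_nonneg_left ?_ (norm_nonneg _))
  calc ‖birem F X U U1 U2 s r‖
      ≤ (N2 (2 * γ) (Set.Icc 0 T) (birem F X U U1 U2)).toNNReal * (r - s) ^ (2 * γ) :=
        (h.holderBounds le_rfl le_rfl).remainder s r hs hsr.le (hrt.trans ht)
    _ ≤ (N2 (2 * γ) (Set.Icc 0 T) (birem F X U U1 U2)).toNNReal * (t - s) ^ (2 * γ) := by
        gcongr

theorem roughInt_eq_integral (hs : 0 ≤ s) (hst : s ≤ t) (ht : t ≤ T) :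
    roughInt F γ T X XX U U1 U2 s t = ∫ r in s..t, sharp (emb F U r) (X' r) := by
  have hint_sharp := h.intervalIntegrable_sharp hint
  have hγ : 0 < 2 * γ := mul_pos two_pos h.γ_pos
  have roughInt_limit := (h.additiveOn_roughInt.mono hs ht).tendsto_sum_of_rpow h.one_lt hst
    fun x y hx hxy hy ↦ (h.holderBounds le_rfl le_rfl).norm_roughInt_sub_expansion_le
      (hs.trans hx) hxy (hy.trans ht)
  have integral_limit := ((additiveOn_integral hint_sharp).mono hs ht).tendsto_sum
    ((additiveOn_integral hint.norm).mono hs ht) (tendsto_const_mul_rpow_nhdsGE_zero _ hγ) hst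
    fun x y hx hxy hy ↦ h.norm_integral_sub_expansion_le hX' hint hXX
      (hs.trans hx) hxy (hy.trans ht)
  exact tendsto_nhds_unique roughInt_limit integral_limit

end IsRoughData

end SmoothCase

/-! ### The primitive -/

section Seminorms

variable {A : Type*} [NormedRing A] [NormedAlgebra ℂ A] [StarRing A] [StarModule ℂ A]
  {F : Filtr A} {γ : ℝ} {X : ℝ → A} {U : ∀ t, PT (F.alg t) 2} {U1 U2 : ∀ t, PT (F.alg t) 3}

theorem coe_toNNReal_add_le_normBQ {I : Set ℝ} :
    ((N1 γ I (emb F U1)).toNNReal + (N1 γ I (emb F U2)).toNNReal +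
      (N2 (2 * γ) I (birem F X U U1 U2)).toNNReal : ℝ≥0) ≤ normBQ F γ I X U U1 U2 := by
  rw [normBQ, ENNReal.coe_add, ENNReal.coe_add]
  exact add_le_add ((add_le_add (ENNReal.coe_toNNReal_le_self.trans le_add_self)
    (ENNReal.coe_toNNReal_le_self.trans le_add_self)).trans le_add_self)
    ENNReal.coe_toNNReal_le_self

end Seminorms

section Primitive

open Filter Topology

variable {A : Type*} [NormedRing A] [NormedAlgebra ℂ A] [StarRing A] [StarModule ℂ A]
  [CStarRing A] [CompleteSpace A]

/-- The primitive `Z = Z₀ + J_{0·}(U ♯ dX)` of the rough integral with initial value `Z₀`. -/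
noncomputable def roughPrimitive (F : Filtr A) (γ T : ℝ) (X : ℝ → A)
    (XX : ∀ s : ℝ, ℝ → (PT (F.alg s) 2 →L[ℂ] A)) (U : ∀ t, PT (F.alg t) 2)
    (U1 U2 : ∀ t, PT (F.alg t) 3) (Z₀ : A) (t : ℝ) : A :=
  Z₀ + roughInt F γ T X XX U U1 U2 0 t

variable {F : Filtr A} {γ T : ℝ} {X : ℝ → A} {XX : ∀ s : ℝ, ℝ → (PT (F.alg s) 2 →L[ℂ] A)}
  {U : ∀ t, PT (F.alg t) 2} {U1 U2 : ∀ t, PT (F.alg t) 3} {Z₀ : A} {s t : ℝ}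

namespace IsRoughData

variable (h : IsRoughData F γ T X XX U U1 U2)
include h

theorem expansion_mem (hs : 0 ≤ s) (hst : s ≤ t) (ht : t ≤ T) :
    expansion F X XX U U1 U2 s t ∈ F.alg t := by
  let S : Submodule ℂ A := Subalgebra.toSubmodule (F.alg t).toSubalgebra
  have hS : IsClosed (S : Set A) := h.isClosed_alg t
  have incr_mem : incr X s t ∈ F.alg t :=
    sub_mem (h.mem t t (hs.trans hst) le_rfl) (h.mem s t hs hst)
  have coe_mem (x : F.alg s) : (x : A) ∈ F.alg t := F.mono hst x.2
  have sharp_mem : sharp (emb F U s) (incr X s t) ∈ S := by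
    refine PT.map_mem ((sharpCLM A (incr X s t)).comp (mapPT (incl (F.alg s)) 2)) hS
      (fun v ↦ ?_) (U s)
    rw [ContinuousLinearMap.comp_apply, mapPT_tens, sharpCLM_apply, sharp_tens]
    exact mul_mem (s := F.alg t) (mul_mem (coe_mem _) incr_mem) (coe_mem _)
  have timesId_mem : timesId (XX s t) (U1 s) ∈ S := by
    refine PT.map_mem _ hS (fun v ↦ ?_) _
    rw [timesId_tens]
    exact mul_mem (s := F.alg t) (h.area_mem hs hst ht _) (coe_mem _)
  have idTimes_mem : idTimes (adjOp (XX s t)) (U2 s) ∈ S := by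
    refine PT.map_mem _ hS (fun v ↦ ?_) _
    rw [idTimes_tens, adjOp_tens₂]
    exact mul_mem (s := F.alg t) (coe_mem _) (star_mem (h.area_mem hs hst ht _))
  exact S.add_mem (S.add_mem sharp_mem timesId_mem) idTimes_mem

theorem roughInt_mem (hs : 0 ≤ s) (hst : s ≤ t) (ht : t ≤ T) :
    roughInt F γ T X XX U U1 U2 s t ∈ F.alg t := by
  have riemann_sums := (h.additiveOn_roughInt.mono hs ht).tendsto_sum_of_rpow h.one_lt hst
    fun x y hx hxy hy ↦ (h.holderBounds le_rfl le_rfl).norm_roughInt_sub_expansion_le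
      (hs.trans hx) hxy (hy.trans ht)
  refine (h.isClosed_alg t).mem_of_tendsto riemann_sums (Eventually.of_forall fun n ↦ ?_)
  refine sum_mem fun i hi ↦ ?_
  have hi_le := gridPt_le hst (Finset.mem_range.1 hi)
  exact F.mono hi_le (h.expansion_mem (hs.trans (le_gridPt hst n i))
    (gridPt_mono hst n i.le_succ) (hi_le.trans ht))

theorem roughPrimitive_zero : roughPrimitive F γ T X XX U U1 U2 Z₀ 0 = Z₀ := by
  rw [roughPrimitive, h.additiveOn_roughInt.diag le_rfl h.pos.le, add_zero]

theorem incr_roughPrimitive (hs : 0 ≤ s) (hst : s ≤ t) (ht : t ≤ T) :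
    incr (roughPrimitive F γ T X XX U U1 U2 Z₀) s t = roughInt F γ T X XX U U1 U2 s t := by
  rw [incr, roughPrimitive, roughPrimitive, h.additiveOn_roughInt 0 s t le_rfl hs hst ht]
  abel

theorem roughPrimitive_mem (hZ₀ : Z₀ ∈ F.alg 0) (ht : t ∈ Set.Icc 0 T) :
    roughPrimitive F γ T X XX U U1 U2 Z₀ t ∈ F.alg t :=
  add_mem (F.mono ht.1 hZ₀) (h.roughInt_mem le_rfl ht.1 ht.2)

theorem memC1_roughPrimitive :
    MemC1 γ (Set.Icc 0 T) (roughPrimitive F γ T X XX U U1 U2 Z₀) where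
  cont := continuousOn_const.add (h.continuousOn_roughInt.comp (f := fun t ↦ ((0 : ℝ), t))
    (by fun_prop) fun _ ht ↦ ⟨⟨le_rfl, h.pos.le⟩, ht, ht.1⟩)
  finite := holderSup_ne_top fun s hs t ht hst ↦ by
    rw [h.incr_roughPrimitive hs.1 hst.le ht.2]
    exact h.memC2_roughInt.norm_le h.γ_pos.ne' hs ht hst.le

theorem rem_roughPrimitive (hs : 0 ≤ s) (hst : s ≤ t) (ht : t ≤ T) :
    rem F X (roughPrimitive F γ T X XX U U1 U2 Z₀) U s t =
      roughInt F γ T X XX U U1 U2 s t - sharp (emb F U s) (incr X s t) := by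
  rw [rem, h.incr_roughPrimitive hs hst ht]

theorem isControlled_roughPrimitive (hZ₀ : Z₀ ∈ F.alg 0) :
    IsControlled F γ T X (roughPrimitive F γ T X XX U U1 U2 Z₀) U where
  adapted _ ht := h.roughPrimitive_mem hZ₀ ht
  holder := h.memC1_roughPrimitive
  holder_deriv := h.bicontrolled.holder
  rem_mem := memC2_of_norm_le (mul_pos two_pos h.γ_pos).ne'
    ((continuousOn_incr h.memC1_roughPrimitive.cont).sub h.continuousOn_sharp_incr)
    fun _ hs _ ht hst ↦ (congrArg norm (h.rem_roughPrimitive hs.1 hst ht.2)).trans_le <|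
      (h.holderBounds le_rfl le_rfl).norm_roughInt_sub_sharp_le hs.1 hst ht.2

theorem isControlled_roughPrimitive_sub :
    IsControlled F γ T X (fun t ↦ roughPrimitive F γ T X XX U U1 U2 Z₀ t - Z₀) U := by
  have sub_eq : (fun t ↦ roughPrimitive F γ T X XX U U1 U2 Z₀ t - Z₀) =
      roughPrimitive F γ T X XX U U1 U2 0 := by
    ext t
    simp [roughPrimitive]
  exact sub_eq ▸ h.isControlled_roughPrimitive (zero_mem _)

end IsRoughData

theorem eq_roughPrimitive {Z : ℝ → A} (hZ₀ : Z 0 = Z₀)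
    (hZ : incr Z 0 t = roughInt F γ T X XX U U1 U2 0 t) :
    Z t = roughPrimitive F γ T X XX U U1 U2 Z₀ t := by
  rw [roughPrimitive, ← hZ, ← hZ₀, incr, add_sub_cancel]

namespace HolderBounds

variable {l₁ l₂ : ℝ} {x ξ u m w v : ℝ≥0} (h : HolderBounds F γ T X XX U U1 U2 l₁ l₂ x ξ u m w v)
include h

theorem normQ_roughPrimitive_le {L τ R : ℝ≥0} (hL : (L : ℝ) = (l₂ - l₁) ^ γ)
    (hτ : (τ : ℝ) = T ^ γ) (hR : R = sewC (3 * γ) * (ξ * w + x * v) * L + ξ * m) :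
    normQ F γ (Set.Icc l₁ l₂) X (roughPrimitive F γ T X XX U U1 U2 Z₀) U ≤
      ((R * τ + x * u) + u + (L * v + x * m) + R : ℝ≥0) := by
  have hR_coe : (R : ℝ) = sewC (3 * γ) * (ξ * w + x * v) * (l₂ - l₁) ^ γ + ξ * m := by
    simp [hR, hL]
  rw [normQ, ENNReal.coe_add _ R, ENNReal.coe_add _ (L * v + x * m), ENNReal.coe_add _ u]
  refine add_le_add (add_le_add (add_le_add ?_ (N0_le h.biprocess)) ?_) ?_
  · refine holderSup_le fun s hs t ht hst ↦ ?_
    rw [h.incr_roughPrimitive (h.zero_le.trans hs.1) hst.le (ht.2.trans h.le_T)]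
    simpa [hR_coe, hτ] using h.norm_roughInt_le hs.1 hst.le ht.2
  · refine holderSup_le fun s hs t ht hst ↦ ?_
    simpa [hL] using h.norm_incr_emb_le hs.1 hst.le ht.2
  · refine holderSup_le fun s hs t ht hst ↦ ?_
    rw [h.rem_roughPrimitive (h.zero_le.trans hs.1) hst.le (ht.2.trans h.le_T), hR_coe]
    exact h.norm_roughInt_sub_sharp_le hs.1 hst.le ht.2

theorem normQ_roughPrimitive_le_mul {L τ B : ℝ≥0} (hL : (L : ℝ) = (l₂ - l₁) ^ γ)
    (hτ : (τ : ℝ) = T ^ γ) (hu : u ≤ B) (hm : m ≤ B) (hw : L * w ≤ B) (hv : L * v ≤ B) :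
    normQ F γ (Set.Icc l₁ l₂) X (roughPrimitive F γ T X XX U U1 U2 Z₀) U ≤
      ((2 + (2 + sewC (3 * γ) * (1 + τ)) * x + (sewC (3 * γ) + 1) * (1 + τ) * ξ) * B : ℝ≥0) := by
  refine (h.normQ_roughPrimitive_le hL hτ rfl).trans (ENNReal.coe_le_coe.2 ?_)
  have remainder_le : sewC (3 * γ) * (ξ * w + x * v) * L + ξ * m ≤
      ((sewC (3 * γ) + 1) * ξ + sewC (3 * γ) * x) * B :=
    calc sewC (3 * γ) * (ξ * w + x * v) * L + ξ * m
        = sewC (3 * γ) * (ξ * (L * w) + x * (L * v)) + ξ * m := by ring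
      _ ≤ sewC (3 * γ) * (ξ * B + x * B) + ξ * B := by gcongr
      _ = ((sewC (3 * γ) + 1) * ξ + sewC (3 * γ) * x) * B := by ring
  grw [remainder_le, hu, hv, hm]
  exact le_of_eq (by ring)

end HolderBounds

theorem IsRoughData.normQ_roughPrimitive_le (h : IsRoughData F γ T X XX U U1 U2) {l₁ l₂ : ℝ}
    {τ : ℝ≥0} (hτ : (τ : ℝ) = T ^ γ) (hl₁ : 0 ≤ l₁) (hl : l₁ ≤ l₂) (hl₂ : l₂ ≤ T) :
    normQ F γ (Set.Icc l₁ l₂) X (roughPrimitive F γ T X XX U U1 U2 Z₀) U ≤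
      (2 + (2 + sewC (3 * γ) * (1 + τ) : ℝ≥0) * N1 γ (Set.Icc 0 T) X +
        ((sewC (3 * γ) + 1) * (1 + τ) : ℝ≥0) * areaNorm F (2 * γ) T XX) *
      (1 + N0 (Set.Icc l₁ l₂) (emb F U) + ENNReal.ofReal ‖emb F U1 l₁‖ +
        ENNReal.ofReal ‖emb F U2 l₁‖ +
        ENNReal.ofReal ((l₂ - l₁) ^ γ) * normBQ F γ (Set.Icc l₁ l₂) X U U1 U2) := by
  set I := Set.Icc l₁ l₂
  set L := ((l₂ - l₁) ^ γ).toNNReal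
  set u := (N0 I (emb F U)).toNNReal
  set w := (N1 γ I (emb F U1)).toNNReal + (N1 γ I (emb F U2)).toNNReal
  set v := (N2 (2 * γ) I (birem F X U U1 U2)).toNNReal
  set m := ‖emb F U1 l₁‖₊ + ‖emb F U2 l₁‖₊
  have hL : (L : ℝ) = (l₂ - l₁) ^ γ := Real.coe_toNNReal _ (Real.rpow_nonneg (sub_nonneg.2 hl) γ)
  set B := 1 + u + m + L * (w + v) with hB
  have B_eq : B = u + (m + L * w) + L * v + 1 := by rw [hB]; ring
  have m_le : m + L * w ≤ B := B_eq ▸ le_add_self.trans (le_self_add.trans le_self_add)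
  have u_le : u ≤ B := B_eq ▸ le_self_add.trans (le_self_add.trans le_self_add)
  have v_le : L * v ≤ B := B_eq ▸ le_add_self.trans le_self_add
  have B_le : (B : ℝ≥0∞) ≤ 1 + N0 I (emb F U) + ENNReal.ofReal ‖emb F U1 l₁‖ +
      ENNReal.ofReal ‖emb F U2 l₁‖ +
      ENNReal.ofReal ((l₂ - l₁) ^ γ) * normBQ F γ I X U U1 U2 := by
    rw [hB, ENNReal.coe_add, ENNReal.coe_add, ENNReal.coe_add, ENNReal.coe_add, ENNReal.coe_mul,
      ENNReal.coe_one, ofReal_norm, ofReal_norm, ← add_assoc]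
    exact add_le_add (add_le_add_left (add_le_add_left
      (add_le_add_right ENNReal.coe_toNNReal_le_self _) _) _)
      (mul_le_mul_right coe_toNNReal_add_le_normBQ _)
  have hX : ((N1 γ (Set.Icc 0 T) X).toNNReal : ℝ≥0∞) = N1 γ (Set.Icc 0 T) X :=
    ENNReal.coe_toNNReal h.holder.finite
  have hXX : ((areaNorm F (2 * γ) T XX).toNNReal : ℝ≥0∞) = areaNorm F (2 * γ) T XX :=
    ENNReal.coe_toNNReal h.area.holder
  grw [(h.holderBounds hl₁ hl₂).normQ_roughPrimitive_le_mul hL hτ u_le m_le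
    (le_add_self.trans m_le) v_le, ENNReal.coe_mul, B_le, ← hX, ← hXX]
  exact mul_le_mul_left (le_of_eq (by push_cast; rfl)) _

end Primitive

theorem IsTrace.isRoughData {H : Type*} [NormedAddCommGroup H] [InnerProductSpace ℂ H]
    [CompleteSpace H] {A : VonNeumannAlgebra H} {φ : A.toStarSubalgebra →ₗ[ℂ] ℂ}
    (hφ : IsTrace A φ) {γ T : ℝ} (hγ : 1 / 3 < γ) (hT : 0 < T) {X : ℝ → A.toStarSubalgebra}
    (hsa : ∀ t ∈ Set.Icc 0 T, IsSelfAdjoint (X t)) (hX : MemC1 γ (Set.Icc 0 T) X)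
    {XX : ∀ s : ℝ, ℝ → (PT ((genFiltr A X).alg s) 2 →L[ℂ] A.toStarSubalgebra)}
    (hXX : IsProductLevyArea (genFiltr A X) γ T X XX) {U : ∀ t, PT ((genFiltr A X).alg t) 2}
    {U1 U2 : ∀ t, PT ((genFiltr A X).alg t) 3}
    (hU : IsBicontrolled (genFiltr A X) γ T X U U1 U2) :
    IsRoughData (genFiltr A X) γ T X XX U U1 U2 where
  one_lt := by linarith
  pos := hT
  retraction t := by
    obtain ⟨Q, hQ⟩ := genFiltr_isCommutantOf A X t
    exact hφ.exists_retraction hQ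
  mem _ _ := mem_genFiltr A X
  selfAdjoint := hsa
  holder := hX
  area := hXX
  bicontrolled := hU

theorem proposition4p6_general (γ T : ℝ) :
    ∃ a b c : ℝ≥0,
    ∀ (A : Type u) [NormedRing A] [NormedAlgebra ℂ A] [StarRing A] [StarModule ℂ A] [CStarRing A]
      [CompleteSpace A] (F : Filtr A) (X : ℝ → A)
      (XX : ∀ s : ℝ, ℝ → (PT (F.alg s) 2 →L[ℂ] A)) (U : ∀ t, PT (F.alg t) 2)
      (U1 U2 : ∀ t, PT (F.alg t) 3), IsRoughData F γ T X XX U U1 U2 →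
    (MemC3 (3 * γ) (Set.Icc 0 T) (cobd (expansion F X XX U U1 U2)) ∧
      (∃ N, IsSewing (3 * γ) T (cobd (expansion F X XX U U1 U2)) N ∧
        ∀ N', IsSewing (3 * γ) T (cobd (expansion F X XX U U1 U2)) N' →
          ∀ s t, 0 ≤ s → s ≤ t → t ≤ T → N' s t = N s t) ∧
      MemC2 γ (Set.Icc 0 T) (roughInt F γ T X XX U U1 U2)) ∧
    (∀ X' : ℝ → A, (∀ t ∈ Set.Icc 0 T, HasDerivWithinAt X (X' t) (Set.Icc 0 T) t) →
      IntervalIntegrable X' MeasureTheory.volume 0 T →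
      (∀ s t, 0 ≤ s → s ≤ t → t ≤ T → ∀ W : PT (F.alg s) 2,
        XX s t W = ∫ r in s..t, sharp (mapPT (incl (F.alg s)) 2 W) (incr X s r) * X' r) →
      ∀ s t, 0 ≤ s → s ≤ t → t ≤ T →
        IntervalIntegrable (fun r ↦ sharp (emb F U r) (X' r)) MeasureTheory.volume s t ∧
        roughInt F γ T X XX U U1 U2 s t = ∫ r in s..t, sharp (emb F U r) (X' r)) ∧
    (∀ Z₀ : A, ∃ Z : ℝ → A,
      (Z 0 = Z₀ ∧ ∀ s t, 0 ≤ s → s ≤ t → t ≤ T →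
        incr Z s t = roughInt F γ T X XX U U1 U2 s t) ∧
      (∀ Z' : ℝ → A,
        (Z' 0 = Z₀ ∧ ∀ s t, 0 ≤ s → s ≤ t → t ≤ T →
          incr Z' s t = roughInt F γ T X XX U U1 U2 s t) →
        ∀ t ∈ Set.Icc 0 T, Z' t = Z t) ∧
      IsControlled F γ T X (fun t ↦ Z t - Z₀) U ∧
      (Z₀ ∈ F.alg 0 → IsControlled F γ T X Z U) ∧
      ∀ l₁ l₂, 0 ≤ l₁ → l₁ ≤ l₂ → l₂ ≤ T →
        normQ F γ (Set.Icc l₁ l₂) X Z U ≤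
          (a + b * N1 γ (Set.Icc 0 T) X + c * areaNorm F (2 * γ) T XX) *
            (1 + N0 (Set.Icc l₁ l₂) (emb F U) + ENNReal.ofReal ‖emb F U1 l₁‖ +
              ENNReal.ofReal ‖emb F U2 l₁‖ +
              ENNReal.ofReal ((l₂ - l₁) ^ γ) * normBQ F γ (Set.Icc l₁ l₂) X U U1 U2)) := by
  set τ := (T ^ γ).toNNReal
  refine ⟨2, 2 + sewC (3 * γ) * (1 + τ), (sewC (3 * γ) + 1) * (1 + τ),
    fun A _ _ _ _ _ _ F X XX U U1 U2 h ↦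
      ⟨⟨h.memC3_cobd_expansion, ?_, h.memC2_roughInt⟩, ?_, fun Z₀ ↦
        ⟨roughPrimitive F γ T X XX U U1 U2 Z₀,
          ⟨h.roughPrimitive_zero, fun s t ↦ h.incr_roughPrimitive⟩, ?_,
          h.isControlled_roughPrimitive_sub, h.isControlled_roughPrimitive, ?_⟩⟩⟩
  · obtain ⟨N, hN⟩ := h.exists_isSewing
    exact ⟨N, hN, fun N' hN' s t ↦ hN'.unique h.one_lt hN⟩
  · intro X' hX' hint hXX s t hs hst ht
    exact ⟨intervalIntegrable_mono (h.intervalIntegrable_sharp hint) hs hst ht,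
      h.roughInt_eq_integral hX' hint hXX hs hst ht⟩
  · rintro Z' ⟨hZ'₀, hZ'⟩ t ht
    exact eq_roughPrimitive hZ'₀ (hZ' 0 t le_rfl ht.1 ht.2)
  · intro l₁ l₂ hl₁ hl hl₂
    have hτ : (τ : ℝ) = T ^ γ := Real.coe_toNNReal _ (Real.rpow_nonneg h.pos.le γ)
    exact h.normQ_roughPrimitive_le hτ hl₁ hl hl₂

end ProductArea

open ProductArea in
theorem proposition4p6 (γ T : ℝ) (hγ : 1 / 3 < γ) (hT : 0 < T) :
    ∃ a b c : ℝ≥0,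
    ∀ (H : Type u) [NormedAddCommGroup H] [InnerProductSpace ℂ H] [CompleteSpace H]
      (A : VonNeumannAlgebra H) (φ : A.toStarSubalgebra →ₗ[ℂ] ℂ), IsTrace A φ →
    ∀ X : ℝ → A.toStarSubalgebra,
      (∀ t ∈ Set.Icc 0 T, IsSelfAdjoint (X t)) →
      MemC1 γ (Set.Icc 0 T) X →
    ∀ XX : (∀ s : ℝ, ℝ → (PT ((genFiltr A X).alg s) 2 →L[ℂ] A.toStarSubalgebra)),
      IsProductLevyArea (genFiltr A X) γ T X XX →
    ∀ (U : ∀ t, PT ((genFiltr A X).alg t) 2) (U1 U2 : ∀ t, PT ((genFiltr A X).alg t) 3),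
      IsBicontrolled (genFiltr A X) γ T X U U1 U2 →
    -- (i) the sewing map applies to `δM`, and the integral belongs to `C_2^γ`
    (MemC3 (3 * γ) (Set.Icc 0 T) (cobd (expansion (genFiltr A X) X XX U U1 U2)) ∧
      (∃ N, IsSewing (3 * γ) T (cobd (expansion (genFiltr A X) X XX U U1 U2)) N ∧
        ∀ N', IsSewing (3 * γ) T (cobd (expansion (genFiltr A X) X XX U U1 U2)) N' →
          ∀ s t, 0 ≤ s → s ≤ t → t ≤ T → N' s t = N s t) ∧
      MemC2 γ (Set.Icc 0 T) (roughInt (genFiltr A X) γ T X XX U U1 U2)) ∧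
    -- (ii) the differentiable case
    (∀ X' : ℝ → A.toStarSubalgebra,
      (∀ t ∈ Set.Icc 0 T, HasDerivWithinAt X (X' t) (Set.Icc 0 T) t) →
      IntervalIntegrable X' MeasureTheory.volume 0 T →
      (∀ s t, 0 ≤ s → s ≤ t → t ≤ T → ∀ W : PT ((genFiltr A X).alg s) 2,
        XX s t W =
          ∫ r in s..t, sharp (mapPT (incl ((genFiltr A X).alg s)) 2 W) (incr X s r) * X' r) →
      ∀ s t, 0 ≤ s → s ≤ t → t ≤ T →
        IntervalIntegrable (fun r => sharp (emb (genFiltr A X) U r) (X' r))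
          MeasureTheory.volume s t ∧
        roughInt (genFiltr A X) γ T X XX U U1 U2 s t =
          ∫ r in s..t, sharp (emb (genFiltr A X) U r) (X' r)) ∧
    -- (iii) and (iv): the primitive and its bound
    (∀ Z₀ : A.toStarSubalgebra, ∃ Z : ℝ → A.toStarSubalgebra,
      (Z 0 = Z₀ ∧ ∀ s t, 0 ≤ s → s ≤ t → t ≤ T →
        incr Z s t = roughInt (genFiltr A X) γ T X XX U U1 U2 s t) ∧
      (∀ Z' : ℝ → A.toStarSubalgebra,
        (Z' 0 = Z₀ ∧ ∀ s t, 0 ≤ s → s ≤ t → t ≤ T →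
          incr Z' s t = roughInt (genFiltr A X) γ T X XX U U1 U2 s t) →
        ∀ t ∈ Set.Icc 0 T, Z' t = Z t) ∧
      IsControlled (genFiltr A X) γ T X (fun t => Z t - Z₀) U ∧
      (Z₀ ∈ (genFiltr A X).alg 0 → IsControlled (genFiltr A X) γ T X Z U) ∧
      ∀ l₁ l₂, 0 ≤ l₁ → l₁ ≤ l₂ → l₂ ≤ T →
        normQ (genFiltr A X) γ (Set.Icc l₁ l₂) X Z U ≤
          (a + b * N1 γ (Set.Icc 0 T) X + c * areaNorm (genFiltr A X) (2 * γ) T XX) *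
            (1 + N0 (Set.Icc l₁ l₂) (emb (genFiltr A X) U)
              + ENNReal.ofReal ‖emb (genFiltr A X) U1 l₁‖
              + ENNReal.ofReal ‖emb (genFiltr A X) U2 l₁‖
              + ENNReal.ofReal ((l₂ - l₁) ^ γ) *
                  normBQ (genFiltr A X) γ (Set.Icc l₁ l₂) X U U1 U2)) := by
  obtain ⟨a, b, c, h⟩ := proposition4p6_general γ T
  exact ⟨a, b, c, fun H _ _ _ A φ hφ X hsa hX XX hXX U U1 U2 hU ↦
    h _ _ X XX U U1 U2 (hφ.isRoughData hγ hT hsa hX hXX hU)⟩
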